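/- Let $k$ be an algebraically closed field. A quiver setting $(Q,d)$ is a finite quiver $Q$ with a dimension vector $d\in\mathbb N^{Q_0}$. It is *representation finite* if there are only finitely many isomorphism classes of tuples of linear maps $(M_\alpha\colon k^{d(s\alpha)}\to k^{d(t\alpha)})_{\alpha\in Q_1}$, where $M\cong N$ if there are $g_x\in \mathrm{GL}_{d(x)}(k)$ with $N_\alpha=g_{t\alpha}M_\alpha g_{s\alpha}^{-1}$ for all arrows $\alpha$. Write $(Q,d)\le(Q',d')$ if there is an injective quiver morphism $\psi\colon Q\to Q'$ with $d(x)\le d'(\psi x)$ for all $x$. Consider the following conditions on $(Q,d)$: 1. $Q$ has no cycles, i.e. there is no walk $(x_0,\dots,x_n)$ with $n>0$, $x_{i-1}$ and $x_i$ connected by an arrow (in either direction) for $1\le i\le n$, $x_{i-1}\ne x_{i+1}$ for $0<i<n$, and $x_0=x_n$; 2. if $d(x)\ge 2$, then at most three arrows start and at most three arrows terminate at $x$; 3. if $\alpha$ is an arrow with $d(s\alpha)\ge 2$ and $d(t\alpha)\ge 2$, then the number of arrows starting at $s\alpha$ plus the number of arrows terminating at $t\alpha$ is at most $4$. Let $A$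 be a finite dimensional $k$-algebra with $\mathrm{rad}^2(A)=0$, let $\overline A:=A/\mathrm{rad}(A)\cong \mathbb M_{n_1}(k)\times\cdots\times \mathbb M_{n_l}(k)$ with all $n_i\geq 1$, let $\overline A_i$ be the $i$-th factor, and let $e_1,\dots,e_l\in A$ be idempotents lifting the identities of the factors. The setting $(\Delta_A,w_A)$ has the vertices $(0,i)$ and $(1,i)$ for $1\le i\le l$, with $w_A(0,i)=w_A(1,i)=n_i$; it has $r_{i,j}$ arrows $(1,j)\to(0,i)$, where $e_i\,\mathrm{rad}(A)\,e_j\cong \mathbb M_{n_i\times n_j}(k)^{r_{i,j}}$ as $\overline A_i$-$\overline A_j$-bimodules, and no other arrows. We say that $A$ has *finitely many orbits* if the action $(u,v)*a=uav^{-1}$ of $U(A)\times U(A)$ on $A$ has finitely many orbits, where $U(A)$ is the group of units of $A$. Then the following hold. * Let $Q_{\rm ex}$ be the quiver with vertices $a,b,c,u,v$ and arrows $a\to u$, $a\to v$, $b\to v$, $c\to v$, and let $d_{\rm ex}=(2,1,1;1,2)$, i.e. $d_{\rm ex}(a)=d_{\rm ex}(v)=2$ and $d_{\rm ex}(b)=d_{\rm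 ex}(c)=d_{\rm ex}(u)=1$. The setting $(Q_{\rm ex},d_{\rm ex})$ is representation finite; it satisfies (1) and (2), but violates (3). * (Sufficiency.) If $A$ is a finite dimensional $k$-algebra with $\mathrm{rad}^2(A)=0$ whose lattice of two-sided ideals is distributive, and $(\Delta_A,w_A)$ satisfies (1), (2) and (3), then $A$ has finitely many orbits. * (Non-necessity.) There is a finite dimensional $k$-algebra $A$ with $\mathrm{rad}^2(A)=0$ and distributive lattice of two-sided ideals which has finitely many orbits and for which $(Q_{\rm ex},d_{\rm ex})\le(\Delta_A,w_A)$ and $(\Delta_A,w_A)$ satisfies (1) and (2) but violates (3). * Hence the following assertion (Okniński–Renner, Theorem 10) is false: a finite dimensional $k$-algebra $A$ with $\mathrm{rad}^2(A)=0$ and distributive lattice of two-sided ideals has finitely many orbits if and only if $(\Delta_A,w_A)$ satisfies (1), (2) and (3). -/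

import Mathlib

universe u v

/-! ### Quiver settings

A quiver setting is a quiver on a finite vertex type `V` (with finitely many arrows) together with
a dimension vector `d : V → ℕ`. -/

/-- Representations of the quiver `V` of dimension vector `d`: a linear map
`k ^ d x → k ^ d y` for every arrow `x ⟶ y`. -/
def QuiverRep (k : Type u) [Field k] {V : Type} [Quiver.{0} V] (d : V → ℕ) : Type u :=
  ∀ ⦃x y : V⦄, (x ⟶ y) → ((Fin (d x) → k) →ₗ[k] (Fin (d y) → k))

/-- Isomorphism of representations of the same dimension vector:
`N α = g y ∘ M α ∘ (g x)⁻¹` for all arrows `α : x ⟶ y`, for some `g ∈ GL(d)`. -/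
def QuiverRep.Iso {k : Type u} [Field k] {V : Type} [Quiver.{0} V] {d : V → ℕ}
    (M N : QuiverRep k d) : Prop :=
  ∃ g : ∀ x : V, (Fin (d x) → k) ≃ₗ[k] (Fin (d x) → k),
    ∀ ⦃x y : V⦄ (α : x ⟶ y), N α = (g y).toLinearMap ∘ₗ M α ∘ₗ (g x).symm.toLinearMap

/-- Isomorphism as an equivalence relation; its classes are the `GL(d)`-orbits. -/
def QuiverRep.isoSetoid (k : Type u) [Field k] {V : Type} [Quiver.{0} V] (d : V → ℕ) :
    Setoid (QuiverRep k d) where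
  r := QuiverRep.Iso
  iseqv :=
    { refl := fun M => ⟨fun _ => LinearEquiv.refl k _, fun x y α => by ext; simp⟩
      symm := by
        rintro M N ⟨g, hg⟩
        refine ⟨fun x => (g x).symm, fun x y α => ?_⟩
        rw [hg α]
        ext; simp
      trans := by
        rintro M N P ⟨g, hg⟩ ⟨h, hh⟩
        refine ⟨fun x => (g x).trans (h x), fun x y α => ?_⟩
        rw [hh α, hg α]
        ext; simp }

/-- The quiver setting `(V, d)` is representation finite over `k`: there are only finitely many
representations of dimension vector `d` up to isomorphism. -/
def RepresentationFinite (k : Type u) [Field k] {V : Type} [Quiver.{0} V] (d : V → ℕ) : Prop :=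
  Finite (Quotient (QuiverRep.isoSetoid k d))

/-- `(V, d) ≤ (W, d')`: there is an injective quiver morphism `ψ : V → W` with
`d x ≤ d' (ψ x)` for all vertices `x`. -/
def SettingLE {V W : Type} [Quiver.{0} V] [Quiver.{0} W] (d : V → ℕ) (d' : W → ℕ) : Prop :=
  ∃ ψ : V ⥤q W, Function.Injective ψ.obj ∧
    (∀ x y : V, Function.Injective (fun α : x ⟶ y => ψ.map α)) ∧
    ∀ x, d x ≤ d' (ψ.obj x)

/-- `x` and `y` are connected by an arrow, in either direction. -/
def ArrowConnected {V : Type} [Quiver.{0} V] (x y : V) : Prop :=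
  Nonempty (x ⟶ y) ∨ Nonempty (y ⟶ x)

/-- The quiver `V` has a cycle: a walk `(x 0, …, x n)`, `n > 0`, with `x 0 = x n` and
`x (i - 1) ≠ x (i + 1)` for all `0 < i < n`. -/
def HasCycle (V : Type) [Quiver.{0} V] : Prop :=
  ∃ (n : ℕ) (x : ℕ → V), 0 < n ∧ (∀ i < n, ArrowConnected (x i) (x (i + 1))) ∧
    (∀ i, 0 < i → i < n → x (i - 1) ≠ x (i + 1)) ∧ x 0 = x n

/-- The number of arrows starting at `x`. -/
noncomputable def outDeg {V : Type} [Quiver.{0} V] (x : V) : ℕ := Nat.card (Quiver.Star x)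

/-- The number of arrows terminating at `x`. -/
noncomputable def inDeg {V : Type} [Quiver.{0} V] (x : V) : ℕ := Nat.card (Quiver.Costar x)

/-- Condition (1): there are no cycles. (It does not involve the dimension vector.) -/
def ORCond1 {V : Type} [Quiver.{0} V] (_d : V → ℕ) : Prop := ¬ HasCycle V

/-- Condition (2): if `d x ≥ 2`, then at most three arrows start and at most three arrows
terminate at `x`. -/
def ORCond2 {V : Type} [Quiver.{0} V] (d : V → ℕ) : Prop :=
  ∀ x, 2 ≤ d x → outDeg x ≤ 3 ∧ inDeg x ≤ 3

/-- Condition (3): if `α : x ⟶ y` is an arrow with `d x ≥ 2` and `d y ≥ 2`, then the number of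
arrows starting at `x` plus the number of arrows terminating at `y` is at most `4`. -/
def ORCond3 {V : Type} [Quiver.{0} V] (d : V → ℕ) : Prop :=
  ∀ ⦃x y : V⦄, (x ⟶ y) → 2 ≤ d x → 2 ≤ d y → outDeg x + inDeg y ≤ 4

/-! ### The example -/

/-- The vertices of the example. -/
inductive ExVertex : Type
  | a | b | c | u | v

/-- The arrows `a → u`, `a → v`, `b → v`, `c → v`. -/
inductive ExArrow : ExVertex → ExVertex → Type
  | au : ExArrow .a .u
  | av : ExArrow .a .v
  | bv : ExArrow .b .v
  | cv : ExArrow .c .v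

instance : Quiver.{0} ExVertex := ⟨ExArrow⟩

/-- The dimension vector `(2, 1, 1; 1, 2)`. -/
def exDim : ExVertex → ℕ
  | .a => 2
  | .b => 1
  | .c => 1
  | .u => 1
  | .v => 2

/-! ### Algebras -/

/-- `b = u a v⁻¹` for units `u`, `v`; the classes are the orbits of `U(A) × U(A)` in `A`. -/
def unitOrbitSetoid (A : Type v) [Ring A] : Setoid A where
  r a b := ∃ u v : Aˣ, b = u * a * (v⁻¹ : Aˣ)
  iseqv :=
    { refl := fun a => ⟨1, 1, by simp⟩
      symm := by
        rintro a b ⟨u, v, rfl⟩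
        exact ⟨u⁻¹, v⁻¹, by simp [mul_assoc]⟩
      trans := by
        rintro a b c ⟨u, v, rfl⟩ ⟨u', v', rfl⟩
        exact ⟨u' * u, v' * v, by simp [mul_assoc]⟩ }

/-- `A` has finitely many `U(A)`-orbits. -/
def FinitelyManyUnitOrbits (A : Type v) [Ring A] : Prop :=
  Finite (Quotient (unitOrbitSetoid A))

/-- The square of the Jacobson radical of `A` is zero. -/
def RadSquareZero (A : Type v) [Ring A] : Prop :=
  ∀ x ∈ Ring.jacobson A, ∀ y ∈ Ring.jacobson A, x * y = 0

/-- The lattice of two-sided ideals of `A` is distributive. -/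
def IdealsDistributive (A : Type v) [Ring A] : Prop :=
  ∀ I J K : TwoSidedIdeal A, I ⊓ (J ⊔ K) = (I ⊓ J) ⊔ (I ⊓ K)

/-- The choices made in attaching a quiver setting to `A`: an isomorphism
`A / rad A ≃ M_{n₁}(k) × ⋯ × M_{n_l}(k)` with all `nᵢ` positive, and idempotents `eᵢ` of `A` lifting
the identity elements of the factors. -/
structure WedderburnData (k : Type u) [Field k] (A : Type v) [Ring A] [Algebra k A] where
  l : ℕ
  n : Fin l → ℕ
  n_pos : ∀ i, 0 < n i
  φ : (A ⧸ Ring.jacobson A) ≃ₐ[k] (∀ i, Matrix (Fin (n i)) (Fin (n i)) k)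
  e : Fin l → A
  e_idem : ∀ i, IsIdempotentElem (e i)
  e_lift : ∀ i, φ (Ideal.Quotient.mk (Ring.jacobson A) (e i)) = Pi.single i 1

namespace WedderburnData

variable {k : Type u} [Field k] {A : Type v} [Ring A] [Algebra k A]

/-- The subspace `eᵢ rad(A) eⱼ` of `A`. -/
def peirce (D : WedderburnData k A) (i j : Fin D.l) : Submodule k A :=
  ((Ring.jacobson A).restrictScalars k).map
    (LinearMap.mulLeft k (D.e i) ∘ₗ LinearMap.mulRight k (D.e j))

/-- `eᵢ rad(A) eⱼ` is isomorphic to `M_{nᵢ × nⱼ}(k) ^ r` as a bimodule over the `i`-th and the `j`-th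
factor of `A / rad A`. -/
def IsBimoduleRank (D : WedderburnData k A) (i j : Fin D.l) (r : ℕ) : Prop :=
  ∃ f : D.peirce i j ≃ₗ[k] (Fin r → Matrix (Fin (D.n i)) (Fin (D.n j)) k),
    ∀ (a b : A) (x y : D.peirce i j), (y : A) = D.e i * a * x * b * D.e j →
      ∀ t, f y t = D.φ (Ideal.Quotient.mk _ a) i * f x t * D.φ (Ideal.Quotient.mk _ b) j

/-- The rank `r_{i,j}` of the bimodule `eᵢ rad(A) eⱼ`, i.e. the (unique) number `r` with
`eᵢ rad(A) eⱼ ≃ M_{nᵢ × nⱼ}(k) ^ r`. -/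
noncomputable def rank (D : WedderburnData k A) (i j : Fin D.l) : ℕ :=
  sInf {r | D.IsBimoduleRank i j r}

/-- The vertices `(0, i)` and `(1, i)` of the quiver of `A`. -/
inductive Vertex (D : WedderburnData k A) : Type
  | zero (i : Fin D.l)
  | one (i : Fin D.l)

/-- The arrows of the quiver of `A`: there are `r_{i,j}` arrows from `(1, j)` to `(0, i)`, and no
others. -/
inductive Arrow (D : WedderburnData k A) : D.Vertex → D.Vertex → Type
  | mk (i j : Fin D.l) (m : Fin (D.rank i j)) : Arrow D (.one j) (.zero i)

instance (D : WedderburnData k A) : Quiver.{0} D.Vertex := ⟨D.Arrow⟩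

/-- The dimension vector of the setting of `A`: both `(0, i)` and `(1, i)` get `nᵢ`. -/
def dim (D : WedderburnData k A) : D.Vertex → ℕ
  | .zero i => D.n i
  | .one i => D.n i

/-- Every finite dimensional algebra with `rad² = 0` over an algebraically closed field admits
such data. -/
theorem nonempty_of_radSquareZero [IsAlgClosed k] [FiniteDimensional k A]
    (h : RadSquareZero A) : Nonempty (WedderburnData k A) := by
  have : IsArtinianRing A := IsArtinianRing.of_finite k A
  have : IsArtinianRing (A ⧸ Ring.jacobson A) := IsArtinianRing.of_finite k _
  have : IsSemisimpleRing (A ⧸ Ring.jacobson A) := inferInstance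
  obtain ⟨l, n, hn, ⟨φ⟩⟩ :=
    IsSemisimpleRing.exists_algEquiv_pi_matrix_of_isAlgClosed k (A ⧸ Ring.jacobson A)
  have key : ∀ i : Fin l, ∃ e : A, IsIdempotentElem e ∧
      Ideal.Quotient.mk (Ring.jacobson A) e = φ.symm (Pi.single i 1) := by
    intro i
    refine exists_isIdempotentElem_eq_of_ker_isNilpotent
      (Ideal.Quotient.mk (Ring.jacobson A)) ?_ _ (Ideal.Quotient.mk_surjective _) ?_
    · intro x hx
      rw [Ideal.mk_ker] at hx
      exact ⟨2, by rw [pow_two]; exact h x hx x hx⟩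
    · unfold IsIdempotentElem
      rw [← map_mul, ← Pi.single_mul, mul_one]
  choose e he hl using key
  exact ⟨⟨l, n, fun i => Nat.pos_of_ne_zero (hn i).out, φ, e, he, fun i => by simp [hl]⟩⟩

end WedderburnData

/-!
Let `rad² = 0`. Modulo the radical every element of `A` can be brought by units to an idempotent
`s`, which in the `i`-th matrix factor is the projection to the last `nᵢ - mᵢ` coordinates
(`exists_mul_mul_eq_one_sub`), and `s` lifts to an idempotent `f` of `A`. An element `a` over `s`
can be cleared outside the corner `(1 - f) rad(A) (1 - f)` by multiplying with elements of `1 +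
rad(A)` (`WedderburnData.orbit_eq_corner`). An element of it consists of `r_{i,j}` matrices of size `mᵢ
× mⱼ` for each pair `(i, j)`, that is, of a representation of the quiver of `A` of dimension
vector `m`, and any base change of this representation is induced by a pair of units of `A`. The
group acting at `(0, i)` is independent of the one at `(1, i)`, because the two come from left and
right multiplication. So `A` has finitely many orbits as soon as the quiver of `A` is
representation finite for every dimension vector `m ≤ n`
(`WedderburnData.finitelyManyUnitOrbits`).

If the ideals form a distributive lattice, then `r_{i,j} ≤ 1` (`WedderburnData.rank_le_one`):
otherwise three lines in a plane inside `k ^ r_{i,j}` give three ideals violating distributivity.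
The quiver is then a bipartite forest if condition (1) holds. Two representations glued at a
vertex of dimension at most one can be classified separately (`RepFinite.glue`), so the forest may
be cut at all such vertices; by conditions (2) and (3) only stars with three arms, which are
classified by triples of subspaces (`repFinite_star`, `finClasses_triples`), and disjoint unions
of chains (`flaggedFinite_of_ncard_le_two`) remain.

The example is of type `D₅`, and it would amount to two subspaces and a chain of two subspaces in
the space at `v`. But as this space has dimension two, at most one subspace besides zero and the
whole space occurs in the chain, and the classification of triples of subspaces suffices
(`IsExampleQuiver.repFinite`). An algebra whose quiver is the example together with isolated
vertices is the algebra of block matrices with blocks of sizes `2, 1, 1, 1, 2` whose off-diagonal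
blocks vanish except at four positions, one for each arrow. Its two-sided ideals are spanned by
matrix units, so that their lattice is distributive (`incidenceAlgebra.idealsDistributive`).
-/

open Module

/-! ### Extending partial isomorphisms of vector spaces -/

section LinearAlgebra

variable {k : Type*} [Field k]
variable {V V' W : Type*} [AddCommGroup V] [Module k V] [AddCommGroup V'] [Module k V']
  [AddCommGroup W] [Module k W]

/-- A linear map can be changed outside a subspace `U` so that it takes a prescribed value at a
prescribed vector outside `U`. -/
lemma exists_linearMap_eqOn_and_apply_eq (U : Submodule k V) (f : V →ₗ[k] V') {x : V} (hx : x ∉ U)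
    (y : V') : ∃ f' : V →ₗ[k] V', (∀ u ∈ U, f' u = f u) ∧ f' x = y := by
  obtain ⟨φ, hφx, hφU⟩ := Submodule.exists_le_ker_of_notMem hx
  refine ⟨f + φ.smulRight ((φ x)⁻¹ • (y - f x)), fun u hu => ?_, ?_⟩
  · have : φ u = 0 := hφU hu
    simp [this]
  · simp [smul_smul, hφx]

/-- Enlarging the domain on which a linear map is injective by one vector. -/
lemma injOn_sup_span_singleton {U : Submodule k V} {f : V →ₗ[k] V'} {x : V}
    (hf : ∀ u ∈ U, f u = 0 → u = 0) (hx : f x ∉ U.map f) :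
    ∀ u ∈ U ⊔ k ∙ x, f u = 0 → u = 0 := by
  intro w hw h0
  obtain ⟨u, hu, z, hz, rfl⟩ := Submodule.mem_sup.1 hw
  obtain ⟨c, rfl⟩ := Submodule.mem_span_singleton.1 hz
  have hc : c = 0 := by
    by_contra hc
    apply hx
    refine ⟨-c⁻¹ • u, U.smul_mem _ hu, ?_⟩
    have h1 : f u = - (c • f x) := by
      rw [map_add, map_smul] at h0
      exact eq_neg_of_add_eq_zero_left h0
    rw [map_smul, h1, smul_neg, neg_smul, neg_neg, smul_smul, inv_mul_cancel₀ hc, one_smul]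
  subst hc
  simp only [zero_smul, add_zero] at h0 ⊢
  exact hf u hu h0

lemma Submodule.map_congr_of_eqOn {U : Submodule k V} {f g : V →ₗ[k] V'}
    (h : ∀ u ∈ U, f u = g u) : U.map f = U.map g := by
  ext w
  simp only [Submodule.mem_map]
  exact exists_congr fun u => and_congr_right fun hu => by rw [h u hu]

lemma finrank_map_of_injOn {U : Submodule k V} {f : V →ₗ[k] V'}
    (hf : ∀ u ∈ U, f u = 0 → u = 0) : finrank k (U.map f) = finrank k U := by
  have h := LinearMap.finrank_range_of_inj (f := f.domRestrict U) (by
    rw [injective_iff_map_eq_zero]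
    rintro ⟨u, hu⟩ h
    exact Subtype.ext (hf u hu h))
  rwa [LinearMap.range_domRestrict] at h

variable [FiniteDimensional k V] [FiniteDimensional k V']

lemma finrank_map_add_finrank_inf_ker (T : Submodule k V) (α : V →ₗ[k] W) :
    finrank k (T.map α) + finrank k (T ⊓ LinearMap.ker α : Submodule k V) = finrank k T := by
  have e := LinearMap.finrank_range_add_finrank_ker (α.domRestrict T)
  rw [LinearMap.range_domRestrict] at e
  rw [← e, ← Submodule.map_comap_subtype, Submodule.finrank_map_subtype_eq]
  rfl

lemma exists_mem_notMem_of_finrank_lt {U T : Submodule k V} (h : finrank k U < finrank k T) :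
    ∃ x ∈ T, x ∉ U := by
  by_contra! hc
  exact absurd (Submodule.finrank_mono (show T ≤ U from hc)) (by omega)

/-- Dimension count behind the extension lemmas: a linear map injective on `U`, taking `U` into
`T'`, leaves room in `T'` if `U` is smaller than `T`. -/
lemma exists_mem_notMem_map {U T : Submodule k V} {T' : Submodule k V'} {f : V →ₗ[k] V'}
    (hUT : U ≤ T) (hf : ∀ u ∈ U, f u = 0 → u = 0) (hdim : finrank k T = finrank k T')
    {x : V} (hx : x ∈ T) (hxU : x ∉ U) : ∃ y ∈ T', y ∉ U.map f := by
  apply exists_mem_notMem_of_finrank_lt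
  rw [finrank_map_of_injOn hf, ← hdim]
  exact Submodule.finrank_lt_finrank_of_lt (lt_of_le_of_ne hUT (by rintro rfl; exact hxU hx))

/-- Let `α : V → W` and `α' : V' → W` have the same image on the equidimensional subspaces `T`
and `T'`. A partial isomorphism over `W`, defined on `U ≤ T` with values in `T'`, extends to one
from `T` onto `T'`. -/
lemma exists_extend_over (α : V →ₗ[k] W) (α' : V' →ₗ[k] W) (T : Submodule k V)
    (T' : Submodule k V') (himg : T.map α = T'.map α') (hdim : finrank k T = finrank k T') :
    ∀ (n : ℕ) (U : Submodule k V) (f : V →ₗ[k] V'), finrank k T ≤ finrank k U + n → U ≤ T →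
      (∀ u ∈ U, f u = 0 → u = 0) → U.map f ≤ T' → (∀ u ∈ U, α' (f u) = α u) →
      ∃ h : V →ₗ[k] V', (∀ u ∈ U, h u = f u) ∧ (∀ u ∈ T, h u = 0 → u = 0) ∧ T.map h = T' ∧
        ∀ u ∈ T, α' (h u) = α u := by
  intro n
  induction n with
  | zero =>
    intro U f hn hUT hf hU hα
    obtain rfl : U = T := Submodule.eq_of_le_of_finrank_le hUT hn
    exact ⟨f, fun _ _ => rfl, hf,
      Submodule.eq_of_le_of_finrank_le hU (by rw [finrank_map_of_injOn hf, hdim]), hα⟩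
  | succ n ih =>
    intro U f hn hUT hf hU hα
    by_cases hUT' : T ≤ U
    · exact ih U f (le_trans (Submodule.finrank_mono hUT') (by omega)) hUT hf hU hα
    -- It suffices to find one more vector together with its image.
    suffices hs : ∃ x ∈ T, x ∉ U ∧ ∃ y ∈ T', y ∉ U.map f ∧ α' y = α x by
      obtain ⟨x, hxT, hxU, y, hyT, hyU, hxy⟩ := hs
      obtain ⟨f', hf'U, hf'x⟩ := exists_linearMap_eqOn_and_apply_eq U f hxU y
      have hmap : U.map f' = U.map f := Submodule.map_congr_of_eqOn hf'U
      have hrank : finrank k T ≤ finrank k (U ⊔ k ∙ x : Submodule k V) + n := by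
        have : finrank k U < finrank k (U ⊔ k ∙ x : Submodule k V) := by
          apply Submodule.finrank_lt_finrank_of_lt
          refine lt_of_le_of_ne le_sup_left fun h => hxU ?_
          rw [h]
          exact Submodule.mem_sup_right (Submodule.mem_span_singleton_self x)
        omega
      refine Exists.imp (fun h hh => ⟨fun u hu => (hh.1 u (Submodule.mem_sup_left hu)).trans
        (hf'U u hu), hh.2⟩) (ih (U ⊔ k ∙ x) f' hrank ?_ ?_ ?_ ?_)
      · exact sup_le hUT ((Submodule.span_singleton_le_iff_mem _ _).2 hxT)
      · refine injOn_sup_span_singleton (fun u hu h => hf u hu (hf'U u hu ▸ h)) ?_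
        rwa [hmap, hf'x]
      · rw [Submodule.map_sup, hmap, Submodule.map_span, Set.image_singleton, hf'x]
        exact sup_le hU ((Submodule.span_singleton_le_iff_mem _ _).2 hyT)
      · intro w hw
        obtain ⟨u, hu, z, hz, rfl⟩ := Submodule.mem_sup.1 hw
        obtain ⟨c, rfl⟩ := Submodule.mem_span_singleton.1 hz
        simp [hf'U u hu, hf'x, hα u hu, hxy]
    by_cases hker : ∃ x ∈ T, x ∉ U ∧ α x = 0
    · -- Match a kernel vector outside `U` with a kernel vector outside the image of `U`.
      obtain ⟨x, hxT, hxU, hx0⟩ := hker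
      have hmap : U.map f ⊓ LinearMap.ker α' = (U ⊓ LinearMap.ker α).map f := by
        ext w
        constructor
        · rintro ⟨⟨u, hu, rfl⟩, hw⟩
          exact ⟨u, ⟨hu, by simpa [hα u hu] using hw⟩, rfl⟩
        · rintro ⟨u, ⟨hu, hu0⟩, rfl⟩
          exact ⟨⟨u, hu, rfl⟩, by simpa [hα u hu] using hu0⟩
      have hlt : finrank k (U.map f ⊓ LinearMap.ker α' : Submodule k V') <
          finrank k (T' ⊓ LinearMap.ker α' : Submodule k V') := by
        rw [hmap, finrank_map_of_injOn (U := U ⊓ LinearMap.ker α) fun u hu => hf u hu.1]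
        have e1 := finrank_map_add_finrank_inf_ker T α
        have e2 := finrank_map_add_finrank_inf_ker T' α'
        have e3 : finrank k (U ⊓ LinearMap.ker α : Submodule k V) <
            finrank k (T ⊓ LinearMap.ker α : Submodule k V) := by
          apply Submodule.finrank_lt_finrank_of_lt
          refine lt_of_le_of_ne (inf_le_inf_right _ hUT) fun h => hxU ?_
          have : x ∈ T ⊓ LinearMap.ker α := ⟨hxT, hx0⟩
          exact (h ▸ this).1
        rw [himg] at e1
        omega
      obtain ⟨y, hy, hyU⟩ := exists_mem_notMem_of_finrank_lt hlt
      exact ⟨x, hxT, hxU, y, hy.1, fun h => hyU ⟨h, hy.2⟩, by rw [hx0]; exact hy.2⟩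
    · push Not at hker
      obtain ⟨x, hxT, hxU⟩ := SetLike.not_le_iff_exists.1 hUT'
      obtain ⟨y, hyT, hxy⟩ : α x ∈ T'.map α' := himg ▸ Submodule.mem_map_of_mem hxT
      refine ⟨x, hxT, hxU, y, hyT, ?_, hxy⟩
      rintro ⟨u, hu, rfl⟩
      have : x - u ∈ U := by
        by_contra hc
        exact hker _ (T.sub_mem hxT (hUT hu)) hc (by rw [map_sub, ← hxy, hα u hu, sub_self])
      exact hxU (by simpa using U.add_mem this hu)

/-- Dual form of `exists_extend_over`: a partial isomorphism under `W`, i.e. compatible with maps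
`β : W → V` and `β' : W → V'`, extends to one from `T` onto `T'`. -/
lemma exists_extend_under (β : W →ₗ[k] V) (β' : W →ₗ[k] V') (T : Submodule k V)
    (T' : Submodule k V') (hcomap : T.comap β = T'.comap β') (hdim : finrank k T = finrank k T') :
    ∀ (n : ℕ) (U : Submodule k V) (f : V →ₗ[k] V'), finrank k T ≤ finrank k U + n → U ≤ T →
      (∀ u ∈ U, f u = 0 → u = 0) → U.map f ≤ T' → U.comap β = (U.map f).comap β' →
      (∀ w, β w ∈ U → f (β w) = β' w) →
      ∃ h : V →ₗ[k] V', (∀ u ∈ U, h u = f u) ∧ (∀ u ∈ T, h u = 0 → u = 0) ∧ T.map h = T' ∧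
        ∀ w, β w ∈ T → h (β w) = β' w := by
  intro n
  induction n with
  | zero =>
    intro U f hn hUT hf hU _ hβ
    obtain rfl : U = T := Submodule.eq_of_le_of_finrank_le hUT hn
    exact ⟨f, fun _ _ => rfl, hf,
      Submodule.eq_of_le_of_finrank_le hU (by rw [finrank_map_of_injOn hf, hdim]), hβ⟩
  | succ n ih =>
    intro U f hn hUT hf hU hc hβ
    have hc' : ∀ w, β w ∈ U ↔ β' w ∈ U.map f := fun w => SetLike.ext_iff.1 hc w
    by_cases hUT' : T ≤ U
    · exact ih U f (le_trans (Submodule.finrank_mono hUT') (by omega)) hUT hf hU hc hβ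
    -- It suffices to find one more vector together with its image.
    suffices hs : ∃ x ∈ T, x ∉ U ∧ ∃ y ∈ T', y ∉ U.map f ∧
        ((∃ w₀, β w₀ = x ∧ β' w₀ = y) ∨ ∀ w, β w ∈ T → β w ∈ U) by
      obtain ⟨x, hxT, hxU, y, hyT, hyU, hxy⟩ := hs
      obtain ⟨f', hf'U, hf'x⟩ := exists_linearMap_eqOn_and_apply_eq U f hxU y
      have hmap : U.map f' = U.map f := Submodule.map_congr_of_eqOn hf'U
      have hT1 : U ⊔ k ∙ x ≤ T := sup_le hUT ((Submodule.span_singleton_le_iff_mem _ _).2 hxT)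
      have hmap1 : (U ⊔ k ∙ x).map f' = U.map f ⊔ k ∙ y := by
        rw [Submodule.map_sup, hmap, Submodule.map_span, Set.image_singleton, hf'x]
      have hT1' : (U ⊔ k ∙ x).map f' ≤ T' := by
        rw [hmap1]
        exact sup_le hU ((Submodule.span_singleton_le_iff_mem _ _).2 hyT)
      have hTT : ∀ w, β w ∈ T ↔ β' w ∈ T' := fun w => SetLike.ext_iff.1 hcomap w
      have hrank : finrank k T ≤ finrank k (U ⊔ k ∙ x : Submodule k V) + n := by
        have : finrank k U < finrank k (U ⊔ k ∙ x : Submodule k V) := by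
          apply Submodule.finrank_lt_finrank_of_lt
          refine lt_of_le_of_ne le_sup_left fun h => hxU ?_
          rw [h]
          exact Submodule.mem_sup_right (Submodule.mem_span_singleton_self x)
        omega
      refine Exists.imp (fun h hh => ⟨fun u hu => (hh.1 u (Submodule.mem_sup_left hu)).trans
        (hf'U u hu), hh.2⟩) (ih (U ⊔ k ∙ x) f' hrank hT1 ?_ hT1' ?_ ?_)
      · refine injOn_sup_span_singleton (fun u hu h => hf u hu (hf'U u hu ▸ h)) ?_
        rwa [hmap, hf'x]
      · rw [hmap1]
        ext w
        simp only [Submodule.mem_comap]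
        rcases hxy with ⟨w₀, rfl, rfl⟩ | hall
        · simp only [Submodule.mem_sup, Submodule.mem_span_singleton]
          constructor
          · rintro ⟨u, hu, _, ⟨c, rfl⟩, hw⟩
            refine ⟨β' (w - c • w₀), (hc' _).1 ?_, _, ⟨c, rfl⟩, by simp⟩
            rwa [map_sub, ← hw, map_smul, add_sub_cancel_right]
          · rintro ⟨u, hu, _, ⟨c, rfl⟩, hw⟩
            refine ⟨β (w - c • w₀), (hc' _).2 ?_, _, ⟨c, rfl⟩, by simp⟩
            rwa [map_sub, ← hw, map_smul, add_sub_cancel_right]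
        · refine ⟨fun h => Submodule.mem_sup_left ((hc' w).1 (hall w (hT1 h))),
            fun h => Submodule.mem_sup_left (hall w ((hTT w).2 (hT1' (hmap1 ▸ h))))⟩
      · intro w hw
        rcases hxy with ⟨w₀, rfl, rfl⟩ | hall
        · obtain ⟨u, hu, z, hz, hw⟩ := Submodule.mem_sup.1 hw
          obtain ⟨c, rfl⟩ := Submodule.mem_span_singleton.1 hz
          have hu' : β (w - c • w₀) = u := by
            rw [map_sub, ← hw, map_smul, add_sub_cancel_right]
          have := hβ (w - c • w₀) (hu' ▸ hu)
          rw [hu'] at this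
          rw [← hw, map_add, hf'U u hu, map_smul, hf'x, this]
          simp
        · rw [hf'U _ (hall w (hT1 hw)), hβ w (hall w (hT1 hw))]
    by_cases hr : ∃ w, β w ∈ T ∧ β w ∉ U
    · obtain ⟨w, hwT, hwU⟩ := hr
      exact ⟨β w, hwT, hwU, β' w, (SetLike.ext_iff.1 hcomap w).1 hwT,
        fun h => hwU ((hc' w).2 h), Or.inl ⟨w, rfl, rfl⟩⟩
    · push Not at hr
      obtain ⟨x, hxT, hxU⟩ := SetLike.not_le_iff_exists.1 hUT'
      obtain ⟨y, hyT, hyU⟩ := exists_mem_notMem_map hUT hf hdim hxT hxU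
      exact ⟨x, hxT, hxU, y, hyT, hyU, Or.inr hr⟩

/-- Linear maps `α, α'` to a common space which agree on flags `F`, `F'` of the same dimensions, in
the sense that `α (F i) = α' (F' i)`, differ by an isomorphism matching the flags. -/
lemma exists_flag_equiv_over (α : V →ₗ[k] W) (α' : V' →ₗ[k] W) {m : ℕ}
    {F : ℕ → Submodule k V} {F' : ℕ → Submodule k V'} (hF : Monotone F) (hF' : Monotone F')
    (hm : F m = ⊤) (hm' : F' m = ⊤) (himg : ∀ i ≤ m, (F i).map α = (F' i).map α')
    (hdim : ∀ i ≤ m, finrank k (F i) = finrank k (F' i)) :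
    ∃ h : V ≃ₗ[k] V', (∀ i, (F i).map (h : V →ₗ[k] V') = F' i) ∧ ∀ v, α' (h v) = α v := by
  have key : ∀ i ≤ m, ∃ f : V →ₗ[k] V', (∀ u ∈ F i, f u = 0 → u = 0) ∧
      (∀ j ≤ i, (F j).map f = F' j) ∧ ∀ u ∈ F i, α' (f u) = α u := by
    intro i
    induction i with
    | zero =>
      intro hi
      obtain ⟨h, -, h1, h2, h3⟩ := exists_extend_over α α' (F 0) (F' 0) (himg 0 hi) (hdim 0 hi)
        (finrank k (F 0)) ⊥ 0 (by simp) bot_le (by simp) (by simp) (by simp)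
      exact ⟨h, h1, fun j hj => by obtain rfl := Nat.le_zero.1 hj; exact h2, h3⟩
    | succ i ih =>
      intro hi
      obtain ⟨f, f1, f2, f3⟩ := ih (by omega)
      obtain ⟨h, h0, h1, h2, h3⟩ := exists_extend_over α α' (F (i + 1)) (F' (i + 1))
        (himg _ hi) (hdim _ hi) (finrank k (F (i + 1))) (F i) f (by omega) (hF (by omega)) f1
        ((f2 i le_rfl).le.trans (hF' (by omega))) f3
      refine ⟨h, h1, fun j hj => ?_, h3⟩
      rcases Nat.lt_succ_iff_lt_or_eq.1 (Nat.lt_succ_of_le hj) with hj | rfl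
      · rw [← f2 j (by omega)]
        exact Submodule.map_congr_of_eqOn fun u hu => h0 u (hF (by omega : j ≤ i) hu)
      · exact h2
  obtain ⟨f, f1, f2, f3⟩ := key m le_rfl
  have hinj : Function.Injective f := by
    rw [injective_iff_map_eq_zero]
    exact fun u => f1 u (hm ▸ Submodule.mem_top)
  have hVV : finrank k V = finrank k V' := by
    have := hdim m le_rfl
    rwa [hm, hm', finrank_top, finrank_top] at this
  refine ⟨LinearEquiv.ofInjectiveOfFinrankEq f hinj hVV, fun i => ?_, fun v => ?_⟩
  · rcases le_total i m with hi | hi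
    · exact f2 i hi
    · have e : F i = ⊤ := top_le_iff.1 (hm ▸ hF hi)
      have e' : F' i = ⊤ := top_le_iff.1 (hm' ▸ hF' hi)
      rw [e, e', Submodule.map_top, LinearEquiv.range]
  · exact f3 v (hm ▸ Submodule.mem_top)

/-- Linear maps `β, β'` from a common space with `β⁻¹ (F i) = β'⁻¹ (F' i)` for flags `F`, `F'` of
the same dimensions, and with the same kernel, differ by an isomorphism matching the flags. -/
lemma exists_flag_equiv_under (β : W →ₗ[k] V) (β' : W →ₗ[k] V') {m : ℕ}
    {F : ℕ → Submodule k V} {F' : ℕ → Submodule k V'} (hF : Monotone F) (hF' : Monotone F')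
    (hm : F m = ⊤) (hm' : F' m = ⊤) (hcomap : ∀ i ≤ m, (F i).comap β = (F' i).comap β')
    (hker : LinearMap.ker β = LinearMap.ker β')
    (hdim : ∀ i ≤ m, finrank k (F i) = finrank k (F' i)) :
    ∃ h : V ≃ₗ[k] V', (∀ i, (F i).map (h : V →ₗ[k] V') = F' i) ∧ ∀ w, h (β w) = β' w := by
  have key : ∀ i ≤ m, ∃ f : V →ₗ[k] V', (∀ u ∈ F i, f u = 0 → u = 0) ∧
      (∀ j ≤ i, (F j).map f = F' j) ∧ ∀ w, β w ∈ F i → f (β w) = β' w := by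
    intro i
    induction i with
    | zero =>
      intro hi
      obtain ⟨h, -, h1, h2, h3⟩ := exists_extend_under β β' (F 0) (F' 0) (hcomap 0 hi)
        (hdim 0 hi) (finrank k (F 0)) ⊥ 0 (by simp) bot_le (by simp) (by simp)
        (by simpa using hker) (by
          intro w hw
          have : w ∈ LinearMap.ker β := hw
          rw [hker] at this
          exact (LinearMap.mem_ker.1 this).symm)
      exact ⟨h, h1, fun j hj => by obtain rfl := Nat.le_zero.1 hj; exact h2, h3⟩
    | succ i ih =>
      intro hi
      obtain ⟨f, f1, f2, f3⟩ := ih (by omega)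
      obtain ⟨h, h0, h1, h2, h3⟩ := exists_extend_under β β' (F (i + 1)) (F' (i + 1))
        (hcomap _ hi) (hdim _ hi) (finrank k (F (i + 1))) (F i) f (by omega) (hF (by omega)) f1
        ((f2 i le_rfl).le.trans (hF' (by omega)))
        (by rw [f2 i le_rfl]; exact hcomap i (by omega)) f3
      refine ⟨h, h1, fun j hj => ?_, h3⟩
      rcases Nat.lt_succ_iff_lt_or_eq.1 (Nat.lt_succ_of_le hj) with hj | rfl
      · rw [← f2 j (by omega)]
        exact Submodule.map_congr_of_eqOn fun u hu => h0 u (hF (by omega : j ≤ i) hu)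
      · exact h2
  obtain ⟨f, f1, f2, f3⟩ := key m le_rfl
  have hinj : Function.Injective f := by
    rw [injective_iff_map_eq_zero]
    exact fun u => f1 u (hm ▸ Submodule.mem_top)
  have hVV : finrank k V = finrank k V' := by
    have := hdim m le_rfl
    rwa [hm, hm', finrank_top, finrank_top] at this
  refine ⟨LinearEquiv.ofInjectiveOfFinrankEq f hinj hVV, fun i => ?_, fun w => ?_⟩
  · rcases le_total i m with hi | hi
    · exact f2 i hi
    · have e : F i = ⊤ := top_le_iff.1 (hm ▸ hF hi)
      have e' : F' i = ⊤ := top_le_iff.1 (hm' ▸ hF' hi)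
      rw [e, e', Submodule.map_top, LinearEquiv.range]
  · exact f3 w (hm ▸ Submodule.mem_top)

end LinearAlgebra

/-! ### Relations with finitely many classes -/

/-- The relation `r` has finitely many classes: some map to a finite set only identifies related
elements. For an equivalence relation this says that the quotient is finite. -/
def FinClasses {X : Type*} (r : X → X → Prop) : Prop :=
  ∃ (n : ℕ) (φ : X → Fin n), ∀ x y, φ x = φ y → r x y

lemma FinClasses.of_finite {X : Type*} {r : X → X → Prop} {ι : Type*} [Finite ι] (φ : X → ι)
    (h : ∀ x y, φ x = φ y → r x y) : FinClasses r := by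
  obtain ⟨n, ⟨e⟩⟩ := Finite.exists_equiv_fin ι
  exact ⟨n, e ∘ φ, fun x y hxy => h x y (e.injective hxy)⟩

lemma FinClasses.finite_quotient {X : Type*} (s : Setoid X) (h : FinClasses s.r) :
    Finite (Quotient s) := by
  obtain ⟨n, φ, hφ⟩ := h
  refine Finite.of_injective (fun q : Quotient s => φ q.out) fun p q hpq => ?_
  rw [← Quotient.out_eq p, ← Quotient.out_eq q]
  exact Quotient.sound (hφ _ _ hpq)

/-! ### Triples of subspaces -/

section Triples

variable {k : Type u} [Field k]

section Splitting

variable {V : Type*} [AddCommGroup V] [Module k V] [FiniteDimensional k V]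

/-- A triple of subspaces splits off a line: up to an isomorphism `V ≃ k × k ^ n`, it is the direct
sum of a triple in `k` (given by the set `S` of indices with the full line) and a triple in
`k ^ n`. -/
def SplitsLine (n : ℕ) (U : Fin 3 → Submodule k V) (S : Set (Fin 3))
    (T : Fin 3 → Submodule k (Fin n → k)) : Prop :=
  ∃ e : V ≃ₗ[k] k × (Fin n → k), ∀ i c t, e.symm (c, t) ∈ U i ↔ (i ∉ S → c = 0) ∧ t ∈ T i

lemma SplitsLine.of_isCompl {n : ℕ} (hn : finrank k V = n + 1) {U : Fin 3 → Submodule k V} {x : V}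
    (hx : x ≠ 0) {Q : Submodule k V} (hQ : IsCompl (k ∙ x) Q) (hU : ∀ i, x ∈ U i ∨ U i ≤ Q) :
    ∃ S T, SplitsLine n U S T := by
  have hQn : finrank k Q = finrank k (Fin n → k) := by
    have := Submodule.finrank_add_eq_of_isCompl hQ
    rw [finrank_span_singleton hx, hn] at this
    rw [finrank_fin_fun]
    omega
  let eQ : Q ≃ₗ[k] (Fin n → k) := LinearEquiv.ofFinrankEq _ _ hQn
  let e : V ≃ₗ[k] k × (Fin n → k) := (Submodule.prodEquivOfIsCompl _ _ hQ).symm.trans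
    ((LinearEquiv.toSpanNonzeroSingleton k V x hx).symm.prodCongr eQ)
  have he : ∀ c t, e.symm (c, t) = c • x + eQ.symm t := by
    intro c t
    simp [e, LinearEquiv.trans_symm, LinearEquiv.prodCongr_symm]
  refine ⟨{i | x ∈ U i}, fun i => (U i).comap (Q.subtype ∘ₗ eQ.symm.toLinearMap), e,
    fun i c t => ?_⟩
  rw [he]
  simp only [Set.mem_ofPred_eq, Submodule.mem_comap, LinearMap.comp_apply, Submodule.subtype_apply,
    LinearEquiv.coe_coe]
  by_cases hxU : x ∈ U i
  · simp only [hxU, not_true, false_implies, true_and]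
    exact Submodule.add_mem_iff_right _ ((U i).smul_mem _ hxU)
  · simp only [hxU, not_false_iff, true_implies]
    constructor
    · intro h
      have h1 : c • x ∈ Q := by
        have := Q.sub_mem ((hU i).resolve_left hxU h) (eQ.symm t).2
        rwa [add_sub_cancel_right] at this
      have h2 : c • x = 0 := Submodule.disjoint_def.1 hQ.disjoint _
        (Submodule.smul_mem _ _ (Submodule.mem_span_singleton_self x)) h1
      have hc : c = 0 := (smul_eq_zero.1 h2).resolve_right hx
      subst hc
      exact ⟨rfl, by simpa using h⟩
    · rintro ⟨rfl, h⟩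
      simpa using h

/-- A triple of subspaces splits off a line unless the subspaces are pairwise complementary: a
vector in two of the subspaces, or a hyperplane containing two of them, can be completed to a
decomposition of the triple. -/
lemma exists_splitsLine_of_not_isCompl {n : ℕ} (hn : finrank k V = n + 1)
    {U : Fin 3 → Submodule k V} (hU : ¬ ∀ i j, i ≠ j → IsCompl (U i) (U j)) :
    ∃ S T, SplitsLine n U S T := by
  push Not at hU
  obtain ⟨i, j, hij, hU⟩ := hU
  obtain ⟨l, hl⟩ : ∃ l, ∀ p, p = i ∨ p = j ∨ p = l := by
    have : ∀ i j : Fin 3, i ≠ j → ∃ l, ∀ p, p = i ∨ p = j ∨ p = l := by decide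
    exact this i j hij
  by_cases hd : Disjoint (U i) (U j)
  · have hc : U i ⊔ U j ≠ ⊤ := fun h => hU ⟨hd, codisjoint_iff.2 h⟩
    obtain ⟨Q, hQ, hle⟩ := (eq_top_or_exists_le_coatom (U i ⊔ U j)).resolve_left hc
    obtain ⟨x, hxQ, hx⟩ : ∃ x, x ∉ Q ∧ (x ∈ U l ∨ U l ≤ Q) := by
      by_cases h : U l ≤ Q
      · obtain ⟨x, -, hx⟩ := SetLike.exists_of_lt hQ.lt_top
        exact ⟨x, hx, Or.inr h⟩
      · obtain ⟨x, hx, hxQ⟩ := SetLike.not_le_iff_exists.1 h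
        exact ⟨x, hxQ, Or.inl hx⟩
    have hx0 : x ≠ 0 := by
      rintro rfl
      exact hxQ Q.zero_mem
    refine SplitsLine.of_isCompl hn hx0 (Q := Q) ⟨?_, ?_⟩ fun p => ?_
    · exact (Submodule.disjoint_span_singleton' hx0).2 hxQ |>.symm
    · rw [codisjoint_iff, sup_comm]
      refine hQ.2 _ (lt_of_le_of_ne le_sup_left fun h => hxQ ?_)
      rw [h]
      exact Submodule.mem_sup_right (Submodule.mem_span_singleton_self x)
    · rcases hl p with rfl | rfl | rfl
      · exact Or.inr (le_sup_left.trans hle)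
      · exact Or.inr (le_sup_right.trans hle)
      · exact hx
  · rw [Submodule.disjoint_def] at hd
    push Not at hd
    obtain ⟨x, hxi, hxj, hx0⟩ := hd
    by_cases hxl : x ∈ U l
    · obtain ⟨Q, hQ⟩ := exists_isCompl (k ∙ x)
      refine SplitsLine.of_isCompl hn hx0 hQ fun p => Or.inl ?_
      rcases hl p with rfl | rfl | rfl <;> assumption
    · obtain ⟨Q, hle, hQ⟩ : ∃ Q, U l ≤ Q ∧ IsCompl (k ∙ x) Q := by
        obtain ⟨Q, hle, hQ⟩ := ((Submodule.disjoint_span_singleton' hx0).2 hxl).exists_isCompl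
        exact ⟨Q, hle, hQ.symm⟩
      refine SplitsLine.of_isCompl hn hx0 hQ fun p => ?_
      rcases hl p with rfl | rfl | rfl
      · exact Or.inl hxi
      · exact Or.inl hxj
      · exact Or.inr hle

/-- Two triples of pairwise complementary subspaces are related by an isomorphism: the third
subspace is the graph of an isomorphism between the first two. -/
lemma exists_equiv_of_pairwise_isCompl {U U' : Fin 3 → Submodule k V}
    (hU : ∀ i j, i ≠ j → IsCompl (U i) (U j)) (hU' : ∀ i j, i ≠ j → IsCompl (U' i) (U' j)) :
    ∃ g : V ≃ₗ[k] V, ∀ i, (U i).map (g : V →ₗ[k] V) = U' i := by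
  have hd : ∀ i, finrank k (U i) = finrank k (U' i) := by
    have e1 := Submodule.finrank_add_eq_of_isCompl (hU 0 1 (by decide))
    have e2 := Submodule.finrank_add_eq_of_isCompl (hU 1 2 (by decide))
    have e3 := Submodule.finrank_add_eq_of_isCompl (hU 0 2 (by decide))
    have e4 := Submodule.finrank_add_eq_of_isCompl (hU' 0 1 (by decide))
    have e5 := Submodule.finrank_add_eq_of_isCompl (hU' 1 2 (by decide))
    have e6 := Submodule.finrank_add_eq_of_isCompl (hU' 0 2 (by decide))
    intro i
    fin_cases i <;> simp only [Fin.zero_eta, Fin.mk_one, Fin.reduceFinMk] <;> omega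
  -- The maps to `V ⧸ U' 2`, which are isomorphisms on the other two subspaces.
  have hq : finrank k (V ⧸ U 2) = finrank k (V ⧸ U' 2) := by
    have h1 := Submodule.finrank_quotient_add_finrank (U 2)
    have h2 := Submodule.finrank_quotient_add_finrank (U' 2)
    have := hd 2
    omega
  let γ : (V ⧸ U 2) ≃ₗ[k] (V ⧸ U' 2) := LinearEquiv.ofFinrankEq _ _ hq
  let α : V →ₗ[k] V ⧸ U' 2 := γ.toLinearMap ∘ₗ (U 2).mkQ
  let α' : V →ₗ[k] V ⧸ U' 2 := (U' 2).mkQ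
  have hα : ∀ i, i ≠ 2 → (U i).map α = ⊤ := fun i hi => by
    have : (U i).map (U 2).mkQ = ⊤ := by
      have h1 : (U i ⊔ U 2).map (U 2).mkQ = ⊤ := by
        rw [(hU i 2 hi).sup_eq_top, Submodule.map_top, Submodule.range_mkQ]
      rwa [Submodule.map_sup, Submodule.mkQ_map_self, sup_bot_eq] at h1
    rw [Submodule.map_comp, this, Submodule.map_top, LinearEquiv.range]
  have hα' : ∀ i, i ≠ 2 → (U' i).map α' = ⊤ := fun i hi => by
    have h1 : (U' i ⊔ U' 2).map (U' 2).mkQ = ⊤ := by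
      rw [(hU' i 2 hi).sup_eq_top, Submodule.map_top, Submodule.range_mkQ]
    rwa [Submodule.map_sup, Submodule.mkQ_map_self, sup_bot_eq] at h1
  have hex : ∀ i, i ≠ 2 → ∃ h : V →ₗ[k] V, (∀ u ∈ U i, h u = 0 → u = 0) ∧ (U i).map h = U' i ∧
      ∀ u ∈ U i, α' (h u) = α u := fun i hi => by
    obtain ⟨h, -, hh⟩ := exists_extend_over α α' (U i) (U' i) ((hα i hi).trans (hα' i hi).symm)
      (hd i) (finrank k (U i)) ⊥ 0 (by simp) bot_le (by simp) (by simp) (by simp)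
    exact ⟨h, hh⟩
  obtain ⟨h0, h0i, h0m, h0α⟩ := hex 0 (by decide)
  obtain ⟨h1, h1i, h1m, h1α⟩ := hex 1 (by decide)
  have hdec : ∀ v, ∃ a ∈ U 0, ∃ b ∈ U 1, a + b = v := fun v =>
    Submodule.mem_sup.1 ((hU 0 1 (by decide)).sup_eq_top ▸ Submodule.mem_top)
  let π0 := (U 0).projectionOnto (U 1) (hU 0 1 (by decide))
  let π1 := (U 1).projectionOnto (U 0) (hU 1 0 (by decide))
  let h : V →ₗ[k] V := h0 ∘ₗ (U 0).subtype ∘ₗ π0 + h1 ∘ₗ (U 1).subtype ∘ₗ π1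
  have hh : ∀ a ∈ U 0, ∀ b ∈ U 1, h (a + b) = h0 a + h1 b := by
    intro a ha b hb
    have e1 : π0 a = ⟨a, ha⟩ := Submodule.projectionOnto_apply_left _ ⟨a, ha⟩
    have e2 : π1 b = ⟨b, hb⟩ := Submodule.projectionOnto_apply_left _ ⟨b, hb⟩
    have e3 : π0 b = 0 := Submodule.projectionOnto_apply_eq_zero_iff _ |>.2 hb
    have e4 : π1 a = 0 := Submodule.projectionOnto_apply_eq_zero_iff _ |>.2 ha
    simp [h, e1, e2, e3, e4]
  have hinj : Function.Injective h := by
    rw [injective_iff_map_eq_zero]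
    intro v hv
    obtain ⟨a, ha, b, hb, rfl⟩ := hdec v
    rw [hh a ha b hb] at hv
    have m0 : h0 a ∈ U' 0 := h0m ▸ Submodule.mem_map_of_mem ha
    have m1 : h1 b ∈ U' 1 := h1m ▸ Submodule.mem_map_of_mem hb
    have z0 : h0 a = 0 := by
      refine Submodule.disjoint_def.1 (hU' 0 1 (by decide)).disjoint _ m0 ?_
      rw [eq_neg_of_add_eq_zero_left hv]
      exact (U' 1).neg_mem m1
    rw [z0, zero_add] at hv
    rw [h0i a ha z0, h1i b hb hv, add_zero]
  have hhα : ∀ v, α' (h v) = α v := by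
    intro v
    obtain ⟨a, ha, b, hb, rfl⟩ := hdec v
    rw [hh a ha b hb, map_add, map_add, h0α a ha, h1α b hb]
  refine ⟨LinearEquiv.ofInjectiveEndo h hinj, fun i => ?_⟩
  change (U i).map h = U' i
  refine Submodule.eq_of_le_of_finrank_le ?_ ?_
  · rintro _ ⟨u, hu, rfl⟩
    fin_cases i
    · have := hh u hu 0 (U 1).zero_mem
      rw [add_zero, map_zero, add_zero] at this
      rw [this]
      exact h0m ▸ Submodule.mem_map_of_mem hu
    · have := hh 0 (U 0).zero_mem u hu
      rw [zero_add, map_zero, zero_add] at this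
      rw [this]
      exact h1m ▸ Submodule.mem_map_of_mem hu
    · have h0 : α' (h u) = 0 := by
        rw [hhα u]
        simpa [α] using hu
      simpa [α'] using h0
  · rw [finrank_map_of_injOn fun u _ hu => (injective_iff_map_eq_zero h).1 hinj u hu, hd]

end Splitting

/-- There are finitely many triples of subspaces of `k ^ n` up to isomorphism. -/
theorem finClasses_triples (n : ℕ) : FinClasses fun U U' : Fin 3 → Submodule k (Fin n → k) =>
    ∃ g : (Fin n → k) ≃ₗ[k] (Fin n → k), ∀ i,
      (U i).map (g : (Fin n → k) →ₗ[k] (Fin n → k)) = U' i := by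
  classical
  induction n with
  | zero =>
    exact FinClasses.of_finite (fun _ => ()) fun U U' _ =>
      ⟨LinearEquiv.refl k _, fun i => Subsingleton.elim _ _⟩
  | succ n ih =>
    obtain ⟨N, φ, hφ⟩ := ih
    have hex : ∀ U : Fin 3 → Submodule k (Fin (n + 1) → k),
        ∃ o : Option (Set (Fin 3) × (Fin 3 → Submodule k (Fin n → k))),
          (o = none → ∀ i j, i ≠ j → IsCompl (U i) (U j)) ∧
          ∀ p, o = some p → SplitsLine n U p.1 p.2 := by
      intro U
      by_cases h : ∀ i j, i ≠ j → IsCompl (U i) (U j)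
      · exact ⟨none, fun _ => h, by simp⟩
      · obtain ⟨S, T, hST⟩ := exists_splitsLine_of_not_isCompl (finrank_fin_fun k) h
        exact ⟨some (S, T), by simp, by rintro p ⟨⟩; exact hST⟩
    choose o ho1 ho2 using hex
    refine FinClasses.of_finite (fun U => (o U).map fun p => (p.1, φ p.2)) fun U U' hUU => ?_
    rcases h : o U with _ | ⟨S, T⟩ <;> rcases h' : o U' with _ | ⟨S', T'⟩
    · exact exists_equiv_of_pairwise_isCompl (ho1 U h) (ho1 U' h')
    · simp [h, h'] at hUU
    · simp [h, h'] at hUU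
    · simp only [h, h', Option.map_some, Option.some.injEq, Prod.mk.injEq] at hUU
      obtain ⟨rfl, hT⟩ := hUU
      obtain ⟨g, hg⟩ := hφ _ _ hT
      obtain ⟨e, he⟩ := ho2 U _ h
      obtain ⟨e', he'⟩ := ho2 U' _ h'
      refine ⟨e.trans (((LinearEquiv.refl k k).prodCongr g).trans e'.symm), fun i => ?_⟩
      ext w
      rw [Submodule.mem_map_equiv]
      obtain ⟨⟨c, t⟩, rfl⟩ := e'.symm.surjective w
      have : (e.trans (((LinearEquiv.refl k k).prodCongr g).trans e'.symm)).symm (e'.symm (c, t)) =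
          e.symm (c, g.symm t) := by
        simp [LinearEquiv.trans_symm]
      rw [this, he i, he' i]
      change _ ∧ g.symm t ∈ T i ↔ _ ∧ t ∈ T' i
      rw [← hg i, Submodule.mem_map_equiv]

end Triples

/-! ### Sets of arrows -/

section Arrows

variable {V : Type}

/-- The neighbours of `x` in the set `E` of arrows; the pair `(x, y)` is the arrow `x → y`. -/
def arrowNbrs (E : Finset (V × V)) (x : V) : Set V := {y | (x, y) ∈ E ∨ (y, x) ∈ E}

/-- There is no closed walk without backtracking along the arrows in `E`. -/
def ArrowAcyclic (E : Finset (V × V)) : Prop :=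
  ∀ (n : ℕ) (x : ℕ → V), 0 < n → (∀ i < n, x (i + 1) ∈ arrowNbrs E (x i)) →
    (∀ i, 0 < i → i < n → x (i - 1) ≠ x (i + 1)) → x 0 ≠ x n

/-- Every vertex is a source or a sink. -/
def ArrowBipartite (E : Finset (V × V)) : Prop := ∀ x y z, (x, y) ∈ E → (y, z) ∉ E

lemma mem_arrowNbrs_comm {E : Finset (V × V)} {x y : V} :
    y ∈ arrowNbrs E x ↔ x ∈ arrowNbrs E y := or_comm

lemma arrowNbrs_mono {E E' : Finset (V × V)} (h : E' ⊆ E) (x : V) :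
    arrowNbrs E' x ⊆ arrowNbrs E x := fun _ hy => hy.imp (@h _) (@h _)

lemma ArrowAcyclic.mono {E E' : Finset (V × V)} (hE : ArrowAcyclic E) (h : E' ⊆ E) :
    ArrowAcyclic E' := fun n x hn hx hb => hE n x hn (fun i hi => arrowNbrs_mono h _ (hx i hi)) hb

lemma ArrowBipartite.mono {E E' : Finset (V × V)} (hE : ArrowBipartite E) (h : E' ⊆ E) :
    ArrowBipartite E' := fun x y z h1 h2 => hE x y z (h h1) (h h2)

lemma ArrowBipartite.ne {E : Finset (V × V)} (hE : ArrowBipartite E) {x y : V}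
    (h : y ∈ arrowNbrs E x) : y ≠ x := by
  rintro rfl
  rcases h with h | h <;> exact hE _ _ _ h h

/-- A nonempty finite forest has a leaf: otherwise there is an infinite walk without backtracking,
which revisits some vertex. -/
lemma ArrowAcyclic.exists_leaf [Finite V] {E : Finset (V × V)} (hE : ArrowAcyclic E)
    (hne : E.Nonempty) : ∃ x y, arrowNbrs E x = {y} := by
  by_contra! hleaf
  have hnext : ∀ p : {p : V × V // p.2 ∈ arrowNbrs E p.1}, ∃ z, z ∈ arrowNbrs E p.1.2 ∧
      z ≠ p.1.1 := by
    rintro ⟨⟨a, b⟩, hab⟩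
    by_contra! h
    exact hleaf b a (Set.Subset.antisymm (fun z hz => h z hz)
      (Set.singleton_subset_iff.2 (mem_arrowNbrs_comm.1 hab)))
  choose f hf1 hf2 using hnext
  obtain ⟨⟨a, b⟩, hab⟩ := hne
  let s : ℕ → {p : V × V // p.2 ∈ arrowNbrs E p.1} := fun n =>
    (fun p => ⟨(p.1.2, f p), hf1 p⟩)^[n] ⟨(a, b), Or.inl hab⟩
  have hs : ∀ n, (s (n + 1)).1 = ((s n).1.2, f (s n)) := fun n => by
    simp only [s, Function.iterate_succ_apply']
  have hs1 : ∀ n, (s (n + 1)).1.1 = (s n).1.2 := fun n => by rw [hs]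
  have hs2 : ∀ n, (s (n + 2)).1.1 ≠ (s n).1.1 := fun n => by
    rw [hs1, hs]
    exact hf2 _
  obtain ⟨i, j, hij, h⟩ := Finite.exists_ne_map_eq_of_infinite fun n => (s n).1.1
  wlog hlt : i < j generalizing i j
  · exact this j i hij.symm h.symm (lt_of_le_of_ne (not_lt.1 hlt) hij.symm)
  refine hE (j - i) (fun n => (s (i + n)).1.1) (by omega) (fun n _ => ?_) (fun n hn _ => ?_) ?_
  · rw [← add_assoc, hs1]
    exact (s (i + n)).2
  · obtain ⟨n, rfl⟩ := Nat.exists_eq_succ_of_ne_zero hn.ne'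
    exact (hs2 (i + n)).symm
  · simpa [Nat.add_sub_cancel' hlt.le] using h

lemma exists_reduced_walk {r : V → V → Prop} {y w : V} (h : Relation.ReflTransGen r y w) :
    ∃ (n : ℕ) (x : ℕ → V), x 0 = y ∧ x n = w ∧ (∀ i < n, r (x i) (x (i + 1))) ∧
      ∀ i, 0 < i → i < n → x (i - 1) ≠ x (i + 1) := by
  induction h with
  | refl => exact ⟨0, fun _ => y, rfl, rfl, by simp, by simp⟩
  | @tail b c _ hbc ih =>
    obtain ⟨n, x, h0, hn, hr, hb⟩ := ih
    by_cases hback : 0 < n ∧ x (n - 1) = c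
    · exact ⟨n - 1, x, h0, hback.2, fun i hi => hr i (by omega), fun i h1 h2 => hb i h1 (by omega)⟩
    · have hx : ∀ i, i ≤ n → Function.update x (n + 1) c i = x i := fun i hi =>
        Function.update_of_ne (by omega) _ _
      refine ⟨n + 1, Function.update x (n + 1) c, ?_, by simp, fun i hi => ?_, fun i h1 h2 => ?_⟩
      · rw [hx 0 (by omega), h0]
      · rcases Nat.lt_succ_iff_lt_or_eq.1 hi with hi | rfl
        · rw [hx i (by omega), hx (i + 1) (by omega)]
          exact hr i hi
        · rw [hx i le_rfl, Function.update_self, hn]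
          exact hbc
      · rcases Nat.lt_succ_iff_lt_or_eq.1 h2 with h2 | rfl
        · rw [hx _ (by omega), hx _ (by omega)]
          exact hb i h1 h2
        · rw [hx _ (by omega), Function.update_self]
          exact fun h => hback ⟨h1, h⟩

/-- In a forest, removing a vertex `z` separates its neighbours `y` and `y'`: the branch `R` at `z`
through `y` does not contain `y'`. -/
lemma ArrowAcyclic.exists_branch {E : Finset (V × V)} (hE : ArrowAcyclic E)
    (hbip : ArrowBipartite E) {y y' z : V} (hy : y ∈ arrowNbrs E z) (hy' : y' ∈ arrowNbrs E z)
    (hne : y ≠ y') : ∃ R : Set V, y ∈ R ∧ y' ∉ R ∧ z ∉ R ∧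
      ∀ a ∈ R, ∀ b ∈ arrowNbrs E a, b ≠ z → b ∈ R := by
  have hyz := hbip.ne hy
  refine ⟨{w | Relation.ReflTransGen (fun a b => b ∈ arrowNbrs E a ∧ b ≠ z) y w}, .refl, ?_, ?_,
    fun a ha b hb hbz => ha.tail ⟨hb, hbz⟩⟩
  · intro h
    obtain ⟨n, x, h0, hn, hr, hb⟩ := exists_reduced_walk h
    have hn0 : n ≠ 0 := by
      rintro rfl
      exact hne (h0.symm.trans hn)
    have hxz : ∀ i ≤ n, x i ≠ z := by
      intro i hi
      rcases i with _ | i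
      · rwa [h0]
      · exact (hr i (by omega)).2
    -- The walk from `y` to `y'` avoiding `z` closes up through `z`.
    refine hE (n + 2) (fun i => if i = 0 ∨ i = n + 2 then z else x (i - 1)) (by omega)
      (fun i hi => ?_) (fun i h1 h2 => ?_) (by simp)
    · rcases i with _ | i
      · simpa [h0] using hy
      · rcases Nat.lt_succ_iff_lt_or_eq.1 (Nat.lt_of_succ_lt_succ hi) with hi | rfl
        · have := (hr i hi).1
          simpa [show ¬ i = n + 1 by omega, show ¬ i = n by omega] using this
        · simpa [hn] using mem_arrowNbrs_comm.1 hy'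
    · rcases i with _ | _ | i
      · omega
      · have := hxz 1 (by omega)
        simpa [hn0] using this.symm
      · by_cases hi : i = n
        · omega
        by_cases hi' : i + 1 = n
        · subst hi'
          have := hxz i (by omega)
          simpa using this
        · have := hb (i + 1) (by omega) (by omega)
          simpa [show ¬ i = n + 1 by omega, hi'] using this
  · intro h
    rcases Relation.ReflTransGen.cases_tail h with h | ⟨_, _, h⟩
    · exact hyz h.symm
    · exact h.2 rfl

end Arrows

/-! ### Representations along a set of arrows -/

section Reps

variable {V : Type}

/-- Families of linear maps `k ^ d x → k ^ d y` for all pairs of vertices. A representation of the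
quiver with arrows `E` is such a family regarded up to its values outside `E`. -/
abbrev RepFamily (k : Type u) [Field k] (d : V → ℕ) : Type u :=
  ∀ x y : V, (Fin (d x) → k) →ₗ[k] (Fin (d y) → k)

/-- The group of base changes of dimension vector `d`. -/
abbrev BaseChange (k : Type u) [Field k] (d : V → ℕ) : Type u :=
  ∀ x : V, (Fin (d x) → k) ≃ₗ[k] (Fin (d x) → k)

variable {k : Type u} [Field k] {d : V → ℕ}

/-- The base change `g` takes `M` to `N` on the arrows in `E`. -/
def IsoOn (E : Finset (V × V)) (M N : RepFamily k d) (g : BaseChange k d) : Prop :=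
  ∀ x y, (x, y) ∈ E → ∀ w, N x y (g x w) = g y (M x y w)

/-- Finitely many isomorphism classes of representations of the quiver with arrows `E`. -/
def RepFinite (k : Type u) [Field k] (E : Finset (V × V)) (d : V → ℕ) : Prop :=
  FinClasses fun M N : RepFamily k d => ∃ g, IsoOn E M N g

/-- Two sets of arrows meeting in at most one vertex, of dimension at most one, can be treated
separately: on a space of dimension one the two base changes differ by a scalar, and scalars act
trivially. -/
lemma RepFinite.glue {E E₁ E₂ : Finset (V × V)} (h₁ : RepFinite k E₁ d) (h₂ : RepFinite k E₂ d)
    (hE : ∀ e ∈ E, e ∈ E₁ ∨ e ∈ E₂)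
    (hdim : ∀ w, (arrowNbrs E₁ w).Nonempty → (arrowNbrs E₂ w).Nonempty → d w ≤ 1)
    (huniq : ∀ w, (arrowNbrs E₁ w).Nonempty → (arrowNbrs E₂ w).Nonempty →
      ∀ w', (arrowNbrs E₁ w').Nonempty → (arrowNbrs E₂ w').Nonempty → w = w') :
    RepFinite k E d := by
  classical
  obtain ⟨n₁, φ₁, hφ₁⟩ := h₁
  obtain ⟨n₂, φ₂, hφ₂⟩ := h₂
  refine FinClasses.of_finite (fun M => (φ₁ M, φ₂ M)) fun M N hMN => ?_
  obtain ⟨e₁, e₂⟩ := Prod.mk.inj hMN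
  obtain ⟨g₁, hg₁⟩ := hφ₁ M N e₁
  obtain ⟨g₂, hg₂⟩ := hφ₂ M N e₂
  obtain ⟨c, hc0, hc⟩ : ∃ c : k, c ≠ 0 ∧ ∀ w, (arrowNbrs E₁ w).Nonempty →
      (arrowNbrs E₂ w).Nonempty → ∀ v, g₁ w v = c • g₂ w v := by
    by_cases hz : ∃ z, (arrowNbrs E₁ z).Nonempty ∧ (arrowNbrs E₂ z).Nonempty
    · obtain ⟨z, hz₁, hz₂⟩ := hz
      obtain ⟨c, hc0, hc⟩ : ∃ c : k, c ≠ 0 ∧ ∀ v, g₁ z v = c • g₂ z v := by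
        have hd : finrank k (Fin (d z) → k) ≤ 1 := by simpa using hdim z hz₁ hz₂
        by_cases hv : ∃ v : Fin (d z) → k, v ≠ 0
        · obtain ⟨v, hv⟩ := hv
          have hgv : g₂ z v ≠ 0 := by simpa using hv
          have h1 : finrank k (Fin (d z) → k) = 1 :=
            le_antisymm hd (finrank_pos_iff_exists_ne_zero.2 ⟨v, hv⟩)
          obtain ⟨c, hc⟩ := (finrank_eq_one_iff_of_nonzero' _ hgv).1 h1 (g₁ z v)
          refine ⟨c, ?_, fun w => ?_⟩
          · rintro rfl
            rw [zero_smul] at hc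
            exact hv ((LinearEquiv.map_eq_zero_iff _).1 hc.symm)
          · obtain ⟨a, rfl⟩ := (finrank_eq_one_iff_of_nonzero' _ hv).1 h1 w
            rw [map_smul, map_smul, ← hc, smul_comm]
        · push Not at hv
          exact ⟨1, one_ne_zero, fun v => by rw [hv v]; simp⟩
      refine ⟨c, hc0, fun w hw₁ hw₂ => ?_⟩
      obtain rfl := huniq z hz₁ hz₂ w hw₁ hw₂
      exact hc
    · exact ⟨1, one_ne_zero, fun w hw₁ hw₂ => absurd ⟨w, hw₁, hw₂⟩ hz⟩
  let s : ∀ w, (Fin (d w) → k) ≃ₗ[k] (Fin (d w) → k) := fun w =>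
    LinearEquiv.smulOfNeZero k _ c hc0
  let g : BaseChange k d := fun w =>
    if (arrowNbrs E₁ w).Nonempty then g₁ w else (g₂ w).trans (s w)
  have hgl : ∀ w, (arrowNbrs E₁ w).Nonempty → ∀ v, g w v = g₁ w v := fun w hw v => by
    simp [g, hw]
  have hgr : ∀ w, (arrowNbrs E₂ w).Nonempty → ∀ v, g w v = c • g₂ w v := fun w hw v => by
    by_cases hw₁ : (arrowNbrs E₁ w).Nonempty
    · rw [hgl w hw₁, hc w hw₁ hw]
    · simp [g, hw₁, s]
  refine ⟨g, fun x y hxy v => ?_⟩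
  rcases hE _ hxy with h | h
  · rw [hgl x ⟨y, Or.inl h⟩, hgl y ⟨x, Or.inr h⟩]
    exact hg₁ x y h v
  · rw [hgr x ⟨y, Or.inl h⟩, hgr y ⟨x, Or.inr h⟩, map_smul, hg₂ x y h v]

end Reps

/-! ### Chains, stars and forests -/

section Forest

variable {V : Type} {k : Type u} [Field k] {d : V → ℕ}

/-- A representation together with a flag of length `m` in the space at the vertex `x`, encoded as a
monotone sequence of subspaces which is everything from the index `m` on. -/
structure FlaggedRep (k : Type u) [Field k] (d : V → ℕ) (x : V) (m : ℕ) where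
  rep : RepFamily k d
  flag : ℕ → Submodule k (Fin (d x) → k)
  mono : Monotone flag
  flag_top : flag m = ⊤

/-- Finitely many isomorphism classes of representations of the quiver with arrows `E`, together
with a flag of length `m` in the space at `x`. -/
def FlaggedFinite (k : Type u) [Field k] (E : Finset (V × V)) (d : V → ℕ) (x : V) (m : ℕ) : Prop :=
  FinClasses fun M N : FlaggedRep k d x m => ∃ g, IsoOn E M.rep N.rep g ∧
    ∀ i, (M.flag i).map (g x : (Fin (d x) → k) →ₗ[k] (Fin (d x) → k)) = N.flag i

/-- The dimensions of the members of the flag. -/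
noncomputable def FlaggedRep.dims {x : V} {m : ℕ} (M : FlaggedRep k d x m) (i : Fin (m + 1)) :
    Fin (d x + 1) :=
  ⟨finrank k (M.flag i), Nat.lt_succ_of_le ((Submodule.finrank_le _).trans_eq (finrank_fin_fun k))⟩

lemma FlaggedRep.finrank_eq_of_dims_eq {x : V} {m : ℕ} {M N : FlaggedRep k d x m}
    (h : M.dims = N.dims) (i : ℕ) (hi : i ≤ m) : finrank k (M.flag i) = finrank k (N.flag i) :=
  congrArg Fin.val (congrFun h ⟨i, Nat.lt_succ_of_le hi⟩)

lemma FlaggedFinite.repFinite {E : Finset (V × V)} {x : V} (h : FlaggedFinite k E d x 0) :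
    RepFinite k E d := by
  obtain ⟨n, φ, hφ⟩ := h
  refine ⟨n, fun M => φ ⟨M, fun _ => ⊤, monotone_const, rfl⟩, fun M N hMN => ?_⟩
  obtain ⟨g, hg, -⟩ := hφ _ _ hMN
  exact ⟨g, hg⟩

/-- A flag at a vertex not touched by `E` only contributes its dimensions. -/
lemma RepFinite.flaggedFinite {E : Finset (V × V)} (h : RepFinite k E d) {x : V}
    (hx : arrowNbrs E x = ∅) (m : ℕ) : FlaggedFinite k E d x m := by
  classical
  obtain ⟨n, φ, hφ⟩ := h
  refine FinClasses.of_finite (fun M => (φ M.rep, M.dims)) fun M N hMN => ?_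
  obtain ⟨h1, h2⟩ := Prod.mk.inj hMN
  obtain ⟨g, hg⟩ := hφ _ _ h1
  obtain ⟨h, hh, -⟩ := exists_flag_equiv_over (0 : _ →ₗ[k] k) 0 M.mono N.mono M.flag_top N.flag_top
    (fun _ _ => by rw [Submodule.map_zero, Submodule.map_zero])
    (FlaggedRep.finrank_eq_of_dims_eq h2)
  refine ⟨Function.update g x h, fun a b hab w => ?_, fun i => by rw [Function.update_self, hh]⟩
  have ha : a ≠ x := by
    rintro rfl
    exact (Set.eq_empty_iff_forall_notMem.1 hx) b (Or.inl hab)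
  have hb : b ≠ x := by
    rintro rfl
    exact (Set.eq_empty_iff_forall_notMem.1 hx) a (Or.inr hab)
  rw [Function.update_of_ne ha, Function.update_of_ne hb, hg a b hab]

/-- Pushing a flag forward along an arrow `x → y` starting at a leaf `x`: the isomorphism class of a
representation with a flag at `x` is determined by that of the rest with the image flag at `y`, and
by the dimensions of the flag. -/
lemma FlaggedFinite.of_leaf_source {E E' : Finset (V × V)} {x y : V} {m : ℕ}
    (h : FlaggedFinite k E' d y (m + 1)) (hE : ∀ e ∈ E, e ∈ E' ∨ e = (x, y)) (hxy : y ≠ x)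
    (hx : arrowNbrs E' x = ∅) : FlaggedFinite k E d x m := by
  classical
  obtain ⟨n, φ, hφ⟩ := h
  let push : FlaggedRep k d x m → FlaggedRep k d y (m + 1) := fun M =>
    { rep := M.rep
      flag := fun i => if i ≤ m then (M.flag i).map (M.rep x y) else ⊤
      mono := by
        intro i j hij
        dsimp only
        split_ifs with h1 h2
        · exact Submodule.map_mono (M.mono hij)
        · exact le_top
        · omega
        · exact le_rfl
      flag_top := by simp }
  refine FinClasses.of_finite (fun M => (φ (push M), M.dims)) fun M N hMN => ?_
  obtain ⟨h1, h2⟩ := Prod.mk.inj hMN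
  obtain ⟨g, hg, hgf⟩ := hφ _ _ h1
  obtain ⟨h, hh, hα⟩ := exists_flag_equiv_over ((g y).toLinearMap ∘ₗ M.rep x y) (N.rep x y) M.mono
    N.mono M.flag_top N.flag_top (fun i hi => by
      have := hgf i
      simp only [push, hi, if_true] at this
      rw [Submodule.map_comp, this]) (FlaggedRep.finrank_eq_of_dims_eq h2)
  refine ⟨Function.update g x h, fun a b hab w => ?_, fun i => by rw [Function.update_self, hh]⟩
  rcases hE _ hab with hab | hab
  · have ha : a ≠ x := by
      rintro rfl
      exact (Set.eq_empty_iff_forall_notMem.1 hx) b (Or.inl hab)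
    have hb : b ≠ x := by
      rintro rfl
      exact (Set.eq_empty_iff_forall_notMem.1 hx) a (Or.inr hab)
    rw [Function.update_of_ne ha, Function.update_of_ne hb]
    exact hg a b hab w
  · obtain ⟨rfl, rfl⟩ := Prod.mk.inj hab
    rw [Function.update_self, Function.update_of_ne hxy]
    exact hα w

/-- Pulling a flag back along an arrow `y → x` ending at a leaf `x`. -/
lemma FlaggedFinite.of_leaf_target {E E' : Finset (V × V)} {x y : V} {m : ℕ}
    (h : FlaggedFinite k E' d y (m + 1)) (hE : ∀ e ∈ E, e ∈ E' ∨ e = (y, x)) (hxy : y ≠ x)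
    (hx : arrowNbrs E' x = ∅) : FlaggedFinite k E d x m := by
  classical
  obtain ⟨n, φ, hφ⟩ := h
  let pull : FlaggedRep k d x m → FlaggedRep k d y (m + 1) := fun M =>
    { rep := M.rep
      flag := fun i => i.casesOn (LinearMap.ker (M.rep y x)) fun i => (M.flag i).comap (M.rep y x)
      mono := by
        refine monotone_nat_of_le_succ fun i => ?_
        rcases i with _ | i
        · exact Submodule.comap_mono bot_le
        · exact Submodule.comap_mono (M.mono (Nat.le_succ i))
      flag_top := by simp [M.flag_top] }
  refine FinClasses.of_finite (fun M => (φ (pull M), M.dims)) fun M N hMN => ?_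
  obtain ⟨h1, h2⟩ := Prod.mk.inj hMN
  obtain ⟨g, hg, hgf⟩ := hφ _ _ h1
  have hcomap : ∀ P Q : Submodule k (Fin (d y) → k),
      P.map (g y : (Fin (d y) → k) →ₗ[k] (Fin (d y) → k)) = Q →
      P = Q.comap (g y : (Fin (d y) → k) →ₗ[k] (Fin (d y) → k)) := by
    rintro P _ rfl
    exact (Submodule.comap_map_eq_of_injective (g y).injective P).symm
  obtain ⟨h, hh, hβ⟩ := exists_flag_equiv_under (M.rep y x) (N.rep y x ∘ₗ (g y).toLinearMap) M.mono
    N.mono M.flag_top N.flag_top (fun i _ => by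
      rw [Submodule.comap_comp]
      exact hcomap _ _ (hgf (i + 1))) (by
      rw [LinearMap.ker_comp]
      exact hcomap _ _ (hgf 0)) (FlaggedRep.finrank_eq_of_dims_eq h2)
  refine ⟨Function.update g x h, fun a b hab w => ?_, fun i => by rw [Function.update_self, hh]⟩
  rcases hE _ hab with hab | hab
  · have ha : a ≠ x := by
      rintro rfl
      exact (Set.eq_empty_iff_forall_notMem.1 hx) b (Or.inl hab)
    have hb : b ≠ x := by
      rintro rfl
      exact (Set.eq_empty_iff_forall_notMem.1 hx) a (Or.inr hab)
    rw [Function.update_of_ne ha, Function.update_of_ne hb]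
    exact hg a b hab w
  · obtain ⟨rfl, rfl⟩ := Prod.mk.inj hab
    rw [Function.update_self, Function.update_of_ne hxy]
    exact (hβ w).symm

lemma repFinite_empty : RepFinite k (∅ : Finset (V × V)) d :=
  FinClasses.of_finite (fun _ => ()) fun _ _ _ =>
    ⟨fun _ => LinearEquiv.refl k _, fun _ _ h => absurd h (Finset.notMem_empty _)⟩

/-- Disjoint unions of chains (quivers of type `A`) are representation finite, even with a flag at a
vertex with at most one neighbour: the flag is moved along the chain while arrows are removed. -/
theorem flaggedFinite_of_ncard_le_two [Finite V] (E : Finset (V × V)) (hE : ArrowAcyclic E)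
    (hbip : ArrowBipartite E) (hdeg : ∀ x, (arrowNbrs E x).ncard ≤ 2) :
    ∀ x m, (arrowNbrs E x).ncard ≤ 1 → FlaggedFinite k E d x m := by
  classical
  induction E using Finset.strongInduction with
  | H E ih =>
    have hleaf : ∀ x y m, arrowNbrs E x = {y} → FlaggedFinite k E d x m := by
      intro x y m hxy
      have hy : y ∈ arrowNbrs E x := hxy ▸ Set.mem_singleton y
      have hne := hbip.ne hy
      let E' : Finset (V × V) := E.filter fun e => e ≠ (x, y) ∧ e ≠ (y, x)
      have hsub : E' ⊆ E := Finset.filter_subset _ _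
      have hx : arrowNbrs E' x = ∅ := by
        refine Set.eq_empty_iff_forall_notMem.2 fun z hz => ?_
        have : z = y := by
          have := arrowNbrs_mono hsub x hz
          rwa [hxy] at this
        subst this
        rcases hz with hz | hz <;> simp [E'] at hz
      have hss : E' ⊂ E := by
        refine lt_of_le_of_ne hsub fun h => ?_
        rw [h, hxy] at hx
        simp at hx
      have hlt : (arrowNbrs E' y).ncard < (arrowNbrs E y).ncard := by
        refine Set.ncard_lt_ncard ⟨arrowNbrs_mono hsub y, fun h => ?_⟩ (Set.toFinite _)
        have := mem_arrowNbrs_comm.1 (h (mem_arrowNbrs_comm.1 hy))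
        rw [hx] at this
        exact this
      have hrec : FlaggedFinite k E' d y (m + 1) := ih E' hss (hE.mono hsub) (hbip.mono hsub)
        (fun z => (Set.ncard_le_ncard (arrowNbrs_mono hsub z) (Set.toFinite _)).trans (hdeg z)) y
        (m + 1) (by have := hdeg y; omega)
      rcases hy with hy | hy
      · refine hrec.of_leaf_source (fun e he => ?_) hne hx
        have h1 : e ≠ (y, x) := by
          rintro rfl
          exact hbip _ _ _ hy he
        by_cases h2 : e = (x, y)
        · exact Or.inr h2
        · exact Or.inl (Finset.mem_filter.2 ⟨he, h2, h1⟩)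
      · refine hrec.of_leaf_target (fun e he => ?_) hne hx
        have h1 : e ≠ (x, y) := by
          rintro rfl
          exact hbip _ _ _ hy he
        by_cases h2 : e = (y, x)
        · exact Or.inr h2
        · exact Or.inl (Finset.mem_filter.2 ⟨he, h1, h2⟩)
    intro x m hx
    rcases (arrowNbrs E x).eq_empty_or_nonempty with h0 | hne
    · refine RepFinite.flaggedFinite ?_ h0 m
      rcases E.eq_empty_or_nonempty with rfl | hne
      · exact repFinite_empty
      · obtain ⟨z, y, hz⟩ := hE.exists_leaf hne
        exact (hleaf z y 0 hz).repFinite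
    · obtain ⟨y, hy⟩ := Set.ncard_eq_one.1
        (le_antisymm hx ((Set.ncard_pos (Set.toFinite _)).2 hne))
      exact hleaf x y m hy

/-- The subspace of the space at `c` defined by a neighbour `y`: the image of `y → c` or the kernel
of `c → y`. -/
noncomputable def armSubspace (E : Finset (V × V)) (M : RepFamily k d) (c y : V) :
    Submodule k (Fin (d c) → k) :=
  open Classical in if (y, c) ∈ E then LinearMap.range (M y c) else LinearMap.ker (M c y)

/-- A base change at `c` matching the subspaces defined by a neighbour `y` extends to `y`. -/
lemma exists_equiv_of_map_armSubspace {E : Finset (V × V)} (hbip : ArrowBipartite E)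
    {M N : RepFamily k d} {c y : V} {g : (Fin (d c) → k) ≃ₗ[k] (Fin (d c) → k)}
    (h : (armSubspace E M c y).map (g : (Fin (d c) → k) →ₗ[k] (Fin (d c) → k)) =
      armSubspace E N c y) :
    ∃ f : (Fin (d y) → k) ≃ₗ[k] (Fin (d y) → k),
      ((y, c) ∈ E → ∀ w, N y c (f w) = g (M y c w)) ∧
      ((c, y) ∈ E → ∀ w, N c y (g w) = f (M c y w)) := by
  by_cases hy : (y, c) ∈ E
  · simp only [armSubspace, hy, if_true] at h
    obtain ⟨f, -, hf⟩ := exists_flag_equiv_over (m := 0) (g.toLinearMap ∘ₗ M y c) (N y c)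
      (F := fun _ => ⊤) (F' := fun _ => ⊤) monotone_const monotone_const rfl rfl
      (fun _ _ => by rw [Submodule.map_top, Submodule.map_top, LinearMap.range_comp, h])
      (fun _ _ => rfl)
    exact ⟨f, fun _ => hf, fun hc => absurd hc (hbip _ _ _ hy)⟩
  · simp only [armSubspace, hy, if_false] at h
    obtain ⟨f, -, hf⟩ := exists_flag_equiv_under (m := 0) (M c y) (N c y ∘ₗ g.toLinearMap)
      (F := fun _ => ⊤) (F' := fun _ => ⊤) monotone_const monotone_const rfl rfl
      (fun _ _ => rfl)
      (by rw [LinearMap.ker_comp, ← h, Submodule.comap_map_eq_of_injective g.injective])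
      (fun _ _ => rfl)
    exact ⟨f, fun hc => absurd hc hy, fun _ w => (hf w).symm⟩

/-- Stars with at most three arms (type `D₄`) are representation finite: a representation amounts to
three subspaces of the space at the centre. -/
theorem repFinite_star {E : Finset (V × V)} (hbip : ArrowBipartite E) (c : V) (s : Fin 3 → V)
    (hc : ∀ e ∈ E, (e.1 = c ∧ ∃ i, e.2 = s i) ∨ (e.2 = c ∧ ∃ i, e.1 = s i)) : RepFinite k E d := by
  classical
  obtain ⟨n, φ, hφ⟩ := finClasses_triples (k := k) (d c)
  refine FinClasses.of_finite (fun M => φ fun i => armSubspace E M c (s i)) fun M N hMN => ?_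
  obtain ⟨g, hg⟩ := hφ _ _ hMN
  have hex : ∀ y, ∃ f : (Fin (d y) → k) ≃ₗ[k] (Fin (d y) → k), (∃ i, y = s i) →
      ((y, c) ∈ E → ∀ w, N y c (f w) = g (M y c w)) ∧
      ((c, y) ∈ E → ∀ w, N c y (g w) = f (M c y w)) := by
    intro y
    by_cases hy : ∃ i, y = s i
    · obtain ⟨i, rfl⟩ := hy
      obtain ⟨f, hf⟩ := exists_equiv_of_map_armSubspace hbip (hg i)
      exact ⟨f, fun _ => hf⟩
    · exact ⟨LinearEquiv.refl k _, fun h => absurd h hy⟩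
  choose f hf using hex
  refine ⟨Function.update f c g, fun a b hab w => ?_⟩
  rcases hc _ hab with ⟨rfl, hi⟩ | ⟨rfl, hi⟩
  · have hne : b ≠ a := by
      rintro rfl
      exact hbip _ _ _ hab hab
    rw [Function.update_self, Function.update_of_ne hne]
    exact (hf b hi).2 hab w
  · have hne : a ≠ b := by
      rintro rfl
      exact hbip _ _ _ hab hab
    rw [Function.update_self, Function.update_of_ne hne]
    exact (hf a hi).1 hab w

lemma exists_fin_three_of_ncard_le [Finite V] {S : Set V} (hS : S.ncard ≤ 3) {c : V} :
    ∃ s : Fin 3 → V, ∀ y ∈ S, ∃ i, y = s i := by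
  obtain ⟨f, hf⟩ : ∃ f : S → Fin 3, Function.Injective f := by
    have : Nat.card S ≤ 3 := hS
    exact ⟨Fin.castLE this ∘ Finite.equivFin S,
      (Fin.castLE_injective this).comp (Finite.equivFin S).injective⟩
  classical
  refine ⟨fun i => if h : ∃ y : S, f y = i then h.choose else c, fun y hy => ⟨f ⟨y, hy⟩, ?_⟩⟩
  have h : ∃ z : S, f z = f ⟨y, hy⟩ := ⟨_, rfl⟩
  change y = dite _ _ _
  rw [dif_pos h, hf h.choose_spec]

/-- A forest in which every vertex of dimension at least two has at most three neighbours, and any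
two adjacent vertices of dimension at least two have at most four neighbours in total, is
representation finite. Cutting at the vertices of dimension at most one, only stars with three arms
and chains remain. -/
theorem repFinite_of_forest [Finite V] (E : Finset (V × V)) (hE : ArrowAcyclic E)
    (hbip : ArrowBipartite E) (h2 : ∀ x, 2 ≤ d x → (arrowNbrs E x).ncard ≤ 3)
    (h3 : ∀ x y, (x, y) ∈ E → 2 ≤ d x → 2 ≤ d y →
      (arrowNbrs E x).ncard + (arrowNbrs E y).ncard ≤ 4) : RepFinite k E d := by
  classical
  induction E using Finset.strongInduction with
  | H E ih =>
    have hrec : ∀ E', E' ⊂ E → RepFinite k E' d := fun E' hss => by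
      have hn : ∀ x, (arrowNbrs E' x).ncard ≤ (arrowNbrs E x).ncard := fun x =>
        Set.ncard_le_ncard (arrowNbrs_mono hss.1 x) (Set.toFinite _)
      exact ih E' hss (hE.mono hss.1) (hbip.mono hss.1) (fun x hx => (hn x).trans (h2 x hx))
        fun x y hxy hx hy => (Nat.add_le_add (hn x) (hn y)).trans (h3 x y (hss.1 hxy) hx hy)
    by_cases hcut : ∃ z, d z ≤ 1 ∧ 2 ≤ (arrowNbrs E z).ncard
    · -- Cut off a branch at `z`.
      obtain ⟨z, hz1, hz2⟩ := hcut
      obtain ⟨y, hy, y', hy', hne⟩ := (Set.one_lt_ncard (Set.toFinite _)).1 hz2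
      obtain ⟨R, hyR, hyR', hzR, hR⟩ := hE.exists_branch hbip hy hy' hne
      let E₁ := E.filter fun e => e.1 ∈ R ∨ e.2 ∈ R
      let E₂ := E.filter fun e => ¬ (e.1 ∈ R ∨ e.2 ∈ R)
      have hs1 : E₁ ⊂ E := by
        refine Finset.filter_ssubset.2 ?_
        rcases hy' with h | h
        · exact ⟨_, h, by simp [hzR, hyR']⟩
        · exact ⟨_, h, by simp [hzR, hyR']⟩
      have hs2 : E₂ ⊂ E := by
        refine Finset.filter_ssubset.2 ?_
        rcases hy with h | h
        · exact ⟨_, h, by simp [hyR]⟩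
        · exact ⟨_, h, by simp [hyR]⟩
      have hshare : ∀ w, (arrowNbrs E₁ w).Nonempty → (arrowNbrs E₂ w).Nonempty → w = z := by
        rintro w ⟨a, ha⟩ ⟨b, hb⟩
        have hwR : w ∉ R := by
          rcases hb with hb | hb <;> have := (Finset.mem_filter.1 hb).2 <;> tauto
        by_contra hwz
        have haR : a ∈ R := by
          rcases ha with ha | ha <;> have := (Finset.mem_filter.1 ha).2 <;> tauto
        exact hwR (hR a haR w (mem_arrowNbrs_comm.1 (arrowNbrs_mono hs1.1 w ha)) hwz)
      refine (hrec E₁ hs1).glue (hrec E₂ hs2) (fun e he => ?_) (fun w hw1 hw2 => ?_)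
        fun w hw1 hw2 w' hw1' hw2' => (hshare w hw1 hw2).trans (hshare w' hw1' hw2').symm
      · by_cases h : e.1 ∈ R ∨ e.2 ∈ R
        · exact Or.inl (Finset.mem_filter.2 ⟨he, h⟩)
        · exact Or.inr (Finset.mem_filter.2 ⟨he, h⟩)
      · rw [hshare w hw1 hw2]
        exact hz1
    push Not at hcut
    have hdim : ∀ z, 2 ≤ (arrowNbrs E z).ncard → 2 ≤ d z := fun z hz => by
      by_contra h
      have := hcut z (by omega)
      omega
    by_cases hstar : ∃ c, 3 ≤ (arrowNbrs E c).ncard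
    · -- The star with centre `c` is separated from the rest.
      obtain ⟨c, hc⟩ := hstar
      have hdc := hdim c (by omega)
      let E₁ := E.filter fun e => e.1 = c ∨ e.2 = c
      let E₂ := E.filter fun e => ¬ (e.1 = c ∨ e.2 = c)
      have hs2 : E₂ ⊂ E := by
        refine Finset.filter_ssubset.2 ?_
        obtain ⟨y, hy⟩ := Set.nonempty_of_ncard_ne_zero (s := arrowNbrs E c) (by omega)
        rcases hy with h | h
        · exact ⟨_, h, by simp⟩
        · exact ⟨_, h, by simp⟩
      obtain ⟨s, hs⟩ := exists_fin_three_of_ncard_le (h2 c hdc) (c := c)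
      have hsub : E₁ ⊆ E := Finset.filter_subset _ _
      have h₁ : RepFinite k E₁ d := by
        refine repFinite_star (hbip.mono hsub) c s ?_
        rintro ⟨a, b⟩ hab
        obtain ⟨he, h | h⟩ := Finset.mem_filter.1 hab
        · exact Or.inl ⟨h, hs b (Or.inl (h ▸ he))⟩
        · exact Or.inr ⟨h, hs a (Or.inr (h ▸ he))⟩
      have hshare : ∀ w, (arrowNbrs E₁ w).Nonempty → (arrowNbrs E₂ w).Nonempty → False := by
        rintro w ⟨a, ha⟩ ⟨b, hb⟩
        have hwc : w ≠ c ∧ b ≠ c := by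
          rcases hb with hb | hb <;> have := (Finset.mem_filter.1 hb).2 <;> tauto
        have hac : a = c := by
          rcases ha with ha | ha <;> have := (Finset.mem_filter.1 ha).2 <;> tauto
        subst hac
        have ha' := arrowNbrs_mono hsub w ha
        have hw : 2 ≤ (arrowNbrs E w).ncard := by
          refine (Set.one_lt_ncard (Set.toFinite _)).2 ⟨a, ha', b, arrowNbrs_mono hs2.1 w hb, ?_⟩
          exact fun h => hwc.2 h.symm
        have hdw := hdim w hw
        rcases ha' with h | h
        · have := h3 _ _ h hdw hdc
          omega
        · have := h3 _ _ h hdc hdw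
          omega
      refine h₁.glue (hrec E₂ hs2) (fun e he => ?_) (fun w hw1 hw2 => (hshare w hw1 hw2).elim)
        fun w hw1 hw2 => (hshare w hw1 hw2).elim
      by_cases h : e.1 = c ∨ e.2 = c
      · exact Or.inl (Finset.mem_filter.2 ⟨he, h⟩)
      · exact Or.inr (Finset.mem_filter.2 ⟨he, h⟩)
    · push Not at hstar
      rcases E.eq_empty_or_nonempty with rfl | hne
      · exact repFinite_empty
      · obtain ⟨x, y, hx⟩ := hE.exists_leaf hne
        exact (flaggedFinite_of_ncard_le_two E hE hbip (fun z => Nat.lt_succ_iff.1 (hstar z)) x 0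
          (by rw [hx, Set.ncard_singleton])).repFinite

end Forest

/-! ### From quivers to sets of arrows -/

section Quivers

variable {V : Type} [Quiver.{0} V]

/-- The pairs of vertices joined by an arrow. Multiplicities are forgotten. -/
noncomputable def arrowSet (V : Type) [Quiver.{0} V] [Finite V] : Finset (V × V) :=
  (Set.toFinite {e : V × V | Nonempty (e.1 ⟶ e.2)}).toFinset

lemma mem_arrowSet [Finite V] {x y : V} : (x, y) ∈ arrowSet V ↔ Nonempty (x ⟶ y) := by
  simp [arrowSet]

/-- For quivers without parallel arrows, isomorphism of representations is isomorphism of families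
along the set of arrows. -/
lemma RepFinite.representationFinite [Finite V] (hsub : ∀ x y : V, Subsingleton (x ⟶ y))
    {k : Type u} [Field k] {d : V → ℕ} (h : RepFinite k (arrowSet V) d) :
    RepresentationFinite k d := by
  classical
  obtain ⟨n, φ, hφ⟩ := h
  let f : QuiverRep k d → RepFamily k d := fun M x y =>
    if h : Nonempty (x ⟶ y) then M h.some else 0
  have hf : ∀ M : QuiverRep k d, ∀ x y (α : x ⟶ y), f M x y = M α := fun M x y α => by
    have h : Nonempty (x ⟶ y) := ⟨α⟩
    rw [Subsingleton.elim α h.some]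
    exact dif_pos h
  refine FinClasses.finite_quotient _ ⟨n, fun M => φ (f M), fun M N hMN => ?_⟩
  obtain ⟨g, hg⟩ := hφ _ _ hMN
  refine ⟨g, fun x y α => LinearMap.ext fun w => ?_⟩
  have := hg x y (mem_arrowSet.2 ⟨α⟩) ((g x).symm w)
  rw [LinearEquiv.apply_symm_apply, hf, hf] at this
  simpa using this

lemma ORCond1.arrowAcyclic [Finite V] {d : V → ℕ} (h : ORCond1 d) : ArrowAcyclic (arrowSet V) := by
  intro n x hn hx hb h0
  refine h ⟨n, x, hn, fun i hi => ?_, hb, h0⟩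
  exact (hx i hi).imp mem_arrowSet.1 mem_arrowSet.1

lemma ncard_setOf_nonempty_hom_le_outDeg [Finite V] [∀ x y : V, Finite (x ⟶ y)] (x : V) :
    {y | Nonempty (x ⟶ y)}.ncard ≤ outDeg x := by
  have : Finite (Quiver.Star x) := inferInstanceAs (Finite (Σ y, (x ⟶ y)))
  refine Nat.card_le_card_of_injective (fun y : {y | Nonempty (x ⟶ y)} =>
    (⟨y.1, y.2.some⟩ : Quiver.Star x)) fun y z h => Subtype.ext (congrArg Sigma.fst h)

lemma ncard_setOf_nonempty_hom_le_inDeg [Finite V] [∀ x y : V, Finite (x ⟶ y)] (x : V) :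
    {y | Nonempty (y ⟶ x)}.ncard ≤ inDeg x := by
  have : Finite (Quiver.Costar x) := inferInstanceAs (Finite (Σ y, (y ⟶ x)))
  refine Nat.card_le_card_of_injective (fun y : {y | Nonempty (y ⟶ x)} =>
    (⟨y.1, y.2.some⟩ : Quiver.Costar x)) fun y z h => Subtype.ext (congrArg Sigma.fst h)

lemma outDeg_eq_ncard (hsub : ∀ x y : V, Subsingleton (x ⟶ y)) (x : V) :
    outDeg x = {y | Nonempty (x ⟶ y)}.ncard := by
  refine Nat.card_congr (Equiv.ofBijective (fun p : Quiver.Star x =>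
    (⟨p.1, ⟨p.2⟩⟩ : {y | Nonempty (x ⟶ y)})) ⟨?_, ?_⟩)
  · rintro ⟨y, α⟩ ⟨z, β⟩ h
    obtain rfl : y = z := congrArg Subtype.val h
    rw [Subsingleton.elim α β]
  · rintro ⟨y, ⟨α⟩⟩
    exact ⟨⟨y, α⟩, rfl⟩

lemma inDeg_eq_ncard (hsub : ∀ x y : V, Subsingleton (x ⟶ y)) (x : V) :
    inDeg x = {y | Nonempty (y ⟶ x)}.ncard := by
  refine Nat.card_congr (Equiv.ofBijective (fun p : Quiver.Costar x =>
    (⟨p.1, ⟨p.2⟩⟩ : {y | Nonempty (y ⟶ x)})) ⟨?_, ?_⟩)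
  · rintro ⟨y, α⟩ ⟨z, β⟩ h
    obtain rfl : y = z := congrArg Subtype.val h
    rw [Subsingleton.elim α β]
  · rintro ⟨y, ⟨α⟩⟩
    exact ⟨⟨y, α⟩, rfl⟩

/-- For bipartite quivers, the three conditions bound the number of neighbours, so that
`repFinite_of_forest` applies to every smaller dimension vector. -/
lemma repFinite_of_conditions [Finite V] [∀ x y : V, Finite (x ⟶ y)] {k : Type u} [Field k]
    (hbip : ArrowBipartite (arrowSet V)) {d d' : V → ℕ} (hd : ∀ x, d' x ≤ d x) (h1 : ORCond1 d)
    (h2 : ORCond2 d) (h3 : ORCond3 d) : RepFinite k (arrowSet V) d' := by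
  have hout : ∀ x y, (x, y) ∈ arrowSet V → (arrowNbrs (arrowSet V) x).ncard ≤ outDeg x := by
    intro x y hxy
    refine le_trans (Set.ncard_le_ncard ?_ (Set.toFinite _)) (ncard_setOf_nonempty_hom_le_outDeg x)
    rintro z (hz | hz)
    · exact mem_arrowSet.1 hz
    · exact absurd hxy (hbip _ _ _ hz)
  have hin : ∀ x y, (x, y) ∈ arrowSet V → (arrowNbrs (arrowSet V) y).ncard ≤ inDeg y := by
    intro x y hxy
    refine le_trans (Set.ncard_le_ncard ?_ (Set.toFinite _)) (ncard_setOf_nonempty_hom_le_inDeg y)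
    rintro z (hz | hz)
    · exact absurd hz (hbip _ _ _ hxy)
    · exact mem_arrowSet.1 hz
  refine repFinite_of_forest _ h1.arrowAcyclic hbip (fun x hx => ?_) fun x y hxy hx hy => ?_
  · have hx' := hx.trans (hd x)
    rcases (arrowNbrs (arrowSet V) x).eq_empty_or_nonempty with h | ⟨y, hy | hy⟩
    · simp [h]
    · exact (hout x y hy).trans (h2 x hx').1
    · exact (hin y x hy).trans (h2 x hx').2
  · exact (Nat.add_le_add (hout x y hxy) (hin x y hxy)).trans
      (h3 (mem_arrowSet.1 hxy).some (hx.trans (hd x)) (hy.trans (hd y)))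

/-- A quiver has no cycles if it carries a height function for which neighbours have different
heights and every vertex has at most one lower neighbour: a reduced walk then has no interior local
maximum, so that a closed one descends from its base point on both sides to the same vertex. -/
lemma not_hasCycle_of_height (h : V → ℕ) (h1 : ∀ x y : V, ArrowConnected x y → h x ≠ h y)
    (h2 : ∀ x y z : V, ArrowConnected x y → ArrowConnected x z → h y < h x → h z < h x → y = z) :
    ¬ HasCycle V := by
  rintro ⟨n, x, hn, hx, hb, h0⟩
  induction n using Nat.strong_induction_on generalizing x with
  | _ n ih =>
    have hx' : ∀ i, 0 < i → i ≤ n → ArrowConnected (x i) (x (i - 1)) := fun i hi hin => by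
      have := hx (i - 1) (by omega)
      rw [Nat.sub_add_cancel hi] at this
      exact this.symm
    obtain ⟨j, hj, hmax⟩ := Finset.exists_max_image (Finset.range (n + 1)) (fun i => h (x i))
      ⟨0, by simp⟩
    have hlt : ∀ i ≤ n, ArrowConnected (x j) (x i) → h (x i) < h (x j) := fun i hi hc =>
      lt_of_le_of_ne (hmax i (by simpa [Nat.lt_succ_iff] using hi)) (h1 _ _ hc).symm
    have hjn : j ≤ n := Nat.lt_succ_iff.1 (Finset.mem_range.1 hj)
    by_cases hj' : 0 < j ∧ j < n
    · exact hb j hj'.1 hj'.2 (h2 (x j) _ _ (hx' j hj'.1 hjn) (hx j hj'.2)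
        (hlt _ (by omega) (hx' j hj'.1 hjn)) (hlt _ (by omega) (hx j hj'.2)))
    · have hxj : x j = x 0 := by
        rcases Nat.eq_zero_or_pos j with rfl | hpos
        · rfl
        · rw [show j = n by omega, h0]
      have c1 : ArrowConnected (x j) (x 1) := hxj ▸ hx 0 hn
      have c2 : ArrowConnected (x j) (x (n - 1)) := by
        rw [hxj, h0]
        exact hx' n hn le_rfl
      have heq : x 1 = x (n - 1) :=
        h2 (x j) _ _ c1 c2 (hlt _ hn c1) (hlt _ (Nat.sub_le _ _) c2)
      rcases lt_trichotomy n 2 with hn2 | rfl | hn2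
      · obtain rfl : n = 1 := by omega
        exact h1 _ _ (hx 0 hn) (by rw [h0])
      · exact hb 1 (by omega) (by omega) h0
      · refine ih (n - 2) (by omega) (fun i => x (i + 1)) (by omega) (fun i hi => hx _ (by omega))
          (fun i hi hi' => ?_) ?_
        · have := hb (i + 1) (by omega) (by omega)
          rwa [show i + 1 - 1 = i - 1 + 1 by omega] at this
        · rw [show n - 2 + 1 = n - 1 by omega, ← heq]

end Quivers

/-! ### The example quiver -/

section Example

/-- In dimension at most two, a chain `F₁ ≤ F₂` of subspaces has at most one nontrivial member: the
subspace `F₂` if it is a line, or else `F₁`. -/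
lemma map_eq_of_chain {k : Type*} [Field k] {W : Type*} [AddCommGroup W] [Module k W]
    [FiniteDimensional k W] (hW : finrank k W ≤ 2) {F₁ F₂ F₁' F₂' : Submodule k W} (h : F₁ ≤ F₂)
    (h' : F₁' ≤ F₂') (e₁ : finrank k F₁ = finrank k F₁') (e₂ : finrank k F₂ = finrank k F₂')
    (g : W ≃ₗ[k] W)
    (hg : (if finrank k F₂ = 1 then F₂ else F₁).map (g : W →ₗ[k] W) =
      if finrank k F₂' = 1 then F₂' else F₁') :
    F₁.map (g : W →ₗ[k] W) = F₁' ∧ F₂.map (g : W →ₗ[k] W) = F₂' := by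
  by_cases h1 : finrank k F₂ = 1
  · rw [if_pos h1, if_pos (e₂ ▸ h1)] at hg
    refine ⟨?_, hg⟩
    have hle := Submodule.finrank_mono h
    by_cases h0 : finrank k F₁ = 0
    · rw [Submodule.finrank_eq_zero.1 h0, Submodule.finrank_eq_zero.1 (e₁.symm.trans h0),
        Submodule.map_bot]
    · rw [Submodule.eq_of_le_of_finrank_le h (by omega),
        Submodule.eq_of_le_of_finrank_le h' (by omega), hg]
  · rw [if_neg h1, if_neg (e₂ ▸ h1)] at hg
    refine ⟨hg, ?_⟩
    have hle := Submodule.finrank_le F₂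
    by_cases h0 : finrank k F₂ = 0
    · rw [Submodule.finrank_eq_zero.1 h0, Submodule.finrank_eq_zero.1 (e₂.symm.trans h0),
        Submodule.map_bot]
    · rw [Submodule.eq_top_of_finrank_eq (show finrank k F₂ = finrank k W by omega),
        Submodule.eq_top_of_finrank_eq (show finrank k F₂' = finrank k W by omega),
        Submodule.map_top, LinearEquiv.range]

/-- The quiver `V` is the example quiver, embedded by `s`, together with isolated vertices. -/
structure IsExampleQuiver {V : Type} [Quiver.{0} V] (s : ExVertex → V) : Prop where
  inj : Function.Injective s
  hom_iff : ∀ x y : V, Nonempty (x ⟶ y) ↔ ∃ p q, Nonempty (ExArrow p q) ∧ s p = x ∧ s q = y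
  subsingleton : ∀ x y : V, Subsingleton (x ⟶ y)

namespace IsExampleQuiver

variable {V : Type} [Quiver.{0} V] {s : ExVertex → V}

/-- The example (of type `D₅`) is representation finite if the dimension at `v` is at most two: a
representation amounts to the subspaces `M_bv (k ^ d b)`, `M_cv (k ^ d c)` and the chain
`M_av (ker M_au) ≤ M_av (k ^ d a)` in the space at `v`, and the chain counts as one subspace. -/
theorem repFinite [Finite V] (hs : IsExampleQuiver s) {k : Type u} [Field k] {d : V → ℕ}
    (hd : d (s .v) ≤ 2) : RepFinite k (arrowSet V) d := by
  classical
  obtain ⟨n, φ, hφ⟩ := finClasses_triples (k := k) (d (s .v))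
  let K : RepFamily k d → Submodule k (Fin (d (s .a)) → k) := fun M =>
    LinearMap.ker (M (s .a) (s .u))
  let F₁ : RepFamily k d → Submodule k (Fin (d (s .v)) → k) := fun M => (K M).map (M (s .a) (s .v))
  let F₂ : RepFamily k d → Submodule k (Fin (d (s .v)) → k) := fun M =>
    LinearMap.range (M (s .a) (s .v))
  have hF : ∀ M, F₁ M ≤ F₂ M := fun M => LinearMap.map_le_range
  let U : RepFamily k d → Fin 3 → Submodule k (Fin (d (s .v)) → k) := fun M =>
    ![if finrank k (F₂ M) = 1 then F₂ M else F₁ M, LinearMap.range (M (s .b) (s .v)),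
      LinearMap.range (M (s .c) (s .v))]
  have hlt : ∀ {m : ℕ} (P : Submodule k (Fin m → k)), finrank k P < m + 1 := fun P =>
    Nat.lt_succ_of_le ((Submodule.finrank_le P).trans_eq (finrank_fin_fun k))
  refine FinClasses.of_finite (fun M => ((φ (U M), (⟨_, hlt (K M)⟩ : Fin _)),
    ((⟨_, hlt (F₁ M)⟩ : Fin _), (⟨_, hlt (F₂ M)⟩ : Fin _)))) fun M N hMN => ?_
  simp only [Prod.mk.injEq, Fin.mk.injEq] at hMN
  obtain ⟨⟨eU, eK⟩, e₁, e₂⟩ := hMN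
  obtain ⟨gv, hgv⟩ := hφ _ _ eU
  obtain ⟨hg₁, hg₂⟩ := map_eq_of_chain (by rw [finrank_fin_fun]; exact hd) (hF M) (hF N) e₁ e₂ gv
    (hgv 0)
  have harm : ∀ p : ExVertex, (LinearMap.range (M (s p) (s .v))).map
      (gv : (Fin (d (s .v)) → k) →ₗ[k] _) = LinearMap.range (N (s p) (s .v)) →
      ∃ f : (Fin (d (s p)) → k) ≃ₗ[k] (Fin (d (s p)) → k),
        ∀ w, N (s p) (s .v) (f w) = gv (M (s p) (s .v) w) := fun p hp => by
    obtain ⟨f, -, hf⟩ := exists_flag_equiv_over (m := 0) (gv.toLinearMap ∘ₗ M (s p) (s .v))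
      (N (s p) (s .v)) (F := fun _ => ⊤) (F' := fun _ => ⊤) monotone_const monotone_const rfl rfl
      (fun _ _ => by rw [Submodule.map_top, Submodule.map_top, LinearMap.range_comp, hp])
      (fun _ _ => rfl)
    exact ⟨f, hf⟩
  obtain ⟨gb, hgb⟩ := harm .b (hgv 1)
  obtain ⟨gc, hgc⟩ := harm .c (hgv 2)
  have hmono : ∀ P : Submodule k (Fin (d (s .a)) → k),
      Monotone fun i : ℕ => if i = 0 then P else ⊤ := fun P i j hij => by
    dsimp only
    split_ifs with h1 h2
    · exact le_rfl
    · exact le_top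
    · omega
    · exact le_rfl
  obtain ⟨ga, hga, hgav⟩ := exists_flag_equiv_over (m := 1) (gv.toLinearMap ∘ₗ M (s .a) (s .v))
    (N (s .a) (s .v)) (hmono (K M)) (hmono (K N)) rfl rfl
    (fun i _ => by
      rcases i with _ | i
      · rw [Submodule.map_comp]
        exact hg₁
      · simp only [Nat.add_eq_zero_iff, one_ne_zero, and_false, if_false]
        rw [Submodule.map_top, Submodule.map_top, LinearMap.range_comp]
        exact hg₂)
    (fun i _ => by
      rcases i with _ | i
      · exact eK
      · rfl)
  obtain ⟨gu, -, hgu⟩ := exists_flag_equiv_under (m := 0) (M (s .a) (s .u))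
    (N (s .a) (s .u) ∘ₗ ga.toLinearMap) (F := fun _ => ⊤) (F' := fun _ => ⊤) monotone_const
    monotone_const rfl rfl (fun _ _ => rfl)
    (by
      rw [LinearMap.ker_comp]
      have := hga 0
      simp only [if_true] at this
      change K M = (K N).comap _
      rw [← this, Submodule.comap_map_eq_of_injective ga.injective])
    (fun _ _ => rfl)
  let g : BaseChange k d := Function.update (Function.update (Function.update (Function.update
    (Function.update (fun x => LinearEquiv.refl k _) (s .a) ga) (s .b) gb) (s .c) gc) (s .u) gu)
    (s .v) gv
  have ea : g (s .a) = ga := by simp [g, Function.update_of_ne, hs.inj.eq_iff]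
  have eb : g (s .b) = gb := by simp [g, Function.update_of_ne, hs.inj.eq_iff]
  have ec : g (s .c) = gc := by simp [g, Function.update_of_ne, hs.inj.eq_iff]
  have eu : g (s .u) = gu := by simp [g, Function.update_of_ne, hs.inj.eq_iff]
  have ev : g (s .v) = gv := by simp [g]
  refine ⟨g, fun x y hxy w => ?_⟩
  obtain ⟨p, q, ⟨α⟩, rfl, rfl⟩ := (hs.hom_iff x y).1 (mem_arrowSet.1 hxy)
  cases α
  · rw [ea, eu]
    exact (hgu w).symm
  · rw [ea, ev]
    exact hgav w
  · rw [eb, ev]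
    exact hgb w
  · rw [ec, ev]
    exact hgc w

lemma orCond1 (hs : IsExampleQuiver s) (d : V → ℕ) : ORCond1 d := by
  classical
  have hconn : ∀ x y : V, ArrowConnected x y → ∃ p q, (Nonempty (ExArrow p q) ∨
      Nonempty (ExArrow q p)) ∧ s p = x ∧ s q = y := by
    rintro x y (h | h)
    · obtain ⟨p, q, hα, rfl, rfl⟩ := (hs.hom_iff _ _).1 h
      exact ⟨p, q, Or.inl hα, rfl, rfl⟩
    · obtain ⟨p, q, hα, rfl, rfl⟩ := (hs.hom_iff _ _).1 h
      exact ⟨q, p, Or.inr hα, rfl, rfl⟩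
  -- The height is the distance from `v`.
  let h : V → ℕ := fun x => if x = s .v then 0 else if x = s .u then 2 else 1
  refine not_hasCycle_of_height h (fun x y hxy => ?_) fun x y z hxy hxz hy hz => ?_
  · obtain ⟨p, q, ⟨⟨α⟩⟩ | ⟨⟨α⟩⟩, rfl, rfl⟩ := hconn x y hxy <;> cases α <;>
      simp [h, hs.inj.eq_iff]
  · obtain ⟨p, q, ⟨⟨α⟩⟩ | ⟨⟨α⟩⟩, rfl, rfl⟩ := hconn x y hxy <;>
      obtain ⟨p', q', hα', hp', rfl⟩ := hconn _ z hxz <;>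
      obtain rfl := hs.inj hp' <;> rcases hα' with ⟨⟨β⟩⟩ | ⟨⟨β⟩⟩ <;> cases α <;> cases β <;>
      simp [h, hs.inj.eq_iff] at hy hz ⊢

lemma setOf_nonempty_hom (hs : IsExampleQuiver s) (p : ExVertex) :
    {y | Nonempty (s p ⟶ y)} = s '' {q | Nonempty (ExArrow p q)} := by
  ext y
  constructor
  · intro h
    obtain ⟨p', q, hα, hp, rfl⟩ := (hs.hom_iff _ _).1 h
    exact ⟨q, hs.inj hp ▸ hα, rfl⟩
  · rintro ⟨q, hα, rfl⟩
    exact (hs.hom_iff _ _).2 ⟨p, q, hα, rfl, rfl⟩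

lemma setOf_nonempty_hom' (hs : IsExampleQuiver s) (q : ExVertex) :
    {x | Nonempty (x ⟶ s q)} = s '' {p | Nonempty (ExArrow p q)} := by
  ext x
  constructor
  · intro h
    obtain ⟨p, q', hα, rfl, hq⟩ := (hs.hom_iff _ _).1 h
    exact ⟨p, hs.inj hq ▸ hα, rfl⟩
  · rintro ⟨p, hα, rfl⟩
    exact (hs.hom_iff _ _).2 ⟨p, q, hα, rfl, rfl⟩

lemma orCond2 (hs : IsExampleQuiver s) (d : V → ℕ) : ORCond2 d := by
  intro x _
  rw [outDeg_eq_ncard hs.subsingleton, inDeg_eq_ncard hs.subsingleton]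
  constructor
  · refine (Set.ncard_le_ncard (t := {s .u, s .v, s .v}) ?_ (Set.toFinite _)).trans
      ((Set.ncard_insert_le _ _).trans (Nat.succ_le_succ ((Set.ncard_insert_le _ _).trans_eq
        (by rw [Set.ncard_singleton]))))
    rintro y hy
    obtain ⟨p, q, ⟨α⟩, rfl, rfl⟩ := (hs.hom_iff _ _).1 hy
    cases α <;> simp
  · refine (Set.ncard_le_ncard (t := {s .a, s .b, s .c}) ?_ (Set.toFinite _)).trans
      ((Set.ncard_insert_le _ _).trans (Nat.succ_le_succ ((Set.ncard_insert_le _ _).trans_eq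
        (by rw [Set.ncard_singleton]))))
    rintro y hy
    obtain ⟨p, q, ⟨α⟩, rfl, rfl⟩ := (hs.hom_iff _ _).1 hy
    cases α <;> simp

/-- The arrow `a → v` violates condition (3): two arrows start at `a` and three terminate at `v`. -/
lemma not_orCond3 (hs : IsExampleQuiver s) {d : V → ℕ} (ha : 2 ≤ d (s .a)) (hv : 2 ≤ d (s .v)) :
    ¬ ORCond3 d := by
  intro h
  have hav : Nonempty (s .a ⟶ s .v) := (hs.hom_iff _ _).2 ⟨.a, .v, ⟨.av⟩, rfl, rfl⟩
  have := h hav.some ha hv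
  rw [outDeg_eq_ncard hs.subsingleton, inDeg_eq_ncard hs.subsingleton, hs.setOf_nonempty_hom,
    hs.setOf_nonempty_hom', Set.ncard_image_of_injective _ hs.inj,
    Set.ncard_image_of_injective _ hs.inj] at this
  have e1 : {q | Nonempty (ExArrow .a q)} = {.u, .v} := by
    ext q
    simp only [Set.mem_ofPred_eq, Set.mem_insert_iff, Set.mem_singleton_iff]
    constructor
    · rintro ⟨⟨⟩⟩ <;> simp
    · rintro (rfl | rfl)
      · exact ⟨.au⟩
      · exact ⟨.av⟩
  have e2 : {p | Nonempty (ExArrow p .v)} = {.a, .b, .c} := by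
    ext q
    simp only [Set.mem_ofPred_eq, Set.mem_insert_iff, Set.mem_singleton_iff]
    constructor
    · rintro ⟨⟨⟩⟩ <;> simp
    · rintro (rfl | rfl | rfl)
      · exact ⟨.av⟩
      · exact ⟨.bv⟩
      · exact ⟨.cv⟩
  have e3 : ({.a, .b, .c} : Set ExVertex).ncard = 3 :=
    Set.ncard_eq_three.2 ⟨.a, .b, .c, by simp, by simp, by simp, rfl⟩
  rw [e1, e2, e3, Set.ncard_pair (by simp)] at this
  omega

lemma settingLE (hs : IsExampleQuiver s) {d : V → ℕ} (hd : ∀ p, exDim p ≤ d (s p)) :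
    SettingLE exDim d := by
  refine ⟨⟨s, fun {p q} α => ((hs.hom_iff _ _).2 ⟨p, q, ⟨α⟩, rfl, rfl⟩).some⟩, hs.inj,
    fun p q α β _ => ?_, hd⟩
  change ExArrow p q at α β
  cases α <;> cases β <;> rfl

end IsExampleQuiver

lemma isExampleQuiver_id : IsExampleQuiver (id : ExVertex → ExVertex) where
  inj := Function.injective_id
  hom_iff x y := ⟨fun h => ⟨x, y, h, rfl, rfl⟩, by rintro ⟨p, q, h, rfl, rfl⟩; exact h⟩
  subsingleton x y := ⟨fun α β => by
    change ExArrow x y at α β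
    cases α <;> cases β <;> rfl⟩

instance : Finite ExVertex :=
  Finite.of_surjective ![.a, .b, .c, .u, .v] fun p => by
    cases p
    exacts [⟨0, rfl⟩, ⟨1, rfl⟩, ⟨2, rfl⟩, ⟨3, rfl⟩, ⟨4, rfl⟩]

end Example

/-! ### Orbits of the unit group -/

lemma FinClasses.of_fibers {X ι : Type*} [Finite ι] {r : X → X → Prop} (μ : X → ι)
    (h : ∀ i, FinClasses fun x y : {x // μ x = i} => r x y) : FinClasses r := by
  choose n φ hφ using h
  refine FinClasses.of_finite (fun x => (⟨μ x, φ (μ x) ⟨x, rfl⟩⟩ : Σ i, Fin (n i)))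
    fun x y hxy => ?_
  have aux : ∀ i (hi : μ x = i), (⟨i, φ i ⟨x, hi⟩⟩ : Σ i, Fin (n i)) =
      ⟨μ x, φ (μ x) ⟨x, rfl⟩⟩ := by
    rintro _ rfl
    rfl
  exact hφ (μ y) ⟨x, congrArg Sigma.fst hxy⟩ ⟨y, rfl⟩
    (sigma_mk_injective (β := fun i => Fin (n i)) ((aux _ (congrArg Sigma.fst hxy)).trans hxy))

section MatrixNormalForm

variable {k : Type u} [Field k]

/-- The inclusion `k ^ m → k ^ n` of the first `m` coordinates. -/
def blockIncl (k : Type u) [Field k] {m n : ℕ} (h : m ≤ n) : Matrix (Fin n) (Fin m) k :=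
  (1 : Matrix (Fin n) (Fin n) k).submatrix id (Fin.castLE h)

/-- The projection `k ^ n → k ^ m` to the first `m` coordinates. -/
def blockProj (k : Type u) [Field k] {m n : ℕ} (h : m ≤ n) : Matrix (Fin m) (Fin n) k :=
  (1 : Matrix (Fin n) (Fin n) k).submatrix (Fin.castLE h) id

lemma blockProj_mul_blockIncl {m n : ℕ} (h : m ≤ n) : blockProj k h * blockIncl k h = 1 := by
  rw [blockProj, blockIncl, ← Matrix.submatrix_mul _ _ _ id _ Function.bijective_id,
    Matrix.one_mul, Matrix.submatrix_one _ (Fin.castLE_injective h)]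

lemma blockProj_mul_blockIncl_mul {m n : ℕ} {ι : Type*} (h : m ≤ n) (X : Matrix (Fin m) ι k) :
    blockProj k h * (blockIncl k h * X) = X := by
  rw [← Matrix.mul_assoc, blockProj_mul_blockIncl, Matrix.one_mul]

/-- The square matrices of size `n` and nullity `m` form one orbit under multiplication by units on
both sides, represented by the projection to the last `n - m` coordinates. -/
lemma exists_mul_mul_eq_one_sub {n : ℕ} (s : Matrix (Fin n) (Fin n) k) :
    ∃ (m : ℕ) (h : m ≤ n) (P Q : (Matrix (Fin n) (Fin n) k)ˣ),
      (P : Matrix (Fin n) (Fin n) k) * s * (Q : Matrix (Fin n) (Fin n) k) =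
        1 - blockIncl k h * blockProj k h := by
  let α : (Fin n → k) →ₗ[k] (Fin n → k) := Matrix.toLin' s
  have hrn := LinearMap.finrank_range_add_finrank_ker α
  rw [finrank_fin_fun] at hrn
  let m := finrank k (LinearMap.ker α)
  have hm : m ≤ n := by omega
  let E : (Fin n → k) →ₗ[k] (Fin n → k) := Matrix.toLin' (1 - blockIncl k hm * blockProj k hm)
  have hE : LinearMap.range E = LinearMap.ker (Matrix.toLin' (blockProj k hm)) := by
    ext w
    constructor
    · rintro ⟨w, rfl⟩
      rw [LinearMap.mem_ker, ← LinearMap.comp_apply, ← Matrix.toLin'_mul, Matrix.mul_sub,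
        blockProj_mul_blockIncl_mul, Matrix.mul_one, sub_self, map_zero, LinearMap.zero_apply]
    · intro hw
      refine ⟨w, ?_⟩
      simp only [E, map_sub, Matrix.toLin'_one, Matrix.toLin'_mul, LinearMap.sub_apply,
        LinearMap.comp_apply, LinearMap.mem_ker.1 hw, map_zero, LinearMap.id_apply, sub_zero]
  have hEr : finrank k (LinearMap.range E) + m = n := by
    have h1 := LinearMap.finrank_range_add_finrank_ker (Matrix.toLin' (blockProj k hm))
    have h2 : LinearMap.range (Matrix.toLin' (blockProj k hm)) = ⊤ := by
      refine LinearMap.range_eq_top.2 fun w => ⟨Matrix.toLin' (blockIncl k hm) w, ?_⟩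
      rw [← LinearMap.comp_apply, ← Matrix.toLin'_mul, blockProj_mul_blockIncl, Matrix.toLin'_one,
        LinearMap.id_apply]
    rw [h2, finrank_top, finrank_fin_fun, finrank_fin_fun, ← hE] at h1
    omega
  -- First match the images, then the maps.
  have hmono : ∀ P : Submodule k (Fin n → k),
      Monotone fun i : ℕ => if i = 0 then P else ⊤ := fun P i j hij => by
    dsimp only
    split_ifs with h1 h2
    · exact le_rfl
    · exact le_top
    · omega
    · exact le_rfl
  obtain ⟨g, hg, -⟩ := exists_flag_equiv_over (m := 1) (0 : (Fin n → k) →ₗ[k] (Fin n → k)) 0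
    (hmono (LinearMap.range α)) (hmono (LinearMap.range E)) rfl rfl
    (fun _ _ => by rw [Submodule.map_zero, Submodule.map_zero]) (fun i _ => by
      rcases i with _ | i
      · change finrank k (LinearMap.range α) = finrank k (LinearMap.range E)
        omega
      · rfl)
  obtain ⟨f, -, hf⟩ := exists_flag_equiv_over (m := 0) (g.toLinearMap ∘ₗ α) E
    (F := fun _ => ⊤) (F' := fun _ => ⊤) monotone_const monotone_const rfl rfl
    (fun _ _ => by
      rw [Submodule.map_top, Submodule.map_top, LinearMap.range_comp]
      exact hg 0) (fun _ _ => rfl)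
  have hinv : ∀ e : (Fin n → k) ≃ₗ[k] (Fin n → k),
      LinearMap.toMatrix' e.toLinearMap * LinearMap.toMatrix' e.symm.toLinearMap = 1 := fun e => by
    rw [← LinearMap.toMatrix'_comp, LinearEquiv.comp_coe, LinearEquiv.symm_trans_self]
    simp
  have hinv' : ∀ e : (Fin n → k) ≃ₗ[k] (Fin n → k),
      LinearMap.toMatrix' e.symm.toLinearMap * LinearMap.toMatrix' e.toLinearMap = 1 := fun e => by
    rw [← LinearMap.toMatrix'_comp, LinearEquiv.comp_coe, LinearEquiv.self_trans_symm]
    simp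
  refine ⟨m, hm, ⟨_, _, hinv g, hinv' g⟩, ⟨_, _, hinv' f, hinv f⟩, ?_⟩
  apply Matrix.toLin'.injective
  rw [Matrix.toLin'_mul, Matrix.toLin'_mul, Matrix.toLin'_toMatrix', Matrix.toLin'_toMatrix']
  refine LinearMap.ext fun w => ?_
  have := hf (f.symm w)
  rw [LinearEquiv.apply_symm_apply] at this
  exact this.symm

end MatrixNormalForm

namespace WedderburnData

variable {k : Type u} [Field k] {A : Type v} [Ring A] [Algebra k A] (D : WedderburnData k A)

/-- The projection of `A` to the product of matrix algebras. -/
noncomputable def proj : A →ₐ[k] (∀ i, Matrix (Fin (D.n i)) (Fin (D.n i)) k) :=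
  D.φ.toAlgHom.comp (Ideal.Quotient.mkₐ k (Ring.jacobson A))

lemma proj_surjective : Function.Surjective D.proj :=
  D.φ.surjective.comp (Ideal.Quotient.mkₐ_surjective k _)

lemma proj_eq_zero_iff {a : A} : D.proj a = 0 ↔ a ∈ Ring.jacobson A := by
  change D.φ (Ideal.Quotient.mk _ a) = 0 ↔ _
  rw [EmbeddingLike.map_eq_zero_iff, Ideal.Quotient.eq_zero_iff_mem]

lemma proj_e (i : Fin D.l) : D.proj (D.e i) = Pi.single i 1 := D.e_lift i

lemma sub_mem_of_proj_eq {a b : A} (h : D.proj a = D.proj b) : a - b ∈ Ring.jacobson A := by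
  rw [← D.proj_eq_zero_iff, map_sub, h, sub_self]

lemma mul_mem_left {x : A} (hx : x ∈ Ring.jacobson A) (a : A) : a * x ∈ Ring.jacobson A :=
  Ideal.mul_mem_left _ a hx

lemma mul_mem_right {x : A} (hx : x ∈ Ring.jacobson A) (a : A) : x * a ∈ Ring.jacobson A :=
  Ideal.mul_mem_right a _ hx

variable {D} in
lemma mul_eq_mul_of_proj_eq (h : RadSquareZero A) {a b x : A} (hab : D.proj a = D.proj b)
    (hx : x ∈ Ring.jacobson A) : a * x = b * x := by
  rw [← sub_eq_zero, ← sub_mul]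
  exact h _ (D.sub_mem_of_proj_eq hab) _ hx

variable {D} in
lemma mul_eq_mul_of_proj_eq' (h : RadSquareZero A) {a b x : A} (hab : D.proj a = D.proj b)
    (hx : x ∈ Ring.jacobson A) : x * a = x * b := by
  rw [← sub_eq_zero, ← mul_sub]
  exact h _ hx _ (D.sub_mem_of_proj_eq hab)

/-- Units lift along the projection, because its kernel has square zero. -/
lemma exists_unit_proj_eq (h : RadSquareZero A) (P : ∀ i, (Matrix (Fin (D.n i)) (Fin (D.n i)) k)ˣ) :
    ∃ p : Aˣ, (∀ i, D.proj p i = P i) ∧ ∀ i, D.proj (p⁻¹ : Aˣ) i = (P i)⁻¹ := by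
  obtain ⟨a, ha⟩ := D.proj_surjective fun i => P i
  obtain ⟨b, hb⟩ := D.proj_surjective fun i => (P i)⁻¹
  have h1 : a * b - 1 ∈ Ring.jacobson A := by
    rw [← D.proj_eq_zero_iff, map_sub, map_mul, ha, hb, map_one, sub_eq_zero]
    funext i
    simp
  have h2 : b * a - 1 ∈ Ring.jacobson A := by
    rw [← D.proj_eq_zero_iff, map_sub, map_mul, ha, hb, map_one, sub_eq_zero]
    funext i
    simp
  have hu : IsUnit a := by
    refine isUnit_iff_exists_and_exists.2 ⟨⟨b * (1 - (a * b - 1)), ?_⟩, ⟨(1 - (b * a - 1)) * b, ?_⟩⟩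
    · have := h _ h1 _ h1
      calc a * (b * (1 - (a * b - 1))) = 1 - (a * b - 1) * (a * b - 1) := by noncomm_ring
        _ = 1 := by rw [this, sub_zero]
    · have := h _ h2 _ h2
      calc (1 - (b * a - 1)) * b * a = 1 - (b * a - 1) * (b * a - 1) := by noncomm_ring
        _ = 1 := by rw [this, sub_zero]
  obtain ⟨p, rfl⟩ := hu
  refine ⟨p, fun i => congrFun ha i, fun i => ?_⟩
  have : D.proj (p⁻¹ : Aˣ) * D.proj p = 1 := by rw [← map_mul]; simp
  have hi := congrFun this i
  rw [Pi.mul_apply, congrFun ha i, Pi.one_apply] at hi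
  exact (Units.inv_eq_of_mul_eq_one_left hi).symm

lemma mem_peirce {i j : Fin D.l} {y : A} :
    y ∈ D.peirce i j ↔ ∃ x ∈ Ring.jacobson A, D.e i * x * D.e j = y := by
  simp only [peirce, Submodule.mem_map, Submodule.restrictScalars_mem, LinearMap.comp_apply,
    LinearMap.mulLeft_apply, LinearMap.mulRight_apply, mul_assoc]

lemma mem_jacobson_of_mem_peirce {i j : Fin D.l} {y : A} (hy : y ∈ D.peirce i j) :
    y ∈ Ring.jacobson A := by
  obtain ⟨x, hx, rfl⟩ := D.mem_peirce.1 hy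
  exact mul_mem_right (mul_mem_left hx _) _

lemma mul_mul_mem_peirce (i j : Fin D.l) {x : A} (hx : x ∈ Ring.jacobson A) :
    D.e i * x * D.e j ∈ D.peirce i j := D.mem_peirce.2 ⟨x, hx, rfl⟩

lemma e_mul_of_mem_peirce {i j : Fin D.l} {y : A} (hy : y ∈ D.peirce i j) : D.e i * y = y := by
  obtain ⟨x, hx, rfl⟩ := D.mem_peirce.1 hy
  rw [← mul_assoc, ← mul_assoc, (D.e_idem i).eq]

lemma mul_e_of_mem_peirce {i j : Fin D.l} {y : A} (hy : y ∈ D.peirce i j) : y * D.e j = y := by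
  obtain ⟨x, hx, rfl⟩ := D.mem_peirce.1 hy
  rw [mul_assoc, (D.e_idem j).eq]

lemma proj_e_mul_comm (i : Fin D.l) (a : A) : D.proj (D.e i * a) = D.proj (a * D.e i) := by
  rw [map_mul, map_mul, proj_e]
  funext j
  by_cases hj : j = i
  · subst hj
    simp
  · simp [Pi.single_eq_of_ne hj]

variable {D}

/-- Since `rad² = 0`, the subspace `eᵢ rad(A) eⱼ` is a two-sided ideal. -/
lemma mul_mul_mem_peirce_of_mem (h : RadSquareZero A) {i j : Fin D.l} {y : A}
    (hy : y ∈ D.peirce i j) (a b : A) : a * y * b ∈ D.peirce i j := by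
  have hy' := D.mem_jacobson_of_mem_peirce hy
  have h1 : D.e i * (a * y) = a * y := by
    rw [← mul_assoc, mul_eq_mul_of_proj_eq h (D.proj_e_mul_comm i a) hy', mul_assoc,
      D.e_mul_of_mem_peirce hy]
  have h2 : (y * b) * D.e j = y * b := by
    rw [mul_assoc, ← mul_eq_mul_of_proj_eq' h (D.proj_e_mul_comm j b) hy', ← mul_assoc,
      D.mul_e_of_mem_peirce hy]
  refine D.mem_peirce.2 ⟨a * y * b, mul_mem_right (mul_mem_left hy' _) _, ?_⟩
  rw [← mul_assoc, h1, mul_assoc a y b, mul_assoc a (y * b), h2]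

lemma e_mul_mul_mul_e (h : RadSquareZero A) {x : A} (hx : x ∈ Ring.jacobson A) (i j : Fin D.l)
    (a b : A) : D.e i * (a * x * b) * D.e j = D.e i * a * (D.e i * x * D.e j) * b * D.e j := by
  have h1 : D.e i * a * x = D.e i * a * D.e i * x := by
    refine mul_eq_mul_of_proj_eq (D := D) h ?_ hx
    rw [mul_assoc, map_mul, map_mul D.proj (D.e i), ← D.proj_e_mul_comm, map_mul, ← mul_assoc,
      ← map_mul D.proj (D.e i) (D.e i), (D.e_idem i).eq]
  have h2 : x * (b * D.e j) = x * (D.e j * b * D.e j) := by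
    refine mul_eq_mul_of_proj_eq' (D := D) h ?_ hx
    rw [map_mul D.proj (D.e j * b), D.proj_e_mul_comm, ← map_mul, mul_assoc, (D.e_idem j).eq]
  calc D.e i * (a * x * b) * D.e j = (D.e i * a * x) * b * D.e j := by simp only [mul_assoc]
    _ = D.e i * a * D.e i * (x * (b * D.e j)) := by rw [h1]; simp only [mul_assoc]
    _ = _ := by rw [h2]; simp only [mul_assoc]

lemma sum_e_mul_mul_e (h : RadSquareZero A) {x : A} (hx : x ∈ Ring.jacobson A) :
    ∑ i, ∑ j, D.e i * x * D.e j = x := by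
  have hsum : D.proj (∑ i, D.e i) = D.proj 1 := by
    rw [map_sum, map_one]
    simp only [proj_e]
    exact Finset.univ_sum_single 1
  simp only [← Finset.mul_sum, ← Finset.sum_mul]
  rw [mul_eq_mul_of_proj_eq' h hsum (mul_mem_left hx _), mul_one, mul_eq_mul_of_proj_eq h hsum hx,
    one_mul]

/-- Matrix coordinates on the radical, compatible with the action of `A` on both sides. -/
lemma exists_coordinates (h : RadSquareZero A) (D : WedderburnData k A)
    (hr : ∀ i j, D.IsBimoduleRank i j (D.rank i j)) :
    ∃ C : ∀ i j, Fin (D.rank i j) → A → Matrix (Fin (D.n i)) (Fin (D.n j)) k,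
      (∀ i j t, ∀ x ∈ Ring.jacobson A, ∀ a b,
        C i j t (a * x * b) = D.proj a i * C i j t x * D.proj b j) ∧
      ∀ x ∈ Ring.jacobson A, ∀ y ∈ Ring.jacobson A, (∀ i j t, C i j t x = C i j t y) → x = y := by
  classical
  choose f hf using hr
  let C : ∀ i j, Fin (D.rank i j) → A → Matrix (Fin (D.n i)) (Fin (D.n j)) k := fun i j t x =>
    if hx : D.e i * x * D.e j ∈ D.peirce i j then f i j ⟨_, hx⟩ t else 0
  have hC : ∀ i j t, ∀ x (hx : x ∈ Ring.jacobson A),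
      C i j t x = f i j ⟨_, D.mul_mul_mem_peirce i j hx⟩ t := fun i j t x hx =>
    dif_pos (D.mul_mul_mem_peirce i j hx)
  refine ⟨C, fun i j t x hx a b => ?_, fun x hx y hy hxy => ?_⟩
  · rw [hC i j t x hx, hC i j t _ (mul_mem_right (mul_mem_left hx a) b)]
    exact hf i j a b _ _ (e_mul_mul_mul_e h hx i j a b) t
  · rw [← sum_e_mul_mul_e h hx (D := D), ← sum_e_mul_mul_e h hy (D := D)]
    refine Finset.sum_congr rfl fun i _ => Finset.sum_congr rfl fun j _ => ?_
    have : f i j ⟨_, D.mul_mul_mem_peirce i j hx⟩ = f i j ⟨_, D.mul_mul_mem_peirce i j hy⟩ := by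
      funext t
      rw [← hC i j t x hx, ← hC i j t y hy]
      exact hxy i j t
    exact congrArg Subtype.val ((f i j).injective this)

lemma finite_vertex (D : WedderburnData k A) : Finite D.Vertex :=
  Finite.of_surjective (Sum.elim Vertex.zero Vertex.one : Fin D.l ⊕ Fin D.l → D.Vertex) fun x => by
    cases x
    exacts [⟨Sum.inl _, rfl⟩, ⟨Sum.inr _, rfl⟩]

lemma arrowBipartite (D : WedderburnData k A) [Finite D.Vertex] :
    ArrowBipartite (arrowSet D.Vertex) := by
  intro x y z hxy hyz
  obtain ⟨⟨i, j, t⟩⟩ := mem_arrowSet.1 hxy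
  obtain ⟨⟨⟩⟩ := mem_arrowSet.1 hyz

instance (D : WedderburnData k A) (x y : D.Vertex) : Finite (x ⟶ y) := by
  change Finite (D.Arrow x y)
  cases x with
  | zero i => exact Finite.of_injective (fun _ => ()) (by rintro ⟨⟩)
  | one j =>
    cases y with
    | zero i =>
      exact Finite.of_surjective (fun t : Fin (D.rank i j) => Arrow.mk i j t) (by
        rintro ⟨⟩
        exact ⟨_, rfl⟩)
    | one i => exact Finite.of_injective (fun _ => ()) (by rintro ⟨⟩)

/-- The dimension vector with the value `m i` at both `(0, i)` and `(1, i)`. -/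
def dimOf (D : WedderburnData k A) (m : Fin D.l → ℕ) : D.Vertex → ℕ
  | .zero i => m i
  | .one i => m i

/-- An element over an idempotent `f` can be cleared outside the corner of `1 - f` by multiplying
with elements of `1 + rad(A)`. -/
lemma orbit_eq_corner (h : RadSquareZero A) {f a : A} (hf : IsIdempotentElem f)
    (ha : D.proj a = D.proj f) :
    (unitOrbitSetoid A).r a (f + (1 - f) * a * (1 - f)) := by
  have hr := D.sub_mem_of_proj_eq ha
  have one_sub_unit : ∀ x ∈ Ring.jacobson A, ∃ u : Aˣ, (u : A) = 1 - x := fun x hx =>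
    ⟨⟨1 - x, 1 + x, by
      have := h x hx x hx
      calc (1 - x) * (1 + x) = 1 - x * x := by noncomm_ring
        _ = 1 := by rw [this, sub_zero], by
      have := h x hx x hx
      calc (1 + x) * (1 - x) = 1 - x * x := by noncomm_ring
        _ = 1 := by rw [this, sub_zero]⟩, rfl⟩
  have hs : (a - f) * (1 - f) ∈ Ring.jacobson A := mul_mem_right hr _
  obtain ⟨u, hu⟩ := one_sub_unit _ hr
  obtain ⟨w, hw⟩ := one_sub_unit _ hs
  refine ⟨u, w⁻¹, ?_⟩
  rw [inv_inv, hu, hw]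
  have e1 : (a - f) * (a - f) = 0 := h _ hr _ hr
  have e2 : (a - f) * f * (a - f) = 0 := h _ (mul_mem_right hr _) _ hr
  have hf' : f * f = f := hf
  obtain ⟨r, rfl⟩ : ∃ r, a = f + r := ⟨a - f, by abel⟩
  rw [add_sub_cancel_left] at e1 e2 ⊢
  have l : (1 - f) * (f + r) * (1 - f) = r - f * r - r * f + f * r * f := by
    calc (1 - f) * (f + r) * (1 - f)
        = (f - f * f) * (1 - f) + (r - f * r - r * f + f * r * f) := by noncomm_ring
      _ = _ := by rw [hf', sub_self, zero_mul, zero_add]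
  rw [l]
  calc f + (r - f * r - r * f + f * r * f)
      = f + r - r * f - f * r + f * r * f := by abel
    _ = (1 - r) * (f + r) * (1 - r * (1 - f)) - (-(r * r) + (r * f * r) * (1 - f) +
          (r * r) * r * (1 - f) - (r * r) * (1 - f)) := by noncomm_ring
    _ = _ := by rw [e1, e2]; simp

/-- If units `p`, `q` fix the idempotent `f` modulo the radical, in the sense that `p f q⁻¹` and `f`
agree there and that `p` and `q` commute with `f` there, and if they match the corners of `a` and
`b` at `1 - f`, then `a` and `b` are in the same orbit. -/
lemma orbit_of_corner (h : RadSquareZero A) {f a b : A} (hf : IsIdempotentElem f)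
    (ha : D.proj a = D.proj f)
    (hb : D.proj b = D.proj f) (p q : Aˣ) (hpf : D.proj (p * f) = D.proj f)
    (hfp : D.proj (f * p) = D.proj f) (hqf : D.proj ((q⁻¹ : Aˣ) * f) = D.proj f)
    (hfq : D.proj (f * (q⁻¹ : Aˣ)) = D.proj f)
    (hc : p * ((1 - f) * a * (1 - f)) * (q⁻¹ : Aˣ) = (1 - f) * b * (1 - f)) :
    (unitOrbitSetoid A).r a b := by
  have hr := D.sub_mem_of_proj_eq ha
  have hpa : D.proj (p * a * (q⁻¹ : Aˣ)) = D.proj f := by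
    rw [map_mul, map_mul, ha, ← map_mul, hpf, ← map_mul, hfq]
  have hf' : f * f = f := hf
  have key : (1 - f) * (p * a * (q⁻¹ : Aˣ)) * (1 - f) = (1 - f) * b * (1 - f) := by
    rw [← hc]
    obtain ⟨r, rfl⟩ : ∃ r, a = f + r := ⟨a - f, by abel⟩
    rw [add_sub_cancel_left] at hr
    have e1 : (1 - f) * (f + r) * (1 - f) = (1 - f) * r * (1 - f) := by
      calc (1 - f) * (f + r) * (1 - f) = (f - f * f) * (1 - f) + (1 - f) * r * (1 - f) := by
            noncomm_ring
        _ = _ := by rw [hf', sub_self, zero_mul, zero_add]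
    -- Both off-diagonal corners of `p` and `q⁻¹` lie in the radical.
    have e2 : ((1 - f) * p * f) * (f * (q⁻¹ : Aˣ) * (1 - f)) = 0 := by
      refine h _ ?_ _ ?_
      · rw [← D.proj_eq_zero_iff, mul_assoc, map_mul, hpf, ← map_mul, sub_mul, one_mul, hf',
          sub_self, map_zero]
      · rw [← D.proj_eq_zero_iff, map_mul, hfq, ← map_mul, mul_sub, mul_one, hf', sub_self,
          map_zero]
    have e3 : (1 - f) * p * r = p * (1 - f) * r := by
      refine mul_eq_mul_of_proj_eq (D := D) h ?_ hr
      rw [sub_mul, mul_sub, map_sub, map_sub, hpf, hfp, one_mul, mul_one]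
    have e4 : r * ((q⁻¹ : Aˣ) * (1 - f)) = r * ((1 - f) * (q⁻¹ : Aˣ)) := by
      refine mul_eq_mul_of_proj_eq' (D := D) h ?_ hr
      rw [sub_mul, mul_sub, map_sub, map_sub, hqf, hfq, one_mul, mul_one]
    rw [e1]
    calc (1 - f) * (p * (f + r) * (q⁻¹ : Aˣ)) * (1 - f)
        = (1 - f) * p * f * ((q⁻¹ : Aˣ) * (1 - f)) + (1 - f) * p * r * ((q⁻¹ : Aˣ) * (1 - f)) := by
          noncomm_ring
      _ = (1 - f) * p * (f * f) * ((q⁻¹ : Aˣ) * (1 - f)) +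
            p * (1 - f) * (r * ((q⁻¹ : Aˣ) * (1 - f))) := by rw [hf', e3]; simp only [mul_assoc]
      _ = ((1 - f) * p * f) * (f * (q⁻¹ : Aˣ) * (1 - f)) +
            p * (1 - f) * (r * ((1 - f) * (q⁻¹ : Aˣ))) := by rw [e4]; simp only [mul_assoc]
      _ = _ := by rw [e2, zero_add]; simp only [mul_assoc]
  have s1 : (unitOrbitSetoid A).r a (p * a * (q⁻¹ : Aˣ)) := ⟨p, q, rfl⟩
  have s2 := orbit_eq_corner h hf hpa
  rw [key] at s2
  exact (unitOrbitSetoid A).trans' ((unitOrbitSetoid A).trans' s1 s2)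
    ((unitOrbitSetoid A).symm' (orbit_eq_corner h hf hb))

end WedderburnData

namespace WedderburnData

variable {k : Type u} [Field k] {A : Type v} [Ring A] [Algebra k A] {D : WedderburnData k A}

/-- Idempotents lift along the projection, because its kernel has square zero. -/
lemma exists_idempotent_proj_eq (h : RadSquareZero A) (D : WedderburnData k A)
    {s : ∀ i, Matrix (Fin (D.n i)) (Fin (D.n i)) k} (hs : IsIdempotentElem s) :
    ∃ f : A, IsIdempotentElem f ∧ D.proj f = s := by
  refine exists_isIdempotentElem_eq_of_ker_isNilpotent D.proj.toRingHom ?_ s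
    (D.proj_surjective s) hs
  intro x hx
  have hx' : x ∈ Ring.jacobson A := D.proj_eq_zero_iff.1 hx
  exact ⟨2, by rw [pow_two]; exact h x hx' x hx'⟩

/-- The invertible matrix `diag(G, 1)` of size `n`. -/
noncomputable def blockUnit {m n : ℕ} (h : m ≤ n) (g : (Fin m → k) ≃ₗ[k] (Fin m → k)) :
    (Matrix (Fin n) (Fin n) k)ˣ := by
  have key : ∀ g : (Fin m → k) ≃ₗ[k] (Fin m → k),
      (blockIncl k h * LinearMap.toMatrix' g.toLinearMap * blockProj k h +
        (1 - blockIncl k h * blockProj k h)) *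
      (blockIncl k h * LinearMap.toMatrix' g.symm.toLinearMap * blockProj k h +
        (1 - blockIncl k h * blockProj k h)) = 1 := fun g => by
    have hg : LinearMap.toMatrix' g.toLinearMap * LinearMap.toMatrix' g.symm.toLinearMap = 1 := by
      rw [← LinearMap.toMatrix'_comp, LinearEquiv.comp_coe, LinearEquiv.symm_trans_self]
      simp
    simp only [Matrix.add_mul, Matrix.mul_add, Matrix.sub_mul, Matrix.mul_sub, Matrix.mul_assoc,
      blockProj_mul_blockIncl_mul, Matrix.one_mul, Matrix.mul_one]
    rw [← Matrix.mul_assoc (LinearMap.toMatrix' g.toLinearMap), hg, Matrix.one_mul]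
    abel
  exact ⟨_, _, key g, by simpa using key g.symm⟩

lemma coe_blockUnit {m n : ℕ} (h : m ≤ n) (g : (Fin m → k) ≃ₗ[k] (Fin m → k)) :
    (blockUnit h g : Matrix (Fin n) (Fin n) k) =
      blockIncl k h * LinearMap.toMatrix' g.toLinearMap * blockProj k h +
        (1 - blockIncl k h * blockProj k h) := rfl

lemma coe_blockUnit_inv {m n : ℕ} (h : m ≤ n) (g : (Fin m → k) ≃ₗ[k] (Fin m → k)) :
    (((blockUnit h g)⁻¹ : (Matrix (Fin n) (Fin n) k)ˣ) : Matrix (Fin n) (Fin n) k) =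
      blockIncl k h * LinearMap.toMatrix' g.symm.toLinearMap * blockProj k h +
        (1 - blockIncl k h * blockProj k h) := rfl

/-- The orbits of elements over a fixed idempotent `f` of nullities `m i`: they are governed by
representations of the quiver of `A` of dimension vector `m`, because the corner of `1 - f` in the
radical consists of such representations, and all base changes at the vertices lift to units
commuting with `f` modulo the radical. -/
lemma finClasses_fiber [Finite D.Vertex] (h : RadSquareZero A)
    (hr : ∀ i j, D.IsBimoduleRank i j (D.rank i j)) (hr1 : ∀ i j, D.rank i j ≤ 1)
    (m : Fin D.l → ℕ) (hm : ∀ i, m i ≤ D.n i) (hfin : RepFinite k (arrowSet D.Vertex) (D.dimOf m)) :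
    FinClasses fun a b : {a : A // ∃ u w : Aˣ, ∀ i, D.proj (u * a * w) i =
      1 - blockIncl k (hm i) * blockProj k (hm i)} => (unitOrbitSetoid A).r a b := by
  classical
  obtain ⟨N, φ, hφ⟩ := hfin
  obtain ⟨C, hC, hCinj⟩ := exists_coordinates h D hr
  let s : ∀ i, Matrix (Fin (D.n i)) (Fin (D.n i)) k := fun i =>
    1 - blockIncl k (hm i) * blockProj k (hm i)
  have hss : IsIdempotentElem s := by
    funext i
    simp only [s, Pi.mul_apply, Matrix.sub_mul, Matrix.mul_sub, Matrix.mul_assoc,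
      blockProj_mul_blockIncl_mul, Matrix.one_mul, Matrix.mul_one]
    abel
  obtain ⟨f, hf, hfs⟩ := exists_idempotent_proj_eq h D hss
  have hf' : f * f = f := hf
  let c : A → A := fun a => (1 - f) * a * (1 - f)
  -- The representation attached to the corner of `1 - f`.
  let R : A → RepFamily k (D.dimOf m) := fun a x y =>
    match x, y with
    | .one j, .zero i => if ht : 0 < D.rank i j then
        Matrix.toLin' (blockProj k (hm i) * C i j ⟨0, ht⟩ (c a) * blockIncl k (hm j)) else 0
    | .zero _, _ => 0
    | .one _, .one _ => 0
  have hsub : ∀ a : {a : A // ∃ u w : Aˣ, ∀ i, D.proj (u * a * w) i = s i},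
      ∃ b, D.proj b = D.proj f ∧ (unitOrbitSetoid A).r a b := by
    rintro ⟨a, u, w, hu⟩
    exact ⟨u * a * w, by rw [hfs]; exact funext hu, u, w⁻¹, by rw [inv_inv]⟩
  choose β hβf hβ using hsub
  refine FinClasses.of_finite (fun a => φ (R (β a))) fun a b hab => ?_
  refine (unitOrbitSetoid A).trans' (hβ a) ((unitOrbitSetoid A).trans' ?_
    ((unitOrbitSetoid A).symm' (hβ b)))
  obtain ⟨g, hg⟩ := hφ _ _ hab
  let g₀ : ∀ i, (Fin (m i) → k) ≃ₗ[k] (Fin (m i) → k) := fun i => g (.zero i)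
  let g₁ : ∀ i, (Fin (m i) → k) ≃ₗ[k] (Fin (m i) → k) := fun i => g (.one i)
  generalize hα : β a = a' at hg
  generalize hα' : β b = b' at hg
  have ha : D.proj a' = D.proj f := hα ▸ hβf a
  have hb : D.proj b' = D.proj f := hα' ▸ hβf b
  obtain ⟨p, hp, -⟩ := D.exists_unit_proj_eq h fun i => blockUnit (hm i) (g₀ i)
  obtain ⟨q, -, hq⟩ := D.exists_unit_proj_eq h fun i => blockUnit (hm i) (g₁ i)
  have hcJ : ∀ a, D.proj a = D.proj f → c a ∈ Ring.jacobson A := fun a ha => by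
    rw [← D.proj_eq_zero_iff, map_mul, map_mul, ha, ← map_mul, sub_mul, one_mul, hf', sub_self,
      map_zero, zero_mul]
  have hcc : ∀ a, (1 - f) * c a * (1 - f) = c a := fun a => by
    have : (1 - f) * (1 - f) = 1 - f := hf.one_sub
    change (1 - f) * ((1 - f) * a * (1 - f)) * (1 - f) = (1 - f) * a * (1 - f)
    rw [mul_assoc (1 - f) a, ← mul_assoc (1 - f) (1 - f), this, mul_assoc, mul_assoc, this]
  have hfi : ∀ i, D.proj (1 - f) i = blockIncl k (hm i) * blockProj k (hm i) := fun i => by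
    rw [map_sub, hfs, map_one]
    simp [s]
  have hpc : p * c a' * (q⁻¹ : Aˣ) = c b' := by
    refine hCinj _ (mul_mem_right (mul_mem_left (hcJ a' ha) _) _) _ (hcJ b' hb) fun i j t => ?_
    have ht : 0 < D.rank i j := t.pos
    obtain rfl : t = ⟨0, ht⟩ := Fin.ext (by have := t.2; have := hr1 i j; simp only; omega)
    rw [hC _ _ _ _ (hcJ a' ha), hp, hq, ← hcc a', ← hcc b', hC _ _ _ _ (hcJ a' ha),
      hC _ _ _ _ (hcJ b' hb), hfi, hfi, coe_blockUnit, coe_blockUnit_inv]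
    have hgm : (blockProj k (hm i) * C i j ⟨0, ht⟩ (c b') * blockIncl k (hm j)) *
        LinearMap.toMatrix' (g₁ j).toLinearMap =
        LinearMap.toMatrix' (g₀ i).toLinearMap *
          (blockProj k (hm i) * C i j ⟨0, ht⟩ (c a') * blockIncl k (hm j)) := by
      apply Matrix.toLin'.injective
      rw [Matrix.toLin'_mul _ (LinearMap.toMatrix' (g₁ j).toLinearMap),
        Matrix.toLin'_mul (LinearMap.toMatrix' (g₀ i).toLinearMap), Matrix.toLin'_toMatrix',
        Matrix.toLin'_toMatrix']
      refine LinearMap.ext fun w => ?_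
      have := hg (.one j) (.zero i) (mem_arrowSet.2 ⟨Arrow.mk i j ⟨0, ht⟩⟩) w
      simp only [R, ht, dite_true] at this
      exact this
    have hgi : LinearMap.toMatrix' (g₁ j).toLinearMap *
        LinearMap.toMatrix' (g₁ j).symm.toLinearMap = 1 := by
      rw [← LinearMap.toMatrix'_comp, LinearEquiv.comp_coe, LinearEquiv.symm_trans_self]
      simp
    have hgm' : blockProj k (hm i) * C i j ⟨0, ht⟩ (c b') * blockIncl k (hm j) =
        LinearMap.toMatrix' (g₀ i).toLinearMap *
          (blockProj k (hm i) * C i j ⟨0, ht⟩ (c a') * blockIncl k (hm j)) *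
        LinearMap.toMatrix' (g₁ j).symm.toLinearMap := by
      rw [← hgm, Matrix.mul_assoc _ _ (LinearMap.toMatrix' (g₁ j).symm.toLinearMap), hgi,
        Matrix.mul_one]
    have hb'' : blockIncl k (hm i) * blockProj k (hm i) * C i j ⟨0, ht⟩ (c b') *
        (blockIncl k (hm j) * blockProj k (hm j)) =
        blockIncl k (hm i) * (blockProj k (hm i) * C i j ⟨0, ht⟩ (c b') * blockIncl k (hm j)) *
          blockProj k (hm j) := by simp only [Matrix.mul_assoc]
    rw [hb'', hgm']
    simp only [Matrix.add_mul, Matrix.mul_add, Matrix.sub_mul, Matrix.mul_sub, Matrix.mul_assoc,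
      blockProj_mul_blockIncl_mul, Matrix.one_mul, Matrix.mul_one]
    abel
  refine orbit_of_corner h hf ha hb p q ?_ ?_ ?_ ?_ hpc
  all_goals
    rw [map_mul, hfs]
    funext i
    simp only [Pi.mul_apply, hp, hq, coe_blockUnit, coe_blockUnit_inv, s, Matrix.add_mul,
      Matrix.mul_add, Matrix.sub_mul, Matrix.mul_sub, Matrix.mul_assoc,
      blockProj_mul_blockIncl_mul, Matrix.one_mul, Matrix.mul_one]
    abel

/-- If the quiver of `A` has no parallel arrows, and is representation finite for all dimension
vectors `m ≤ n`, then `A` has finitely many orbits: modulo the radical an element becomes an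
idempotent of some nullities `m`. -/
theorem finitelyManyUnitOrbits [Finite D.Vertex] (h : RadSquareZero A)
    (hr : ∀ i j, D.IsBimoduleRank i j (D.rank i j)) (hr1 : ∀ i j, D.rank i j ≤ 1)
    (hfin : ∀ m : Fin D.l → ℕ, (∀ i, m i ≤ D.n i) →
      RepFinite k (arrowSet D.Vertex) (D.dimOf m)) : FinitelyManyUnitOrbits A := by
  have hex : ∀ a : A, ∃ m : ∀ i, Fin (D.n i + 1), ∃ u w : Aˣ, ∀ i, D.proj (u * a * w) i =
      1 - blockIncl k (Nat.lt_succ_iff.1 (m i).2) * blockProj k (Nat.lt_succ_iff.1 (m i).2) := by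
    intro a
    choose m hm P Q hPQ using fun i => exists_mul_mul_eq_one_sub (D.proj a i)
    obtain ⟨p, hp, -⟩ := D.exists_unit_proj_eq h P
    obtain ⟨q, hq, -⟩ := D.exists_unit_proj_eq h Q
    refine ⟨fun i => ⟨m i, Nat.lt_succ_of_le (hm i)⟩, p, q, fun i => ?_⟩
    rw [map_mul, map_mul, Pi.mul_apply, Pi.mul_apply, hp, hq]
    exact hPQ i
  choose μ hμ using hex
  refine FinClasses.finite_quotient _ (FinClasses.of_fibers μ fun m => ?_)
  have hm : ∀ i, (m i : ℕ) ≤ D.n i := fun i => Nat.lt_succ_iff.1 (m i).2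
  obtain ⟨N, φ, hφ⟩ := finClasses_fiber h hr hr1 (fun i => m i) hm (hfin _ hm)
  have hmem : ∀ a : {a // μ a = m}, ∃ u w : Aˣ, ∀ i, D.proj (u * a * w) i =
      1 - blockIncl k (hm i) * blockProj k (hm i) := by
    rintro ⟨a, rfl⟩
    exact hμ a
  exact ⟨N, fun a => φ ⟨a.1, hmem a⟩, fun a b hab => hφ _ _ hab⟩

end WedderburnData

/-! ### The rank of the bimodules -/

namespace WedderburnData

variable {k : Type u} [Field k] {A : Type v} [Ring A] [Algebra k A] {D : WedderburnData k A}

/-- The bimodule `eᵢ rad(A) eⱼ` is a power of the bimodule of matrices. With matrix units `E`, the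
coordinates of `x` at the position `(a, b)` are those of `E₀ₐ x E_b₀` with respect to a basis of
`E₀₀ rad(A) E₀₀`. -/
theorem exists_isBimoduleRank [FiniteDimensional k A] (h : RadSquareZero A)
    (D : WedderburnData k A) (i j : Fin D.l) : ∃ r, D.IsBimoduleRank i j r := by
  classical
  obtain ⟨σ, hσ⟩ := LinearMap.exists_rightInverse_of_surjective D.proj.toLinearMap
    (LinearMap.range_eq_top.2 D.proj_surjective)
  have hσ' : ∀ s, D.proj (σ s) = s := fun s => LinearMap.congr_fun hσ s
  let L : Matrix (Fin (D.n i)) (Fin (D.n i)) k →ₗ[k] A :=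
    σ ∘ₗ LinearMap.single k (fun i => Matrix (Fin (D.n i)) (Fin (D.n i)) k) i
  let R : Matrix (Fin (D.n j)) (Fin (D.n j)) k →ₗ[k] A :=
    σ ∘ₗ LinearMap.single k (fun i => Matrix (Fin (D.n i)) (Fin (D.n i)) k) j
  have hL : ∀ s, D.proj (L s) = Pi.single i s := fun s => hσ' _
  have hR : ∀ s, D.proj (R s) = Pi.single j s := fun s => hσ' _
  have hact : ∀ x ∈ Ring.jacobson A, ∀ a b,
      D.e i * a * x * b * D.e j = L (D.proj a i) * x * R (D.proj b j) := by
    intro x hx a b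
    have e1 : D.e i * a * x = L (D.proj a i) * x := by
      refine mul_eq_mul_of_proj_eq (D := D) h ?_ hx
      rw [hL, map_mul, proj_e]
      funext l
      by_cases hl : l = i
      · subst hl
        simp
      · simp [Pi.single_eq_of_ne hl]
    have e2 : x * (b * D.e j) = x * R (D.proj b j) := by
      refine mul_eq_mul_of_proj_eq' (D := D) h ?_ hx
      rw [hR, map_mul, proj_e]
      funext l
      by_cases hl : l = j
      · subst hl
        simp
      · simp [Pi.single_eq_of_ne hl]
    rw [e1, mul_assoc, mul_assoc, e2, mul_assoc]
  have hcomp : ∀ x ∈ Ring.jacobson A, ∀ s₁ s₂ t₁ t₂,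
      L s₁ * (L s₂ * x * R t₂) * R t₁ = L (s₁ * s₂) * x * R (t₂ * t₁) := by
    intro x hx s₁ s₂ t₁ t₂
    have e1 : L s₁ * L s₂ * x = L (s₁ * s₂) * x :=
      mul_eq_mul_of_proj_eq (D := D) h (by rw [map_mul, hL, hL, hL, Pi.single_mul]) hx
    have e2 : x * (R t₂ * R t₁) = x * R (t₂ * t₁) :=
      mul_eq_mul_of_proj_eq' (D := D) h (by rw [map_mul, hR, hR, hR, Pi.single_mul]) hx
    calc L s₁ * (L s₂ * x * R t₂) * R t₁ = L s₁ * L s₂ * x * (R t₂ * R t₁) := by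
          simp only [mul_assoc]
      _ = _ := by rw [e1, mul_assoc, e2, mul_assoc]
  have hone : ∀ x ∈ D.peirce i j, L 1 * x * R 1 = x := by
    intro x hx
    have := hact x (D.mem_jacobson_of_mem_peirce hx) 1 1
    simp only [mul_one] at this
    rw [D.e_mul_of_mem_peirce hx, D.mul_e_of_mem_peirce hx, map_one, Pi.one_apply,
      Pi.one_apply] at this
    exact this.symm
  have hmem : ∀ x ∈ Ring.jacobson A, ∀ s t, L s * x * R t ∈ D.peirce i j := by
    intro x hx s t
    have e1 := hact x hx (L s) (R t)
    rw [hL, hR, Pi.single_eq_same, Pi.single_eq_same] at e1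
    rw [← e1]
    refine D.mem_peirce.2 ⟨L s * x * R t, mul_mem_right (mul_mem_left hx _) _, ?_⟩
    simp only [mul_assoc]
  -- Matrix units with respect to the first row and the first column.
  let o : Fin (D.n i) := ⟨0, D.n_pos i⟩
  let o' : Fin (D.n j) := ⟨0, D.n_pos j⟩
  let T : Matrix (Fin (D.n i)) (Fin (D.n i)) k → Matrix (Fin (D.n j)) (Fin (D.n j)) k → A →ₗ[k] A :=
    fun s t => LinearMap.mulLeft k (L s) ∘ₗ LinearMap.mulRight k (R t)
  have hT : ∀ s t x, T s t x = L s * x * R t := fun s t x => (mul_assoc _ _ _).symm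
  let Y : Submodule k A :=
    ((Ring.jacobson A).restrictScalars k).map (T (Matrix.single o o 1) (Matrix.single o' o' 1))
  have hYJ : ∀ y ∈ Y, y ∈ Ring.jacobson A := by
    rintro _ ⟨x, hx, rfl⟩
    rw [hT]
    exact mul_mem_right (mul_mem_left hx _) _
  have hY : ∀ y ∈ Y, L (Matrix.single o o 1) * y * R (Matrix.single o' o' 1) = y := by
    rintro _ ⟨x, hx, rfl⟩
    rw [hT, hcomp x hx]
    simp
  have hcoord : ∀ x ∈ D.peirce i j, ∀ a b,
      T (Matrix.single o a 1) (Matrix.single b o' 1) x ∈ Y := by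
    intro x hx a b
    have hx' := D.mem_jacobson_of_mem_peirce hx
    refine ⟨T (Matrix.single o a 1) (Matrix.single b o' 1) x, ?_, ?_⟩
    · rw [hT]
      exact mul_mem_right (mul_mem_left hx' _) _
    · rw [hT, hT, hcomp x hx']
      simp
  let B := finBasis k Y
  let r := finrank k Y
  let f : D.peirce i j →ₗ[k] (Fin r → Matrix (Fin (D.n i)) (Fin (D.n j)) k) :=
    { toFun := fun x t => Matrix.of fun a b => B.repr ⟨_, hcoord x x.2 a b⟩ t
      map_add' := by
        intro x y
        funext t
        ext a b
        have : (⟨_, hcoord _ (x + y).2 a b⟩ : Y) = ⟨_, hcoord x x.2 a b⟩ + ⟨_, hcoord y y.2 a b⟩ :=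
          Subtype.ext (map_add _ _ _)
        simp only [Matrix.of_apply, this, map_add, Finsupp.add_apply, Pi.add_apply,
          Matrix.add_apply]
      map_smul' := by
        intro c x
        funext t
        ext a b
        have : (⟨_, hcoord _ (c • x).2 a b⟩ : Y) = c • ⟨_, hcoord x x.2 a b⟩ :=
          Subtype.ext (map_smul _ _ _)
        simp only [Matrix.of_apply, this, map_smul, Finsupp.smul_apply, Pi.smul_apply,
          Matrix.smul_apply, RingHom.id_apply] }
  have hf : ∀ x t a b, f x t a b = B.repr ⟨_, hcoord x x.2 a b⟩ t := fun x t a b => rfl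
  have hinj : Function.Injective f := by
    rw [injective_iff_map_eq_zero]
    rintro ⟨x, hx⟩ hfx
    have hx' := D.mem_jacobson_of_mem_peirce hx
    have h0 : ∀ a b, L (Matrix.single o a 1) * x * R (Matrix.single b o' 1) = 0 := by
      intro a b
      have : (⟨_, hcoord x hx a b⟩ : Y) = 0 := by
        apply B.repr.injective
        ext t
        rw [← hf ⟨x, hx⟩ t a b, hfx]
        simp
      rw [← hT]
      exact congrArg Subtype.val this
    apply Subtype.ext
    change x = 0
    rw [← hone x hx, ← Matrix.sum_single_one, ← Matrix.sum_single_one, map_sum, map_sum,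
      Finset.sum_mul, Finset.sum_mul]
    refine Finset.sum_eq_zero fun a _ => ?_
    rw [Finset.mul_sum]
    refine Finset.sum_eq_zero fun b _ => ?_
    have := hcomp x hx' (Matrix.single a o 1) (Matrix.single o a 1) (Matrix.single o' b 1)
      (Matrix.single b o' 1)
    rw [h0] at this
    simpa using this.symm
  have hsurj : Function.Surjective f := by
    intro c
    let x : A := ∑ t, ∑ a, ∑ b, c t a b • (L (Matrix.single a o 1) * B t * R (Matrix.single o' b 1))
    have hx : x ∈ D.peirce i j := Submodule.sum_mem _ fun t _ => Submodule.sum_mem _ fun a _ =>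
      Submodule.sum_mem _ fun b _ => Submodule.smul_mem _ _ (hmem _ (hYJ _ (B t).2) _ _)
    refine ⟨⟨x, hx⟩, ?_⟩
    funext t
    ext p q
    have key : (⟨_, hcoord x hx p q⟩ : Y) = ∑ t, c t p q • B t := by
      apply Subtype.ext
      simp only [x, hT, Finset.mul_sum, Finset.sum_mul, mul_smul_comm, smul_mul_assoc,
        hcomp _ (hYJ _ (B _).2), Submodule.coe_sum, Submodule.coe_smul]
      refine Finset.sum_congr rfl fun t _ => ?_
      rw [Finset.sum_eq_single p, Finset.sum_eq_single q]
      · rw [Matrix.single_mul_single_same, Matrix.single_mul_single_same, mul_one,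
          hY _ (B t).2]
      · intro b _ hb
        rw [Matrix.single_mul_single_of_ne _ _ _ _ hb]
        simp
      · simp
      · intro a _ ha
        refine Finset.sum_eq_zero fun b _ => ?_
        rw [Matrix.single_mul_single_of_ne _ _ _ _ ha.symm]
        simp
      · simp
    rw [hf, key]
    simp [Finsupp.single_apply]
  refine ⟨r, LinearEquiv.ofBijective f ⟨hinj, hsurj⟩, fun a b x y hxy t => ?_⟩
  have hx' := D.mem_jacobson_of_mem_peirce x.2
  rw [hact _ hx'] at hxy
  change f y t = D.proj a i * f x t * D.proj b j
  ext p q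
  have key : (⟨_, hcoord y y.2 p q⟩ : Y) =
      ∑ d, ∑ c, (D.proj a i p c * D.proj b j d q) • ⟨_, hcoord x x.2 c d⟩ := by
    apply Subtype.ext
    have e1 : Matrix.single o p 1 * D.proj a i =
        ∑ c, D.proj a i p c • Matrix.single o c (1 : k) := by
      ext u w
      simp [Matrix.sum_apply, Matrix.single_apply, Matrix.mul_apply, ite_and]
    have e2 : D.proj b j * Matrix.single q o' 1 =
        ∑ d, D.proj b j d q • Matrix.single d o' (1 : k) := by
      ext u w
      simp [Matrix.sum_apply, Matrix.single_apply, Matrix.mul_apply, ite_and]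
    simp only [hT, hxy, hcomp _ hx', e1, e2, map_sum, map_smul, Finset.sum_mul, Finset.mul_sum,
      Submodule.coe_sum, Submodule.coe_smul, smul_mul_assoc, mul_smul_comm]
    refine Finset.sum_congr rfl fun d _ => ?_
    rw [Finset.smul_sum]
    refine Finset.sum_congr rfl fun c _ => ?_
    rw [smul_smul, mul_comm]
  rw [hf, key, Matrix.mul_apply]
  simp only [Matrix.mul_apply, map_sum, map_smul, Finsupp.coe_finsetSum, Finset.sum_apply,
    Finsupp.smul_apply, smul_eq_mul, hf, Finset.sum_mul]
  refine Finset.sum_congr rfl fun d _ => Finset.sum_congr rfl fun c _ => ?_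
  ring

lemma isBimoduleRank_rank [FiniteDimensional k A] (h : RadSquareZero A) (D : WedderburnData k A)
    (i j : Fin D.l) : D.IsBimoduleRank i j (D.rank i j) :=
  Nat.sInf_mem (s := {r | D.IsBimoduleRank i j r}) (exists_isBimoduleRank h D i j)

/-- Distributivity bounds the rank by one: subspaces of `k ^ r` give two-sided ideals contained in
`eᵢ rad(A) eⱼ`, and three distinct lines in a plane violate the distributive law. -/
theorem rank_le_one [FiniteDimensional k A] (h : RadSquareZero A) (hd : IdealsDistributive A)
    (D : WedderburnData k A) (i j : Fin D.l) : D.rank i j ≤ 1 := by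
  classical
  by_contra hlt
  obtain ⟨f, hf⟩ := isBimoduleRank_rank h D i j
  generalize D.rank i j = r at f hf hlt
  have hmul : ∀ (C : Submodule k (Fin r → k)) (y : A) (hy : y ∈ D.peirce i j),
      (∀ p q, (fun t => f ⟨y, hy⟩ t p q) ∈ C) → ∀ a b : A, ∃ hy' : a * y * b ∈ D.peirce i j,
        ∀ p q, (fun t => f ⟨a * y * b, hy'⟩ t p q) ∈ C := by
    intro C y hy hC a b
    have hy' := mul_mul_mem_peirce_of_mem h hy a b
    refine ⟨hy', fun p q => ?_⟩
    have e := hf a b ⟨y, hy⟩ ⟨_, hy'⟩ (by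
      change a * y * b = D.e i * a * y * b * D.e j
      conv_lhs => rw [← D.e_mul_of_mem_peirce hy', ← D.mul_e_of_mem_peirce hy']
      simp only [mul_assoc])
    have e' : (fun t => f ⟨a * y * b, hy'⟩ t p q) = ∑ d, ∑ c,
        (D.proj a i p c * D.proj b j d q) • fun t => f ⟨y, hy⟩ t c d := by
      funext t
      rw [e t]
      change (D.proj a i * f ⟨y, hy⟩ t * D.proj b j) p q = _
      simp only [Matrix.mul_apply, Finset.sum_apply, Pi.smul_apply, smul_eq_mul, Finset.sum_mul]
      refine Finset.sum_congr rfl fun d _ => Finset.sum_congr rfl fun c _ => ?_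
      ring
    rw [e']
    exact Submodule.sum_mem _ fun d _ => Submodule.sum_mem _ fun c _ => C.smul_mem _ (hC c d)
  let I : Submodule k (Fin r → k) → TwoSidedIdeal A := fun C =>
    TwoSidedIdeal.mk' {y | ∃ hy : y ∈ D.peirce i j, ∀ p q, (fun t => f ⟨y, hy⟩ t p q) ∈ C}
      ⟨Submodule.zero_mem _, fun p q => by
        have : f ⟨0, Submodule.zero_mem _⟩ = 0 := map_zero f
        rw [this]
        exact C.zero_mem⟩
      (by
        rintro x y ⟨hx, hx'⟩ ⟨hy, hy'⟩
        refine ⟨Submodule.add_mem _ hx hy, fun p q => ?_⟩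
        have : f ⟨x + y, Submodule.add_mem _ hx hy⟩ = f ⟨x, hx⟩ + f ⟨y, hy⟩ :=
          map_add f ⟨x, hx⟩ ⟨y, hy⟩
        rw [this]
        exact C.add_mem (hx' p q) (hy' p q))
      (by
        rintro x ⟨hx, hx'⟩
        refine ⟨Submodule.neg_mem _ hx, fun p q => ?_⟩
        have : f ⟨-x, Submodule.neg_mem _ hx⟩ = -f ⟨x, hx⟩ := map_neg f ⟨x, hx⟩
        rw [this]
        exact C.neg_mem (hx' p q))
      (by
        rintro a y ⟨hy, hy'⟩
        have := hmul C y hy hy' a 1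
        simp only [mul_one] at this
        exact this)
      (by
        rintro y b ⟨hy, hy'⟩
        have := hmul C y hy hy' 1 b
        simp only [one_mul] at this
        exact this)
  have hI : ∀ C y, y ∈ I C ↔ ∃ hy : y ∈ D.peirce i j, ∀ p q, (fun t => f ⟨y, hy⟩ t p q) ∈ C :=
    fun C y => TwoSidedIdeal.mem_mk' _ _ _ _ _ _ _
  have hinf : ∀ C C' : Submodule k (Fin r → k), C ⊓ C' = ⊥ → ∀ y ∈ I C ⊓ I C', y = 0 := by
    intro C C' hCC y hy
    obtain ⟨h1, h2⟩ := (TwoSidedIdeal.mem_inf A).1 hy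
    obtain ⟨hy, h1⟩ := (hI _ _).1 h1
    obtain ⟨_, h2⟩ := (hI _ _).1 h2
    have : f ⟨y, hy⟩ = 0 := by
      funext t
      ext p q
      have h0 : (fun t => f ⟨y, hy⟩ t p q) ∈ C ⊓ C' := ⟨h1 p q, h2 p q⟩
      rw [hCC] at h0
      exact congrFun ((Submodule.mem_bot k).1 h0) t
    exact congrArg Subtype.val (f.map_eq_zero_iff.1 this)
  let G : Matrix (Fin (D.n i)) (Fin (D.n j)) k :=
    Matrix.single ⟨0, D.n_pos i⟩ ⟨0, D.n_pos j⟩ 1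
  let x : (Fin r → k) → D.peirce i j := fun w => f.symm fun t => w t • G
  have hx : ∀ C, ∀ w ∈ C, (x w : A) ∈ I C := by
    intro C w hw
    refine (hI _ _).2 ⟨(x w).2, fun p q => ?_⟩
    have : (fun t => f ⟨x w, (x w).2⟩ t p q) = G p q • w := by
      funext t
      simp [x, mul_comm]
    rw [this]
    exact C.smul_mem _ hw
  let t₀ : Fin r := ⟨0, by omega⟩
  let t₁ : Fin r := ⟨1, by omega⟩
  have ht : t₀ ≠ t₁ := by simp [t₀, t₁]
  let w₀ : Fin r → k := Pi.single t₀ 1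
  let w₁ : Fin r → k := Pi.single t₁ 1
  have hadd : (x (w₀ + w₁) : A) = x w₀ + x w₁ := by
    have : x (w₀ + w₁) = x w₀ + x w₁ := by
      simp only [x, ← map_add]
      congr 1
      funext t
      simp [add_smul]
    rw [this]
    rfl
  have hmem : (x (w₀ + w₁) : A) ∈ I (k ∙ (w₀ + w₁)) ⊓ (I (k ∙ w₀) ⊔ I (k ∙ w₁)) := by
    refine (TwoSidedIdeal.mem_inf A).2 ⟨hx _ _ (Submodule.mem_span_singleton_self _), ?_⟩
    exact TwoSidedIdeal.mem_sup.2 ⟨_, hx _ _ (Submodule.mem_span_singleton_self _), _,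
      hx _ _ (Submodule.mem_span_singleton_self _), hadd.symm⟩
  rw [hd] at hmem
  obtain ⟨y, hy, z, hz, hyz⟩ := TwoSidedIdeal.mem_sup.1 hmem
  have d0 : (k ∙ (w₀ + w₁)) ⊓ (k ∙ w₀) = ⊥ := by
    rw [eq_bot_iff]
    rintro v ⟨h1, h2⟩
    obtain ⟨c, rfl⟩ := Submodule.mem_span_singleton.1 h1
    obtain ⟨c', hc⟩ := Submodule.mem_span_singleton.1 h2
    have := congrFun hc t₁
    simp [w₀, w₁, ht.symm] at this
    simp [← this]
  have d1 : (k ∙ (w₀ + w₁)) ⊓ (k ∙ w₁) = ⊥ := by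
    rw [eq_bot_iff]
    rintro v ⟨h1, h2⟩
    obtain ⟨c, rfl⟩ := Submodule.mem_span_singleton.1 h1
    obtain ⟨c', hc⟩ := Submodule.mem_span_singleton.1 h2
    have := congrFun hc t₀
    simp [w₀, w₁, ht] at this
    simp [← this]
  rw [hinf _ _ d0 y hy, hinf _ _ d1 z hz, add_zero] at hyz
  have h0 : x (w₀ + w₁) = 0 := Subtype.ext hyz.symm
  have h1 : (fun t => (w₀ + w₁) t • G) = 0 := f.symm.map_eq_zero_iff.1 h0
  have h2 := congrFun (congrFun (congrFun h1 t₀) ⟨0, D.n_pos i⟩) ⟨0, D.n_pos j⟩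
  simp [w₀, w₁, ht, G] at h2

end WedderburnData

/-! ### Incidence algebras of square-zero relations -/

section IncidenceAlgebra

variable {l : ℕ}

/-- The algebra of block matrices, with blocks of sizes `n i`, whose block at `(i, j)` vanishes
unless `i = j` or `R i j`. Products are again of this form since no two pairs in `R` are
composable. -/
def incidenceAlgebra (k : Type u) [Field k] (n : Fin l → ℕ) (R : Fin l → Fin l → Prop)
    (hR : ∀ i j m, R i j → ¬ R j m) :
    Subalgebra k (Matrix (Σ i, Fin (n i)) (Σ i, Fin (n i)) k) where
  carrier := {X | ∀ p q, X p q ≠ 0 → p.1 = q.1 ∨ R p.1 q.1}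
  mul_mem' := by
    intro X Y hX hY p q h
    obtain ⟨r, -, hr⟩ := Finset.exists_ne_zero_of_sum_ne_zero h
    have h1 := hX _ _ (left_ne_zero_of_mul hr)
    have h2 := hY _ _ (right_ne_zero_of_mul hr)
    rcases h1 with h1 | h1
    · rwa [h1]
    · rcases h2 with h2 | h2
      · exact Or.inr (h2 ▸ h1)
      · exact absurd h2 (hR _ _ _ h1)
  add_mem' := by
    intro X Y hX hY p q h
    by_cases hp : X p q = 0
    · refine hY p q fun h0 => h ?_
      rw [Matrix.add_apply, hp, h0, add_zero]
    · exact hX p q hp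
  algebraMap_mem' := by
    intro c p q h
    classical
    rw [Matrix.algebraMap_matrix_apply] at h
    by_cases hpq : p = q
    · exact Or.inl (congrArg _ hpq)
    · exact absurd (if_neg hpq) h

namespace incidenceAlgebra

variable {k : Type u} [Field k] {n : Fin l → ℕ} {R : Fin l → Fin l → Prop}
  {hR : ∀ i j m, R i j → ¬ R j m}

/-- The projection to the diagonal blocks. -/
def diag (k : Type u) [Field k] (n : Fin l → ℕ) (R : Fin l → Fin l → Prop)
    (hR : ∀ i j m, R i j → ¬ R j m) :
    incidenceAlgebra k n R hR →ₐ[k] (∀ i, Matrix (Fin (n i)) (Fin (n i)) k) where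
  toFun X i := Matrix.of fun a b => X.1 ⟨i, a⟩ ⟨i, b⟩
  map_one' := by
    funext i
    exact Matrix.submatrix_one (α := k) (Sigma.mk (β := fun i => Fin (n i)) i) sigma_mk_injective
  map_zero' := rfl
  map_add' _ _ := rfl
  map_mul' X Y := by
    funext i
    ext a b
    change ∑ r, X.1 ⟨i, a⟩ r * Y.1 r ⟨i, b⟩ = ∑ c, X.1 ⟨i, a⟩ ⟨i, c⟩ * Y.1 ⟨i, c⟩ ⟨i, b⟩
    rw [Fintype.sum_sigma]
    refine Finset.sum_eq_single i (fun j _ hj => Finset.sum_eq_zero fun c _ => ?_)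
      fun h => absurd (Finset.mem_univ i) h
    by_contra h
    rcases X.2 _ _ (left_ne_zero_of_mul h) with h1 | h1
    · exact hj h1.symm
    · rcases Y.2 _ _ (right_ne_zero_of_mul h) with h2 | h2
      · exact hj h2
      · exact hR _ _ _ h1 h2
  commutes' c := by
    funext i
    ext a b
    change algebraMap k (Matrix (Σ i, Fin (n i)) (Σ i, Fin (n i)) k) c ⟨i, a⟩ ⟨i, b⟩ =
      algebraMap k (Matrix (Fin (n i)) (Fin (n i)) k) c a b
    simp [Matrix.algebraMap_matrix_apply, sigma_mk_injective.eq_iff]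

/-- The block diagonal matrices, as a section of the projection to the diagonal blocks. -/
def ofDiag (hR : ∀ i j m, R i j → ¬ R j m) (s : ∀ i, Matrix (Fin (n i)) (Fin (n i)) k) :
    incidenceAlgebra k n R hR :=
  ⟨Matrix.blockDiagonal' s, fun p q h => Or.inl (by
    by_contra hpq
    exact h (dif_neg hpq))⟩

lemma diag_apply (X : incidenceAlgebra k n R hR) (i : Fin l) (a b : Fin (n i)) :
    diag k n R hR X i a b = X.1 ⟨i, a⟩ ⟨i, b⟩ := rfl

lemma diag_ofDiag (s : ∀ i, Matrix (Fin (n i)) (Fin (n i)) k) :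
    diag k n R hR (ofDiag hR s) = s := by
  funext i
  ext a b
  rw [diag_apply]
  exact Matrix.blockDiagonal'_apply_eq s i a b

lemma ofDiag_mul (s t : ∀ i, Matrix (Fin (n i)) (Fin (n i)) k) :
    ofDiag hR s * ofDiag hR t = ofDiag hR (s * t) :=
  Subtype.ext (Matrix.blockDiagonal'_mul s t).symm

lemma diag_surjective : Function.Surjective (diag k n R hR) := fun s => ⟨_, diag_ofDiag s⟩

lemma diag_eq_zero_iff {X : incidenceAlgebra k n R hR} :
    diag k n R hR X = 0 ↔ ∀ p q, X.1 p q ≠ 0 → R p.1 q.1 := by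
  constructor
  · rintro h ⟨i, a⟩ ⟨j, b⟩ hX
    rcases X.2 _ _ hX with h1 | h1
    · change i = j at h1
      subst h1
      have h0 := congrFun (congrFun (congrFun h i) a) b
      rw [diag_apply] at h0
      exact absurd h0 hX
    · exact h1
  · intro h
    funext i
    ext a b
    rw [diag_apply]
    by_contra hX
    have := h ⟨i, a⟩ ⟨i, b⟩ hX
    exact hR _ _ _ this this

lemma mul_eq_zero_of_diag_eq_zero {X Y : incidenceAlgebra k n R hR} (hX : diag k n R hR X = 0)
    (hY : diag k n R hR Y = 0) : X * Y = 0 := by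
  apply Subtype.ext
  ext p q
  refine Finset.sum_eq_zero fun r _ => ?_
  by_contra h
  exact hR _ _ _ (diag_eq_zero_iff.1 hX _ _ (left_ne_zero_of_mul h))
    (diag_eq_zero_iff.1 hY _ _ (right_ne_zero_of_mul h))

/-- The radical consists of the matrices with zero diagonal blocks: they form an ideal with square
zero and semisimple quotient. -/
lemma mem_jacobson_iff {X : incidenceAlgebra k n R hR} :
    X ∈ Ring.jacobson (incidenceAlgebra k n R hR) ↔ diag k n R hR X = 0 := by
  constructor
  · intro h
    have : RingHomSurjective (diag k n R hR).toRingHom := ⟨diag_surjective⟩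
    have := Ring.le_comap_jacobson (diag k n R hR).toRingHom h
    rw [Ideal.mem_comap, IsSemisimpleRing.jacobson_eq_bot] at this
    exact this
  · intro h
    rw [Ring.jacobson_eq_sInf_isMaximal, Ideal.mem_sInf]
    intro m hm
    by_contra hX
    obtain ⟨a, y, hy, hay⟩ := hm.exists_inv hX
    have h1 : X = X * y := by
      have h2 : X * (a * X) = 0 := by
        refine mul_eq_zero_of_diag_eq_zero h ?_
        rw [map_mul, h, mul_zero]
      calc X = X * (a * X + y) := by rw [hay, mul_one]
        _ = X * y := by rw [mul_add, h2, zero_add]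
    exact hX (h1 ▸ m.mul_mem_left X hy)

lemma radSquareZero : RadSquareZero (incidenceAlgebra k n R hR) := fun _ hX _ hY =>
  mul_eq_zero_of_diag_eq_zero (mem_jacobson_iff.1 hX) (mem_jacobson_iff.1 hY)

/-- The matrix with the single entry `c` at an admissible position. -/
def single (hR : ∀ i j m, R i j → ¬ R j m) (p q : Σ i, Fin (n i)) (h : p.1 = q.1 ∨ R p.1 q.1)
    (c : k) : incidenceAlgebra k n R hR :=
  ⟨Matrix.single p q c, fun p' q' h' => by
    rw [Matrix.single_apply] at h'
    have := (ite_ne_right_iff.1 h').1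
    rw [← this.1, ← this.2]
    exact h⟩

/-- A two-sided ideal contains all matrix units at the positions where some element of it has a
nonzero entry. -/
lemma single_mem (I : TwoSidedIdeal (incidenceAlgebra k n R hR)) {X : incidenceAlgebra k n R hR}
    (hX : X ∈ I) {p q : Σ i, Fin (n i)} (hpq : X.1 p q ≠ 0) (c : k) :
    single hR p q (X.2 _ _ hpq) c ∈ I := by
  have : single hR p q (X.2 _ _ hpq) c =
      single hR p p (Or.inl rfl) (c * (X.1 p q)⁻¹) * X * single hR q q (Or.inl rfl) 1 := by
    apply Subtype.ext
    change Matrix.single p q c = Matrix.single p p _ * X.1 * Matrix.single q q 1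
    rw [Matrix.single_mul_mul_single, mul_one, inv_mul_cancel_right₀ hpq]
  rw [this]
  exact I.mul_mem_right _ _ (I.mul_mem_left _ _ hX)

/-- Two-sided ideals are spanned by matrix units, so their lattice embeds into a lattice of
subsets. -/
lemma idealsDistributive : IdealsDistributive (incidenceAlgebra k n R hR) := by
  classical
  intro I J K
  refine le_antisymm (fun X hX => ?_) le_inf_sup
  obtain ⟨hI, hJK⟩ := (TwoSidedIdeal.mem_inf _).1 hX
  obtain ⟨Y, hY, Z, hZ, rfl⟩ := TwoSidedIdeal.mem_sup.1 hJK
  have hsum : Y + Z = ∑ p, ∑ q, if h : (Y + Z).1 p q ≠ 0 then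
      single hR p q ((Y + Z).2 _ _ h) ((Y + Z).1 p q) else 0 := by
    apply Subtype.ext
    conv_lhs => rw [Matrix.matrix_eq_sum_single (Y + Z).1]
    simp only [AddSubmonoidClass.coe_finsetSum]
    refine Finset.sum_congr rfl fun p _ => Finset.sum_congr rfl fun q _ => ?_
    split_ifs with h
    · rfl
    · rw [not_not.1 h, Matrix.single_zero]
      rfl
  rw [hsum]
  refine sum_mem fun p _ => sum_mem fun q _ => ?_
  split_ifs with h
  · by_cases hYpq : Y.1 p q = 0
    · have hZpq : Z.1 p q ≠ 0 := fun h0 => h (by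
        change Y.1 p q + Z.1 p q = 0
        rw [hYpq, h0, add_zero])
      exact TwoSidedIdeal.mem_sup_right ((TwoSidedIdeal.mem_inf _).2
        ⟨single_mem I hI h _, single_mem K hZ hZpq _⟩)
    · exact TwoSidedIdeal.mem_sup_left ((TwoSidedIdeal.mem_inf _).2
        ⟨single_mem I hI h _, single_mem J hY hYpq _⟩)
  · exact zero_mem _

/-- The blocks on the diagonal as data for the quiver setting. -/
noncomputable def wedderburnData (k : Type u) [Field k] (n : Fin l → ℕ) (hn : ∀ i, 0 < n i)
    (R : Fin l → Fin l → Prop) (hR : ∀ i j m, R i j → ¬ R j m) :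
    WedderburnData k (incidenceAlgebra k n R hR) where
  l := l
  n := n
  n_pos := hn
  φ := (Ideal.quotientEquivAlgOfEq k (by
      ext X
      exact mem_jacobson_iff)).trans
    (Ideal.quotientKerAlgEquivOfSurjective (f := diag k n R hR) diag_surjective)
  e i := ofDiag hR (Pi.single i 1)
  e_idem i := by
    rw [IsIdempotentElem, ofDiag_mul, ← Pi.single_mul, mul_one]
  e_lift i := by
    refine Eq.trans ?_ (diag_ofDiag (hR := hR) _)
    rfl

lemma coe_ofDiag_single (i : Fin l) :
    (ofDiag (k := k) hR (Pi.single i (1 : Matrix (Fin (n i)) (Fin (n i)) k))).1 =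
      Matrix.diagonal fun p => if p.1 = i then 1 else 0 := by
  refine Eq.trans (congrArg Matrix.blockDiagonal' ?_) (Matrix.blockDiagonal'_diagonal
    fun j (_ : Fin (n j)) => if j = i then (1 : k) else 0)
  funext j
  by_cases hj : j = i
  · subst hj
    simp
  · simp [hj]

lemma ofDiag_single_mul_mul_apply (i j : Fin l) (X : incidenceAlgebra k n R hR)
    (p q : Σ i, Fin (n i)) :
    (ofDiag hR (Pi.single i 1) * X * ofDiag hR (Pi.single j 1)).1 p q =
      if p.1 = i ∧ q.1 = j then X.1 p q else 0 := by
  change ((ofDiag hR (Pi.single i (1 : Matrix (Fin (n i)) (Fin (n i)) k))).1 * X.1 *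
    (ofDiag hR (Pi.single j (1 : Matrix (Fin (n j)) (Fin (n j)) k))).1 :
      Matrix (Σ i, Fin (n i)) (Σ i, Fin (n i)) k) p q = _
  rw [coe_ofDiag_single, coe_ofDiag_single, Matrix.mul_diagonal, Matrix.diagonal_mul]
  split_ifs with h1 h2 h3 <;> simp_all

variable {hn : ∀ i, 0 < n i}

lemma mem_peirce_wedderburnData {i j : Fin l} {Y : incidenceAlgebra k n R hR} :
    Y ∈ (wedderburnData k n hn R hR).peirce i j ↔
      ∃ X : incidenceAlgebra k n R hR, (∀ p q, X.1 p q ≠ 0 → R p.1 q.1) ∧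
        ∀ p q, Y.1 p q = if p.1 = i ∧ q.1 = j then X.1 p q else 0 := by
  refine (WedderburnData.mem_peirce _).trans (exists_congr fun X => ?_)
  refine and_congr (mem_jacobson_iff.trans diag_eq_zero_iff) ?_
  constructor
  · rintro rfl p q
    exact ofDiag_single_mul_mul_apply i j X p q
  · intro h
    apply Subtype.ext
    ext p q
    exact (ofDiag_single_mul_mul_apply i j X p q).trans (h p q).symm

/-- The quiver of the algebra has arrows `(1, j) ⟶ (0, i)` exactly for the pairs with `R i j`. -/
lemma rank_ne_zero_iff {i j : Fin l} : (wedderburnData k n hn R hR).rank i j ≠ 0 ↔ R i j := by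
  obtain ⟨f, -⟩ := WedderburnData.isBimoduleRank_rank radSquareZero (wedderburnData k n hn R hR) i j
  constructor
  · intro h
    by_contra hij
    have hbot : ∀ Y : (wedderburnData k n hn R hR).peirce i j, Y = 0 := by
      rintro ⟨Y, hY⟩
      obtain ⟨X, hX, hXY⟩ := mem_peirce_wedderburnData.1 hY
      apply Subtype.ext
      apply Subtype.ext
      ext p q
      refine (hXY p q).trans (ite_eq_right_iff.2 fun hpq => ?_)
      by_contra h0
      exact hij (hpq.1 ▸ hpq.2 ▸ hX p q h0)
    have h1 := f.symm.injective ((hbot (f.symm fun _ =>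
      Matrix.single ⟨0, hn i⟩ ⟨0, hn j⟩ 1)).trans (hbot (f.symm 0)).symm)
    have h2 := congrFun (congrFun (congrFun h1 ⟨0, Nat.pos_of_ne_zero h⟩) ⟨0, hn i⟩) ⟨0, hn j⟩
    rw [Matrix.single_apply_same] at h2
    exact one_ne_zero h2
  · intro hij h
    have hx : single hR ⟨i, 0, hn i⟩ ⟨j, 0, hn j⟩ (Or.inr hij) (1 : k) ∈
        (wedderburnData k n hn R hR).peirce i j := by
      refine mem_peirce_wedderburnData.2
        ⟨single hR ⟨i, 0, hn i⟩ ⟨j, 0, hn j⟩ (Or.inr hij) 1, ?_, ?_⟩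
      · intro p q h'
        change Matrix.single _ _ (1 : k) p q ≠ 0 at h'
        rw [Matrix.single_apply] at h'
        have := (ite_ne_right_iff.1 h').1
        rw [← this.1, ← this.2]
        exact hij
      · intro p q
        split_ifs with hpq
        · rfl
        · change Matrix.single _ _ (1 : k) p q = 0
          rw [Matrix.single_apply, if_neg]
          rintro ⟨rfl, rfl⟩
          exact hpq ⟨rfl, rfl⟩
    have h0 : (⟨_, hx⟩ : (wedderburnData k n hn R hR).peirce i j) = 0 := by
      apply f.injective
      funext t
      exact (Fin.cast h t).elim0
    have h1 := congrArg (fun X => X.1.1 ⟨i, 0, hn i⟩ ⟨j, 0, hn j⟩) h0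
    exact one_ne_zero ((Matrix.single_apply_same _ _ (1 : k)).symm.trans h1)

/-- If `s` identifies the example with the pairs of `R`, regarded as arrows `(1, j) ⟶ (0, i)`, then
it identifies the example with the quiver of the algebra. -/
lemma isExampleQuiver {s : ExVertex → (wedderburnData k n hn R hR).Vertex}
    (hs : Function.Injective s)
    (hR' : ∀ i j, R i j ↔ ∃ p q, Nonempty (ExArrow p q) ∧ s p = .one j ∧ s q = .zero i)
    (hzero : ∀ p q, ExArrow p q → (∃ j, s p = .one j) ∧ ∃ i, s q = .zero i) :
    IsExampleQuiver s where
  inj := hs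
  hom_iff x y := by
    constructor
    · rintro ⟨⟨i, j, m⟩⟩
      exact (hR' i j).1 (rank_ne_zero_iff.1 fun h => (Fin.cast h m).elim0)
    · rintro ⟨p, q, ⟨α⟩, rfl, rfl⟩
      obtain ⟨⟨j, hj⟩, i, hi⟩ := hzero p q α
      rw [hj, hi]
      exact ⟨.mk i j ⟨0, Nat.pos_of_ne_zero (rank_ne_zero_iff.2 ((hR' i j).2 ⟨p, q, ⟨α⟩, hj, hi⟩))⟩⟩
  subsingleton := by
    rintro x y
    refine ⟨?_⟩
    rintro ⟨i, j, m⟩ ⟨_, _, m'⟩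
    have h1 := WedderburnData.rank_le_one radSquareZero idealsDistributive
      (wedderburnData k n hn R hR) i j
    congr 1
    ext
    omega

end incidenceAlgebra

end IncidenceAlgebra

/-! ### The algebra containing the example -/

/-- The sizes of the blocks: the factors `0, 1, 2, 3, 4` correspond to the vertices `a, b, c, u, v`
of the example. -/
def exSize : Fin 5 → ℕ := ![2, 1, 1, 1, 2]

/-- The relation with the pairs `(u, a)`, `(v, a)`, `(v, b)`, `(v, c)`. -/
def ExRel (i j : Fin 5) : Prop := (i = 3 ∧ j = 0) ∨ (i = 4 ∧ j ≤ 2)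

lemma exRel_not_composable (i j m : Fin 5) (hij : ExRel i j) : ¬ ExRel j m := by
  revert i j m
  unfold ExRel
  decide

lemma exSize_pos : ∀ i, 0 < exSize i := by
  decide

/-- The data for the algebra containing the example. -/
noncomputable def exData (k : Type u) [Field k] :
    WedderburnData k (incidenceAlgebra k exSize ExRel exRel_not_composable) :=
  incidenceAlgebra.wedderburnData k exSize exSize_pos ExRel exRel_not_composable

/-- The sources of the example are vertices `(1, j)`, its sinks are vertices `(0, i)`. -/
def exEmbedding (k : Type u) [Field k] : ExVertex → (exData k).Vertex
  | .a => .one (0 : Fin 5)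
  | .b => .one (1 : Fin 5)
  | .c => .one (2 : Fin 5)
  | .u => .zero (3 : Fin 5)
  | .v => .zero (4 : Fin 5)

lemma isExampleQuiver_exEmbedding (k : Type u) [Field k] : IsExampleQuiver (exEmbedding k) := by
  have one_inj : ∀ {i j : Fin 5}, (WedderburnData.Vertex.one i : (exData k).Vertex) = .one j →
      i = j := fun h => WedderburnData.Vertex.one.inj h
  have zero_inj : ∀ {i j : Fin 5}, (WedderburnData.Vertex.zero i : (exData k).Vertex) = .zero j →
      i = j := fun h => WedderburnData.Vertex.zero.inj h
  refine incidenceAlgebra.isExampleQuiver ?_ ?_ ?_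
  · intro p q h
    cases p <;> cases q <;> first
      | rfl
      | exact absurd (one_inj h) (by decide)
      | exact absurd (zero_inj h) (by decide)
      | exact (nomatch (h : (WedderburnData.Vertex.zero _ : (exData k).Vertex) = .one _))
      | exact (nomatch (h : (WedderburnData.Vertex.one _ : (exData k).Vertex) = .zero _))
  · intro i j
    constructor
    · rintro (⟨rfl, rfl⟩ | ⟨rfl, hj⟩)
      · exact ⟨.a, .u, ⟨.au⟩, rfl, rfl⟩
      · have : j = 0 ∨ j = 1 ∨ j = 2 := by
          revert j
          decide
        rcases this with rfl | rfl | rfl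
        · exact ⟨.a, .v, ⟨.av⟩, rfl, rfl⟩
        · exact ⟨.b, .v, ⟨.bv⟩, rfl, rfl⟩
        · exact ⟨.c, .v, ⟨.cv⟩, rfl, rfl⟩
    · rintro ⟨p, q, ⟨α⟩, hp, hq⟩
      cases α <;> rw [← one_inj hp, ← zero_inj hq] <;> unfold ExRel <;> decide
  · rintro p q α
    cases α <;> exact ⟨⟨_, rfl⟩, _, rfl⟩

theorem mainTheorem5 (k : Type u) [Field k] [IsAlgClosed k] :
    -- the example is representation finite, and violates only condition (3)
    (RepresentationFinite k exDim ∧ ORCond1 exDim ∧ ORCond2 exDim ∧ ¬ ORCond3 exDim) ∧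
    -- the three conditions are sufficient for finitely many orbits
    (∀ (A : Type v) [Ring A] [Algebra k A] [FiniteDimensional k A],
      RadSquareZero A → IdealsDistributive A → ∀ D : WedderburnData k A,
        ORCond1 D.dim → ORCond2 D.dim → ORCond3 D.dim → FinitelyManyUnitOrbits A) ∧
    -- they are not necessary, because of an algebra whose setting contains the example
    (∃ (A : Type u) (_ : Ring A) (_ : Algebra k A) (_ : FiniteDimensional k A)
      (D : WedderburnData k A), RadSquareZero A ∧ IdealsDistributive A ∧
        FinitelyManyUnitOrbits A ∧ SettingLE exDim D.dim ∧
        ORCond1 D.dim ∧ ORCond2 D.dim ∧ ¬ ORCond3 D.dim) ∧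
    -- hence the asserted equivalence is false
    ¬ (∀ (A : Type u) [Ring A] [Algebra k A] [FiniteDimensional k A],
      RadSquareZero A → IdealsDistributive A → ∀ D : WedderburnData k A,
        (FinitelyManyUnitOrbits A ↔ ORCond1 D.dim ∧ ORCond2 D.dim ∧ ORCond3 D.dim)) := by
  have hid := isExampleQuiver_id
  have hs := isExampleQuiver_exEmbedding k
  have hA : RadSquareZero (incidenceAlgebra k exSize ExRel exRel_not_composable) :=
    incidenceAlgebra.radSquareZero
  have hd : IdealsDistributive (incidenceAlgebra k exSize ExRel exRel_not_composable) :=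
    incidenceAlgebra.idealsDistributive
  have hfin : FinitelyManyUnitOrbits (incidenceAlgebra k exSize ExRel exRel_not_composable) := by
    have := WedderburnData.finite_vertex (exData k)
    exact WedderburnData.finitelyManyUnitOrbits hA
      (WedderburnData.isBimoduleRank_rank hA (exData k))
      (WedderburnData.rank_le_one hA hd (exData k)) fun m hm => hs.repFinite (hm (4 : Fin 5))
  have hcond : ¬ ORCond3 (exData k).dim := hs.not_orCond3 le_rfl le_rfl
  refine ⟨⟨(hid.repFinite (k := k) le_rfl).representationFinite hid.subsingleton, hid.orCond1 _,
    hid.orCond2 _, hid.not_orCond3 le_rfl le_rfl⟩, ?_, ?_, ?_⟩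
  · intro A _ _ _ h hdist D h1 h2 h3
    have := WedderburnData.finite_vertex D
    refine WedderburnData.finitelyManyUnitOrbits h (WedderburnData.isBimoduleRank_rank h D)
      (WedderburnData.rank_le_one h hdist D) fun m hm =>
        repFinite_of_conditions D.arrowBipartite (d := D.dim) ?_ h1 h2 h3
    rintro (i | i)
    · exact hm i
    · exact hm i
  · exact ⟨_, _, _, inferInstance, exData k, hA, hd, hfin,
      hs.settingLE (by rintro (_ | _ | _ | _ | _) <;> exact le_rfl),
      hs.orCond1 _, hs.orCond2 _, hcond⟩
  · intro h
    exact hcond ((h _ hA hd (exData k)).1 hfin).2.2
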